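/- Let $\mathbb T=\mathbb R/2\pi\mathbb Z$, $\mathcal H=L^2([0,\pi]\times\mathbb T)$ with norm $\|\cdot\|$, $u^+=\max\{u,0\}$, $u^-=u^+-u$, and $\Box=\partial_t^2-\partial_s^2$. For integers $m\ge 1$, $n\ge 0$ put $\phi_{(m,n)}=\frac{\sqrt2}{\pi}\sin(ms)\cos(nt)$, $\psi_{(m,n)}=\frac{\sqrt2}{\pi}\sin(ms)\sin(nt)$; these are eigenfunctions of $\Box$ (with $u=0$ at $s=0,\pi$) for the eigenvalue $m^2-n^2$. Let $\dots<\lambda_{-1}<\lambda_0=0<\lambda_1<\dots$ be the increasing enumeration of the set $\{m^2-n^2: m\ge1,\ n\ge0\}$. Let $\mathcal R$ be the closed linear span in $\mathcal H$ of the $\phi_{(m,n)},\psi_{(m,n)}$ with $m\ne n$, $\mathcal N$ the closed linear span of those with $m=n$, and let $\mathcal H^1$ be the space of all $x\in\mathcal R\cap H^1([0,\pi]\times\mathbb T)$ with zero trace on $s=0$ and $s=\pi$, with the $H^1$ norm. Fix an integer $k$ with $\lambda_k\ne0$. **The curve $\mathcal D_k$.** Let $0<\varepsilon_3<\lambda_{k+1}-\lambda_k$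 and $0<\varepsilon_4<\frac1{\lambda_{k+1}-\lambda_k-\varepsilon_3}-\max\{0,\frac1{\lambda_{k+1}-\varepsilon_3}\}$, and set $\rho=\max\{0,\frac1{\lambda_{k+1}-\varepsilon_3}\}+\varepsilon_4$. Let $M:\mathcal H\to\mathcal H$ be the bounded operator with $M\phi_{(m,n)}=\frac{\phi_{(m,n)}}{\lambda_{k+1}-\varepsilon_3-m^2+n^2}$ and $M\psi_{(m,n)}=\frac{\psi_{(m,n)}}{\lambda_{k+1}-\varepsilon_3-m^2+n^2}$ for all $m\ge1$, $n\ge0$. For $r>0$ let $$\tilde a(r)=\sup_{0\ne v\in\mathcal H}\frac{\langle (M-\rho)v,v\rangle}{\|v^+\|^2+r\|v^-\|^2}.$$ In the open square $R_k(\varepsilon_3,\varepsilon_4)=\,]\lambda_{k+1}-\varepsilon_3-\frac1\rho,\ \lambda_{k+1}-\varepsilon_3[^2$ the curve $\mathcal D_k$ is $$\Bigl\{\Bigl(\lambda_{k+1}-\varepsilon_3-\frac1{\tilde a(r)+\rho},\ \lambda_{k+1}-\varepsilon_3-\frac1{r\tilde a(r)+\rho}\Bigr): r>0\Bigr\},$$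 and a point of $R_k(\varepsilon_3,\varepsilon_4)$ is above $\mathcal D_k$ if it lies in the connected component of $R_k(\varepsilon_3,\varepsilon_4)\setminus\mathcal D_k$ that contains $]\lambda_k,\lambda_{k+1}-\varepsilon_3[^2$. Let $\tilde R_k=\,]-\infty,\lambda_{k+1}[^2$ if $\lambda_k<0$ and $\tilde R_k=\,]0,\lambda_{k+1}[^2$ if $\lambda_k>0$. These squares $R_k(\varepsilon_3,\varepsilon_4)$ exhaust $\tilde R_k$ as $\varepsilon_3,\varepsilon_4\to0$ and the curves in them agree on common squares; a point of $\tilde R_k$ is said to be above $\mathcal D_k$ if, for some admissible $\varepsilon_3,\varepsilon_4$, it belongs to $R_k(\varepsilon_3,\varepsilon_4)$ and is above $\mathcal D_k$ there. **Weak solutions.** For $a,b\in\mathbb R$ and continuous $p:[0,\pi]\times\mathbb T\times\mathbb R\to\mathbb R$ let $P(s,t,\xi)=\int_0^\xi p(s,t,\tau)\,d\tau$. A weak solution of $$\Box u=au^+-bu^-+p(s,t,u)\ \text{ in } ]0,\pi[\times\mathbb T,\qquad u(0,t)=u(\pi,t)=0,\tag{1}$$ is a function $u=x+y$ such that $(x,y)\in\mathcal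 H^1\times\mathcal N$ is a critical point of $$\mathcal I(x,y)=\tfrac12\bigl(\|x_s\|^2-\|x_t\|^2-a\|(x+y)^+\|^2-b\|(x+y)^-\|^2\bigr)-\iint_{[0,\pi]\times\mathbb T}P(s,t,x+y)\,ds\,dt .$$ **Theorem.** Let $(a,b)\in\tilde R_k$ lie above $\mathcal D_k$. Let $p:[0,\pi]\times\mathbb T\times\mathbb R\to\mathbb R$ be continuous with $\lim_{|u|\to\infty}p(s,t,u)/u=0$ uniformly in $(s,t)$, and suppose that (increasing and decreasing being understood in the wide sense): * (H1$'$) there is $\underline\varepsilon_0>0$ such that for each $(s,t)$ the function $u\mapsto au^+-bu^-+p(s,t,u)-(\lambda_{k+1}-\underline\varepsilon_0)u$ is decreasing; * (H2$'$) if $\lambda_k>0$, there is $\overline\varepsilon_0>0$ such that for each $(s,t)$ the function $u\mapsto au^+-bu^-+p(s,t,u)-\overline\varepsilon_0u$ is increasing; * (H3$'$) if $\lambda_k<0$, there is $\overline\varepsilon_0>0$ such that for each $(s,t)$ the function $u\mapsto p(s,t,u)+\frac1{\overline\varepsilon_0}u$ is increasing. Then problem (1) has a weak solution. -/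

import Mathlib

namespace WaveFucik

open MeasureTheory Real Filter Topology
open scoped ContDiff ENNReal

noncomputable section

/-! ## The strip `[0,π] × 𝕋` and the space `L²` on it -/

instance factTwoPiPos : Fact (0 < 2 * π) := ⟨Real.two_pi_pos⟩

/-- The circle `𝕋 = ℝ / 2πℤ`. -/
abbrev Circ : Type := AddCircle (2 * π)

/-- The closed strip `[0,π] × 𝕋`, with points `(s, t)`. -/
abbrev Strip : Type := Set.Icc (0 : ℝ) π × Circ

/-- Lebesgue measure `ds` on the interval `[0,π]`. -/
def intervalMeasure : Measure (Set.Icc (0 : ℝ) π) :=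
  Measure.comap (Subtype.val : Set.Icc (0 : ℝ) π → ℝ) volume

instance : IsFiniteMeasure intervalMeasure := by
  refine ⟨?_⟩
  rw [intervalMeasure,
    (MeasurableEmbedding.subtype_coe measurableSet_Icc).comap_apply]
  refine lt_of_le_of_lt (measure_mono (t := Set.Icc (0 : ℝ) π) ?_) measure_Icc_lt_top
  rintro _ ⟨x, -, rfl⟩
  exact x.2

/-- Lebesgue measure `ds dt` on the strip, of total mass `2π²`. -/
def stripMeasure : Measure Strip := intervalMeasure.prod (volume : Measure Circ)

instance : IsFiniteMeasure stripMeasure := by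
  unfold stripMeasure; infer_instance

/-- The real Hilbert space `L²([0,π] × 𝕋)`. -/
abbrev L2Strip : Type := Lp ℝ 2 stripMeasure

/-! ## Eigenfunctions and eigenvalues of the wave operator -/

/-- The function `(√2/π) sin(m s) cos(n t)`. -/
def phiFun (m n : ℕ) : C(Strip, ℝ) where
  toFun z := √2 / π * Real.sin (m * (z.1 : ℝ)) * (fourier (n : ℤ) z.2 : ℂ).re
  continuous_toFun := by fun_prop

/-- The function `(√2/π) sin(m s) sin(n t)`. -/
def psiFun (m n : ℕ) : C(Strip, ℝ) where
  toFun z := √2 / π * Real.sin (m * (z.1 : ℝ)) * (fourier (n : ℤ) z.2 : ℂ).im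
  continuous_toFun := by fun_prop

theorem fourier_coe_eq (n : ℤ) (t : ℝ) :
    (fourier n (t : Circ) : ℂ) = Complex.exp (((n * t : ℝ) : ℂ) * Complex.I) := by
  rw [fourier_coe_apply]
  congr 1
  have : (π : ℂ) ≠ 0 := by exact_mod_cast Real.pi_ne_zero
  push_cast
  field_simp

theorem phiFun_apply (m n : ℕ) (s : Set.Icc (0 : ℝ) π) (t : ℝ) :
    phiFun m n (s, (t : Circ)) = √2 / π * Real.sin (m * s) * Real.cos (n * t) := by
  simp only [phiFun, ContinuousMap.coe_mk]
  rw [fourier_coe_eq, Complex.exp_ofReal_mul_I_re]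
  simp

theorem psiFun_apply (m n : ℕ) (s : Set.Icc (0 : ℝ) π) (t : ℝ) :
    psiFun m n (s, (t : Circ)) = √2 / π * Real.sin (m * s) * Real.sin (n * t) := by
  simp only [psiFun, ContinuousMap.coe_mk]
  rw [fourier_coe_eq, Complex.exp_ofReal_mul_I_im]
  simp

/-- `φ_{(m,n)}` as an element of `L²`. -/
def phi (m n : ℕ) : L2Strip := ContinuousMap.toLp 2 stripMeasure ℝ (phiFun m n)

/-- `ψ_{(m,n)}` as an element of `L²`. -/
def psi (m n : ℕ) : L2Strip := ContinuousMap.toLp 2 stripMeasure ℝ (psiFun m n)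

/-- `z` is one of the eigenvalues `m² - n²`, `m ≥ 1`, `n ≥ 0`, of `□ = ∂_t² - ∂_s²`. -/
def IsWaveEigenvalue (z : ℤ) : Prop :=
  ∃ m n : ℕ, 1 ≤ m ∧ z = (m : ℤ) ^ 2 - (n : ℤ) ^ 2

/-- The increasing enumeration `… < λ₋₂ < λ₋₁ < λ₀ = 0 < λ₁ < λ₂ < …` of the eigenvalues:
`Nat.nth P k` is the `k`-th element (counted from `0`) of the set of natural numbers with
property `P`, and `0` is an eigenvalue. -/
def eigInt : ℤ → ℤ
  | Int.ofNat k => (Nat.nth (fun j : ℕ => IsWaveEigenvalue (j : ℤ)) k : ℤ)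
  | Int.negSucc k => -(Nat.nth (fun j : ℕ => IsWaveEigenvalue (-(j : ℤ))) (k + 1) : ℤ)

/-- The eigenvalue `λ_k` as a real number. -/
def eig (k : ℤ) : ℝ := (eigInt k : ℝ)

/-- The closed span `ℛ` of the eigenfunctions with `m ≠ n`. -/
def rangeSpace : Submodule ℝ L2Strip :=
  (Submodule.span ℝ
    {e | ∃ m n : ℕ, 1 ≤ m ∧ m ≠ n ∧ (e = phi m n ∨ e = psi m n)}).topologicalClosure

/-- The closed span `𝒩` of the eigenfunctions with `m = n`: the kernel of `□`. -/
def kernelSpace : Submodule ℝ L2Strip :=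
  (Submodule.span ℝ
    {e | ∃ l : ℕ, 1 ≤ l ∧ (e = phi l l ∨ e = psi l l)}).topologicalClosure

/-! ## The Sobolev space `ℋ¹` -/

/-- The inclusion `[0,π] × 𝕋 → ℝ × 𝕋`. -/
def incl (z : Strip) : ℝ × Circ := ((z.1 : ℝ), z.2)

/-- Smooth functions on `ℝ × 𝕋`. -/
def IsSmooth (f : ℝ × Circ → ℝ) : Prop :=
  ContDiff ℝ ∞ (fun q : ℝ × ℝ => f (q.1, (q.2 : Circ)))

/-- The partial derivative `∂f/∂s`. -/
def partialS (f : ℝ × Circ → ℝ) (q : ℝ × Circ) : ℝ :=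
  deriv (fun σ : ℝ => f (σ, q.2)) q.1

/-- The partial derivative `∂f/∂t`. -/
def partialT (f : ℝ × Circ → ℝ) (q : ℝ × Circ) : ℝ :=
  deriv (fun τ : ℝ => f (q.1, q.2 + (τ : Circ))) 0

/-- `xs` and `xt` are the weak partial derivatives of `x` in `]0,π[ × 𝕋`: the test functions
are the smooth functions with (compact) support in `]0,π[ × 𝕋`. -/
def HasWeakGradient (x xs xt : L2Strip) : Prop :=
  ∀ f : ℝ × Circ → ℝ, IsSmooth f → tsupport f ⊆ Set.Ioo (0 : ℝ) π ×ˢ Set.univ →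
    (∫ z, x z * partialS f (incl z) ∂stripMeasure = -∫ z, xs z * f (incl z) ∂stripMeasure) ∧
    (∫ z, x z * partialT f (incl z) ∂stripMeasure = -∫ z, xt z * f (incl z) ∂stripMeasure)

/-- The boundary condition `x(0,t) = x(π,t) = 0`, for `x` in `H¹` with weak derivative `xs`:
there is no boundary term in Green's formula
`∬ x f_s + ∬ x_s f = ∫_𝕋 [x(π,t) f(π,t) - x(0,t) f(0,t)] dt`, where now `f` is smooth up to the
boundary and not required to vanish there. -/
def HasZeroTrace (x xs : L2Strip) : Prop :=
  ∀ f : ℝ × Circ → ℝ, IsSmooth f →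
    ∫ z, x z * partialS f (incl z) ∂stripMeasure = -∫ z, xs z * f (incl z) ∂stripMeasure

theorem continuous_of_lift {g : ℝ × Circ → ℝ}
    (h : Continuous (fun q : ℝ × ℝ => g (q.1, (q.2 : Circ)))) : Continuous g := by
  have hq : IsOpenQuotientMap (Prod.map (id : ℝ → ℝ) (fun t : ℝ => (t : Circ))) :=
    IsOpenQuotientMap.id.prodMap QuotientAddGroup.isOpenQuotientMap_mk
  exact hq.isQuotientMap.continuous_iff.2 h

theorem IsSmooth.continuous {f : ℝ × Circ → ℝ} (hf : IsSmooth f) : Continuous f :=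
  continuous_of_lift (ContDiff.continuous hf)

theorem IsSmooth.continuous_partialS {f : ℝ × Circ → ℝ} (hf : IsSmooth f) :
    Continuous (partialS f) := by
  apply continuous_of_lift
  have hd := ContDiff.continuous_fderiv hf (by simp)
  have key : (fun q : ℝ × ℝ => partialS f (q.1, (q.2 : Circ))) = fun q : ℝ × ℝ =>
      fderiv ℝ (fun q : ℝ × ℝ => f (q.1, (q.2 : Circ))) q (1, 0) := by
    funext q
    have h1 : HasFDerivAt (fun q : ℝ × ℝ => f (q.1, (q.2 : Circ)))
        (fderiv ℝ (fun q : ℝ × ℝ => f (q.1, (q.2 : Circ))) q) q :=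
      ((ContDiff.differentiable hf (by simp)) q).hasFDerivAt
    have h2 : HasDerivAt (fun σ : ℝ => (σ, q.2)) ((1 : ℝ), (0 : ℝ)) q.1 :=
      (hasDerivAt_id q.1).prodMk (hasDerivAt_const q.1 q.2)
    exact (HasFDerivAt.comp_hasDerivAt (x := q.1) (f := fun σ : ℝ => (σ, q.2)) h1 h2).deriv
  rw [key]
  exact hd.clm_apply continuous_const

theorem IsSmooth.continuous_partialT {f : ℝ × Circ → ℝ} (hf : IsSmooth f) :
    Continuous (partialT f) := by
  apply continuous_of_lift
  have hd := ContDiff.continuous_fderiv hf (by simp)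
  have key : (fun q : ℝ × ℝ => partialT f (q.1, (q.2 : Circ))) = fun q : ℝ × ℝ =>
      fderiv ℝ (fun q : ℝ × ℝ => f (q.1, (q.2 : Circ))) q (0, 1) := by
    funext q
    have h1 : HasFDerivAt (fun q : ℝ × ℝ => f (q.1, (q.2 : Circ)))
        (fderiv ℝ (fun q : ℝ × ℝ => f (q.1, (q.2 : Circ))) q) (q.1, q.2 + 0) := by
      simpa using ((ContDiff.differentiable hf (by simp)) q).hasFDerivAt
    have h2 : HasDerivAt (fun τ : ℝ => (q.1, q.2 + τ)) ((0 : ℝ), (1 : ℝ)) 0 :=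
      (hasDerivAt_const (0 : ℝ) q.1).prodMk ((hasDerivAt_id (0 : ℝ)).const_add q.2)
    have h3 := (HasFDerivAt.comp_hasDerivAt (x := (0 : ℝ))
      (f := fun τ : ℝ => (q.1, q.2 + τ)) h1 h2).deriv
    rw [← h3]
    simp [partialT, Function.comp_def]
  rw [key]
  exact hd.clm_apply continuous_const

theorem continuous_incl : Continuous incl := by
  unfold incl; fun_prop

theorem integrable_mul_of_continuous (x : L2Strip) {g : ℝ × Circ → ℝ} (hg : Continuous g) :
    Integrable (fun z => x z * g (incl z)) stripMeasure := by
  have hg' : Continuous (fun z : Strip => g (incl z)) := hg.comp continuous_incl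
  have hx : Integrable (fun z => x z) stripMeasure := (Lp.memLp x).integrable (by norm_num)
  obtain ⟨C, hC⟩ := (isCompact_univ (X := Strip)).exists_bound_of_continuousOn hg'.continuousOn
  exact hx.mul_bdd (c := C) hg'.aestronglyMeasurable (ae_of_all _ fun z => hC z trivial)

theorem integral_add_mul (x y : L2Strip) {g : ℝ × Circ → ℝ} (hg : Continuous g) :
    ∫ z, (x + y : L2Strip) z * g (incl z) ∂stripMeasure =
      ∫ z, x z * g (incl z) ∂stripMeasure + ∫ z, y z * g (incl z) ∂stripMeasure := by
  rw [← integral_add (integrable_mul_of_continuous x hg) (integrable_mul_of_continuous y hg)]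
  refine integral_congr_ae ?_
  filter_upwards [Lp.coeFn_add x y] with z hz
  rw [hz, Pi.add_apply, add_mul]

theorem integral_smul_mul (c : ℝ) (x : L2Strip) (g : ℝ × Circ → ℝ) :
    ∫ z, (c • x : L2Strip) z * g (incl z) ∂stripMeasure =
      c * ∫ z, x z * g (incl z) ∂stripMeasure := by
  rw [← integral_const_mul]
  refine integral_congr_ae ?_
  filter_upwards [Lp.coeFn_smul c x] with z hz
  rw [hz, Pi.smul_apply, smul_eq_mul, mul_assoc]

/-- The space `ℋ¹` of the `x ∈ ℛ ∩ H¹([0,π] × 𝕋)` with `x = 0` for `s = 0` and `s = π`. An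
element is stored as the triple `(x, x_s, x_t)`, in which the weak derivatives are determined
by `x`; the norm inherited from `L² × L² × L²` is equivalent to the norm of `H¹`. -/
def sobolevSpace : Submodule ℝ (L2Strip × L2Strip × L2Strip) where
  carrier := {w | w.1 ∈ rangeSpace ∧ HasWeakGradient w.1 w.2.1 w.2.2 ∧ HasZeroTrace w.1 w.2.1}
  add_mem' := by
    rintro ⟨x, xs, xt⟩ ⟨y, ys, yt⟩ ⟨hx, hx', hx''⟩ ⟨hy, hy', hy''⟩
    refine ⟨rangeSpace.add_mem hx hy, fun f hf hs => ⟨?_, ?_⟩, fun f hf => ?_⟩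
    · have h1 := (hx' f hf hs).1
      have h2 := (hy' f hf hs).1
      simp only [Prod.mk_add_mk] at h1 h2 ⊢
      rw [integral_add_mul _ _ hf.continuous_partialS, integral_add_mul _ _ hf.continuous,
        h1, h2]
      ring
    · have h1 := (hx' f hf hs).2
      have h2 := (hy' f hf hs).2
      simp only [Prod.mk_add_mk] at h1 h2 ⊢
      rw [integral_add_mul _ _ hf.continuous_partialT, integral_add_mul _ _ hf.continuous,
        h1, h2]
      ring
    · have h1 := hx'' f hf
      have h2 := hy'' f hf
      simp only [Prod.mk_add_mk] at h1 h2 ⊢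
      rw [integral_add_mul _ _ hf.continuous_partialS, integral_add_mul _ _ hf.continuous,
        h1, h2]
      ring
  zero_mem' := by
    have h0 : ∀ g : ℝ × Circ → ℝ, ∫ z, (0 : L2Strip) z * g (incl z) ∂stripMeasure = 0 := by
      intro g
      simpa using integral_smul_mul 0 0 g
    have h1 : ∀ g₁ g₂ : ℝ × Circ → ℝ, ∫ z, (0 : L2Strip) z * g₁ (incl z) ∂stripMeasure =
        -∫ z, (0 : L2Strip) z * g₂ (incl z) ∂stripMeasure := by
      intro g₁ g₂
      rw [h0, h0, neg_zero]
    exact ⟨rangeSpace.zero_mem, fun f hf hs => ⟨h1 _ _, h1 _ _⟩, fun f hf => h1 _ _⟩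
  smul_mem' := by
    rintro c ⟨x, xs, xt⟩ ⟨hx, hx', hx''⟩
    refine ⟨rangeSpace.smul_mem c hx, fun f hf hs => ⟨?_, ?_⟩, fun f hf => ?_⟩
    · have h1 := (hx' f hf hs).1
      simp only [Prod.smul_mk] at h1 ⊢
      rw [integral_smul_mul, integral_smul_mul, h1]
      ring
    · have h1 := (hx' f hf hs).2
      simp only [Prod.smul_mk] at h1 ⊢
      rw [integral_smul_mul, integral_smul_mul, h1]
      ring
    · have h1 := hx'' f hf
      simp only [Prod.smul_mk] at h1 ⊢
      rw [integral_smul_mul, integral_smul_mul, h1]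
      ring

/-! ## Weak solutions of `□u = a u⁺ - b u⁻ + p(s,t,u)` -/

/-- The function `u = x + y` represented by a pair `(x, y) ∈ ℋ¹ × 𝒩`. -/
def toFunction (w : sobolevSpace × kernelSpace) : L2Strip :=
  (w.1 : L2Strip × L2Strip × L2Strip).1 + (w.2 : L2Strip)

/-- The energy functional on `ℋ¹ × 𝒩`,
`½ (‖x_s‖² - ‖x_t‖² - a ‖(x+y)⁺‖² - b ‖(x+y)⁻‖²) - ∬ P(s,t,(x+y)(s,t)) ds dt` with
`P(s,t,ξ) = ∫₀^ξ p(s,t,τ) dτ`. -/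
def energy (a b : ℝ) (p : Strip → ℝ → ℝ) (w : sobolevSpace × kernelSpace) : ℝ :=
  1 / 2 * (‖(w.1 : L2Strip × L2Strip × L2Strip).2.1‖ ^ 2
      - ‖(w.1 : L2Strip × L2Strip × L2Strip).2.2‖ ^ 2
      - a * ‖Lp.posPart (toFunction w)‖ ^ 2 - b * ‖Lp.negPart (toFunction w)‖ ^ 2)
    - ∫ z, (∫ τ in (0 : ℝ)..(toFunction w z), p z τ) ∂stripMeasure

/-- `w = (x, y)`, i.e. `u = x + y`, is a weak solution of `□u = a u⁺ - b u⁻ + p(s,t,u)` with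
`u(0,t) = u(π,t) = 0`: it is a critical point of the energy functional. -/
def IsWeakSolution (a b : ℝ) (p : Strip → ℝ → ℝ) (w : sobolevSpace × kernelSpace) : Prop :=
  HasFDerivAt (energy a b p) (0 : (sobolevSpace × kernelSpace) →L[ℝ] ℝ) w

/-! ## The curve `𝒟_k` -/

/-- The coefficient of `v` along the nonzero vector `e` of an orthogonal system (`0` if
`e = 0`). -/
def coeff (e v : L2Strip) : ℝ := inner ℝ e v / ‖e‖ ^ 2

/-- The operator `M = (-□ + c)⁻¹` given by
`M v = ∑ [α_{(m,n)} φ_{(m,n)} + β_{(m,n)} ψ_{(m,n)}] / (c - m² + n²)` for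
`v = ∑ [α_{(m,n)} φ_{(m,n)} + β_{(m,n)} ψ_{(m,n)}]`; here `m = i.1 + 1` and `n = i.2`. -/
def resolventOp (c : ℝ) (v : L2Strip) : L2Strip :=
  ∑' i : ℕ × ℕ, (c - ((i.1 + 1 : ℕ) : ℝ) ^ 2 + (i.2 : ℝ) ^ 2)⁻¹ •
    (coeff (phi (i.1 + 1) i.2) v • phi (i.1 + 1) i.2
      + coeff (psi (i.1 + 1) i.2) v • psi (i.1 + 1) i.2)

/-- The second shift `ρ = max {0, 1/(λ_{k+1} - ε₃)} + ε₄`. -/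
def rho (k : ℤ) (ε₃ ε₄ : ℝ) : ℝ := max 0 (1 / (eig (k + 1) - ε₃)) + ε₄

/-- The admissible parameters: `0 < ε₃ < λ_{k+1} - λ_k` and
`0 < ε₄ < 1/(λ_{k+1} - λ_k - ε₃) - max {0, 1/(λ_{k+1} - ε₃)}`. -/
def Admissible (k : ℤ) (ε₃ ε₄ : ℝ) : Prop :=
  (0 < ε₃ ∧ ε₃ < eig (k + 1) - eig k) ∧
    (0 < ε₄ ∧ ε₄ < 1 / (eig (k + 1) - eig k - ε₃) - max 0 (1 / (eig (k + 1) - ε₃)))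

/-- `ã(r) = sup_{v ≠ 0} ⟨(M - ρ) v, v⟩ / (‖v⁺‖² + r ‖v⁻‖²)`. -/
def aTilde (k : ℤ) (ε₃ ε₄ r : ℝ) : ℝ :=
  ⨆ v : {v : L2Strip // v ≠ 0},
    inner ℝ (resolventOp (eig (k + 1) - ε₃) v.1 - rho k ε₃ ε₄ • v.1) v.1 /
      (‖Lp.posPart v.1‖ ^ 2 + r * ‖Lp.negPart v.1‖ ^ 2)

/-- The open square `R_k = ]λ_{k+1} - ε₃ - 1/ρ, λ_{k+1} - ε₃[²`. -/
def squareR (k : ℤ) (ε₃ ε₄ : ℝ) : Set (ℝ × ℝ) :=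
  Set.Ioo (eig (k + 1) - ε₃ - 1 / rho k ε₃ ε₄) (eig (k + 1) - ε₃) ×ˢ
    Set.Ioo (eig (k + 1) - ε₃ - 1 / rho k ε₃ ε₄) (eig (k + 1) - ε₃)

/-- The part of the curve `𝒟_k` in `R_k`, parametrized by `r > 0`. -/
def curveD (k : ℤ) (ε₃ ε₄ : ℝ) : Set (ℝ × ℝ) :=
  {z | ∃ r : ℝ, 0 < r ∧
    z = (eig (k + 1) - ε₃ - 1 / (aTilde k ε₃ ε₄ r + rho k ε₃ ε₄),
      eig (k + 1) - ε₃ - 1 / (r * aTilde k ε₃ ε₄ r + rho k ε₃ ε₄))}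

/-- The points of `R_k` above `𝒟_k`: the connected component of `R_k \ 𝒟_k` that contains the
square `]λ_k, λ_{k+1} - ε₃[²`. -/
def aboveInSquare (k : ℤ) (ε₃ ε₄ : ℝ) : Set (ℝ × ℝ) :=
  {z | ∃ z₀ ∈ Set.Ioo (eig k) (eig (k + 1) - ε₃) ×ˢ Set.Ioo (eig k) (eig (k + 1) - ε₃),
    z ∈ connectedComponentIn (squareR k ε₃ ε₄ \ curveD k ε₃ ε₄) z₀}

/-- The square `R̃_k`: `]-∞, λ_{k+1}[²` if `λ_k < 0`, and `]0, λ_{k+1}[²` if `λ_k > 0`. -/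
def squareRTilde (k : ℤ) : Set (ℝ × ℝ) :=
  {z | (eig k < 0 ∧ z.1 < eig (k + 1) ∧ z.2 < eig (k + 1)) ∨
    (0 < eig k ∧ z.1 ∈ Set.Ioo 0 (eig (k + 1)) ∧ z.2 ∈ Set.Ioo 0 (eig (k + 1)))}

/-- The points of `R̃_k` above `𝒟_k`. The squares `R_k` exhaust `R̃_k` as `ε₃, ε₄ → 0`, and the
curves in them agree on common squares; so a point is above `𝒟_k` if it is in one of the
squares `R_k`, above the curve there. -/
def aboveD (k : ℤ) : Set (ℝ × ℝ) :=
  {z | z ∈ squareRTilde k ∧ ∃ ε₃ ε₄ : ℝ, Admissible k ε₃ ε₄ ∧ z ∈ aboveInSquare k ε₃ ε₄}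

/-! ## The hypotheses on `p` -/

/-- `p(s,t,u)/u → 0` as `|u| → ∞`, uniformly in `(s,t)`. -/
def SublinearAtInfinity (p : Strip → ℝ → ℝ) : Prop :=
  TendstoUniformly (fun (u : ℝ) (z : Strip) => p z u / u) (fun _ => 0) (cocompact ℝ)

/-- The function `u ↦ a u⁺ - b u⁻ + p(s,t,u)`, `z = (s,t)`. -/
def nonlinearity (a b : ℝ) (p : Strip → ℝ → ℝ) (z : Strip) (u : ℝ) : ℝ :=
  a * max u 0 - b * max (-u) 0 + p z u

/-- (H1′) `u ↦ a u⁺ - b u⁻ + p(s,t,u) - (λ_{k+1} - ε) u` is decreasing. -/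
def HypH1' (k : ℤ) (a b : ℝ) (p : Strip → ℝ → ℝ) : Prop :=
  ∃ ε : ℝ, 0 < ε ∧ ∀ z, Antitone (fun u => nonlinearity a b p z u - (eig (k + 1) - ε) * u)

/-- (H2′) If `λ_k > 0`, then `u ↦ a u⁺ - b u⁻ + p(s,t,u) - ε u` is increasing. -/
def HypH2' (k : ℤ) (a b : ℝ) (p : Strip → ℝ → ℝ) : Prop :=
  0 < eig k → ∃ ε : ℝ, 0 < ε ∧ ∀ z, Monotone (fun u => nonlinearity a b p z u - ε * u)

/-- (H3′) If `λ_k < 0`, then `u ↦ p(s,t,u) + (1/ε) u` is increasing. -/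
def HypH3' (k : ℤ) (p : Strip → ℝ → ℝ) : Prop :=
  eig k < 0 → ∃ ε : ℝ, 0 < ε ∧ ∀ z, Monotone (fun u => p z u + (1 / ε) * u)

end

end WaveFucik

open WaveFucik

/-! The proof is by convex duality. Write `f(u)` for the right-hand side of (1) and fix a shift `c`
in the gap between `λ_k` and `λ_{k+1}`, close to `λ_{k+1}`. Equation (1) becomes `(c - □)u = h(u)`
with `h(u) = cu - f(u)`. By (H1′) the slope of `h` is bounded below by a positive constant, and by
(H2′) or (H3′) it is at most some `L` with `1/L > max {0, 1/c}`
(`exists_slopeBounds_dualNonlinearity`). So the integral of the primitive of `h` is a strongly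
convex functional `Ψ`, whose conjugate `Ψ*` has gradient inverse to `h`
(`QuadBounds.exists_conjugate`). With `M = (c - □)⁻¹` and `v = h(u)`, one looks for critical points
`v` of `Ψ*(v) - ½⟨Mv, v⟩`; there `u = ∇Ψ*(v) = Mv`, and the decay of the multipliers of `M` off the
kernel makes `u` an element of `ℋ¹ + 𝒩` satisfying the weak equation (`exists_weak_of_diagOp`).

The critical point is a global minimum. `M` is not compact, because it equals `1/c` on the
infinite-dimensional kernel of `□`. But off the kernel its multipliers tend to `0`, so for `max {0,
1/c} < ρ < 1/L` only finitely many of them exceed `ρ`, while `Ψ*` has convexity modulus `1/L`. The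
dual functional is therefore strongly convex up to a form of finite rank, and bounded minimizing
sequences have convergent subsequences (`exists_tendsto_of_minimizing`).

Coercivity is where the curve enters. Since `p` is sublinear, `Ψ*` is bounded below, up to `η‖v‖²`
and a constant, by `½(‖v⁺‖²/(c-a) + ‖v⁻‖²/(c-b))` (`exists_jumpEnergy_le_conjugate`). Hence it
suffices that the form `⟨Mv, v⟩ - ‖v⁺‖²/(c-a) - ‖v⁻‖²/(c-b)` be negative definite (`FucikNeg`). At
the shift `c = λ_{k+1} - ε₃` this follows by connectedness: definiteness and positivity somewhere
are disjoint open conditions on `(a, b)`, a point of the square satisfying neither lies on `𝒟_k`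
(`mem_curveD`), and definiteness holds on `]λ_k, c[²`.

That shift need not be close enough to `λ_{k+1}` for (H1′), so definiteness is carried to larger
shifts (`FucikNeg.mono`), again by connectedness. If it were lost at some shift, the degenerate form
would have a nontrivial null vector, coming from a nonzero solution of `□u = au⁺ - bu⁻`. This
equation does not involve the shift, so the form at the original shift would have a null vector too.
-/

namespace WaveFucik

open MeasureTheory Real Filter Topology
open scoped ContDiff ENNReal

section Hilbert

variable {H : Type*} [NormedAddCommGroup H] [InnerProductSpace ℝ H]

/-! ## Functionals with two-sided quadratic bounds -/

/-- The functional `K` has gradient `N`, with first-order remainder between `σ/2 ‖d‖²` and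
`L/2 ‖d‖²`. -/
def QuadBounds (K : H → ℝ) (N : H → H) (σ L : ℝ) : Prop :=
  ∀ x d, σ / 2 * ‖d‖ ^ 2 ≤ K (x + d) - K x - inner ℝ (N x) d ∧
    K (x + d) - K x - inner ℝ (N x) d ≤ L / 2 * ‖d‖ ^ 2

theorem hasFDerivAt_of_abs_le {K : H → ℝ} {x n : H} {C : ℝ}
    (h : ∀ d, |K (x + d) - K x - inner ℝ n d| ≤ C * ‖d‖ ^ 2) :
    HasFDerivAt K (innerSL ℝ n) x := by
  rw [hasFDerivAt_iff_isLittleO_nhds_zero]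
  have h1 : (fun d : H => K (x + d) - K x - innerSL ℝ n d) =O[𝓝 0] fun d : H => ‖d‖ ^ 2 := by
    refine Asymptotics.IsBigO.of_bound C (Eventually.of_forall fun d => ?_)
    simpa using h d
  exact h1.trans_isLittleO (by
    simpa using (Asymptotics.isLittleO_norm_pow_id (E' := H) one_lt_two))

theorem QuadBounds.abs_le {K : H → ℝ} {N : H → H} {σ L : ℝ} (h : QuadBounds K N σ L) (x d : H) :
    |K (x + d) - K x - inner ℝ (N x) d| ≤ (|σ| + |L|) / 2 * ‖d‖ ^ 2 := by
  obtain ⟨h1, h2⟩ := h x d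
  have hd := sq_nonneg ‖d‖
  rw [_root_.abs_le]
  constructor <;> nlinarith [neg_abs_le σ, le_abs_self L, abs_nonneg σ, abs_nonneg L]

theorem QuadBounds.hasFDerivAt {K : H → ℝ} {N : H → H} {σ L : ℝ} (h : QuadBounds K N σ L)
    (x : H) : HasFDerivAt K (innerSL ℝ (N x)) x :=
  hasFDerivAt_of_abs_le (h.abs_le x)

theorem QuadBounds.continuous {K : H → ℝ} {N : H → H} {σ L : ℝ} (h : QuadBounds K N σ L) :
    Continuous K :=
  continuous_iff_continuousAt.2 fun x => (h.hasFDerivAt x).continuousAt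

/-- The Euler equation at a minimum, obtained from a one-sided quadratic bound alone: if `n ≠ 0`, a
short step along `-n` lowers `D`, the linear gain outweighing the quadratic error. -/
theorem eq_zero_of_forall_le_add {D : H → ℝ} {x n : H} {C : ℝ} (hmin : ∀ y, D x ≤ D y)
    (h : ∀ d, D (x + d) ≤ D x + inner ℝ n d + C * ‖d‖ ^ 2) : n = 0 := by
  by_contra hn
  have hn' : 0 < ‖n‖ ^ 2 := by positivity
  set t : ℝ := 1 / (2 * (|C| + 1)) with ht
  have hC := abs_nonneg C
  have htpos : 0 < t := by positivity
  have h1 := h (-(t • n))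
  have h2 := hmin (x + -(t • n))
  rw [inner_neg_right, inner_smul_right, real_inner_self_eq_norm_sq, norm_neg, norm_smul,
    mul_pow, Real.norm_eq_abs, sq_abs] at h1
  have h3 : C * t ≤ 1 / 2 := by
    have : |C| * t ≤ 1 / 2 := by
      rw [ht, mul_one_div, div_le_iff₀ (by positivity)]; linarith
    exact (mul_le_mul_of_nonneg_right (le_abs_self C) htpos.le).trans this
  have h4 : 0 ≤ -(t * ‖n‖ ^ 2) + (C * t) * (t * ‖n‖ ^ 2) := by nlinarith
  have h5 : 0 < t * ‖n‖ ^ 2 := by positivity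
  nlinarith

/-- Bounded minimizing sequences of a functional that is strongly convex up to a finite-rank
quadratic form have convergent subsequences. -/
theorem exists_tendsto_of_minimizing [CompleteSpace H] {F : Type*} [NormedAddCommGroup F]
    [NormedSpace ℝ F] [ProperSpace F] (T : H →L[ℝ] F) {D : H → ℝ} {n : H → H} {κ C m : ℝ}
    (hκ : 0 < κ)
    (hlow : ∀ x d, D x + inner ℝ (n x) d + κ * ‖d‖ ^ 2 - C * ‖T d‖ ^ 2 ≤ D (x + d))
    (hm : ∀ x, m ≤ D x) {v : ℕ → H} {R : ℝ} (hv : ∀ j, ‖v j‖ ≤ R)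
    (hD : Tendsto (fun j => D (v j)) atTop (𝓝 m)) :
    ∃ w, ∃ θ : ℕ → ℕ, StrictMono θ ∧ Tendsto (fun j => v (θ j)) atTop (𝓝 w) := by
  have hTb : ∀ j, T (v j) ∈ Metric.closedBall (0 : F) (‖T‖ * R) := fun j => by
    rw [mem_closedBall_zero_iff]
    exact (T.le_opNorm _).trans (mul_le_mul_of_nonneg_left (hv j) (norm_nonneg _))
  obtain ⟨f, -, θ, hθ, hf⟩ := tendsto_subseq_of_bounded Metric.isBounded_closedBall hTb
  -- Expand about the midpoint `z` in the directions `±(x - y)/2` and add: the gradient terms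
  -- cancel, and `D z ≥ m`. Where `T` is nearly constant, almost minimizers are thus close to one
  -- another.
  have key : ∀ x y : H, κ * ‖x - y‖ ^ 2 ≤
      2 * (D x - m) + 2 * (D y - m) + |C| * ‖T x - T y‖ ^ 2 := by
    intro x y
    set d : H := (1 / 2 : ℝ) • (x - y) with hd
    set z : H := (1 / 2 : ℝ) • (x + y) with hz
    have hx : z + d = x := by rw [hz, hd]; module
    have hy : z + -d = y := by rw [hz, hd]; module
    have h1 := hlow z d
    have h2 := hlow z (-d)
    have h3 := hm z
    rw [hx] at h1
    rw [hy, inner_neg_right, norm_neg, map_neg, norm_neg] at h2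
    have e1 : ‖d‖ ^ 2 = ‖x - y‖ ^ 2 / 4 := by
      rw [hd, norm_smul, mul_pow]; norm_num; ring
    have e2 : ‖T d‖ ^ 2 = ‖T x - T y‖ ^ 2 / 4 := by
      rw [hd, map_smul, map_sub, norm_smul, mul_pow]; norm_num; ring
    rw [e1, e2] at h1 h2
    have h4 : C * ‖T x - T y‖ ^ 2 ≤ |C| * ‖T x - T y‖ ^ 2 :=
      mul_le_mul_of_nonneg_right (le_abs_self C) (sq_nonneg _)
    linarith
  have hfC : CauchySeq fun j => T (v (θ j)) := hf.cauchySeq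
  have hcau : CauchySeq fun j => v (θ j) := by
    rw [Metric.cauchySeq_iff]
    intro ε hε
    have hC := abs_nonneg C
    set η : ℝ := κ * ε ^ 2 / 8 with hη
    have hηpos : 0 < η := by positivity
    obtain ⟨N1, hN1⟩ := Filter.eventually_atTop.1
      ((hD.comp hθ.tendsto_atTop).eventually (gt_mem_nhds (show m < m + η by linarith)))
    have hδ : 0 < Real.sqrt (κ * ε ^ 2 / (4 * (|C| + 1))) := by positivity
    obtain ⟨N2, hN2⟩ := Metric.cauchySeq_iff.1 hfC _ hδ
    refine ⟨max N1 N2, fun i hi j hj => ?_⟩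
    have h1 := hN1 i (le_trans (le_max_left _ _) hi)
    have h2 := hN1 j (le_trans (le_max_left _ _) hj)
    have h3 := hN2 i (le_trans (le_max_right _ _) hi) j (le_trans (le_max_right _ _) hj)
    simp only [Function.comp_apply] at h1 h2
    rw [dist_eq_norm] at h3 ⊢
    have h4 : ‖T (v (θ i)) - T (v (θ j))‖ ^ 2 ≤ κ * ε ^ 2 / (4 * (|C| + 1)) := by
      have := pow_le_pow_left₀ (norm_nonneg _) h3.le 2
      rwa [Real.sq_sqrt (by positivity)] at this
    have h5 : |C| * ‖T (v (θ i)) - T (v (θ j))‖ ^ 2 ≤ κ * ε ^ 2 / 4 := by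
      calc |C| * ‖T (v (θ i)) - T (v (θ j))‖ ^ 2
          ≤ (|C| + 1) * (κ * ε ^ 2 / (4 * (|C| + 1))) := by gcongr; linarith
        _ = κ * ε ^ 2 / 4 := by field_simp
    have h6 := key (v (θ i)) (v (θ j))
    have h7 : κ * ‖v (θ i) - v (θ j)‖ ^ 2 < κ * ε ^ 2 := by
      have : 0 < κ * ε ^ 2 := by positivity
      linarith
    exact lt_of_pow_lt_pow_left₀ 2 hε.le (lt_of_mul_lt_mul_left h7 hκ.le)
  obtain ⟨w, hw⟩ := cauchySeq_tendsto_of_complete hcau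
  exact ⟨w, θ, hθ, hw⟩

/-- A coercive functional that is strongly convex up to a finite-rank quadratic form has a
critical point, at which its minimum is attained. -/
theorem exists_critical_of_coercive [CompleteSpace H] {F : Type*} [NormedAddCommGroup F]
    [NormedSpace ℝ F] [ProperSpace F] (T : H →L[ℝ] F) {D : H → ℝ} {n : H → H} {κ C L δ B : ℝ}
    (hκ : 0 < κ) (hδ : 0 < δ)
    (hlow : ∀ x d, D x + inner ℝ (n x) d + κ * ‖d‖ ^ 2 - C * ‖T d‖ ^ 2 ≤ D (x + d))
    (hup : ∀ x d, D (x + d) ≤ D x + inner ℝ (n x) d + L * ‖d‖ ^ 2)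
    (hcoer : ∀ x, δ * ‖x‖ ^ 2 - B ≤ D x) : ∃ x, n x = 0 := by
  have hcont : Continuous D := by
    refine continuous_iff_continuousAt.2 fun x => HasFDerivAt.continuousAt (𝕜 := ℝ)
      (hasFDerivAt_of_abs_le (n := n x) (C := |L| + |C| * ‖T‖ ^ 2) fun d => ?_)
    have h1 := hlow x d
    have h2 := hup x d
    have h3 : ‖T d‖ ^ 2 ≤ ‖T‖ ^ 2 * ‖d‖ ^ 2 := by
      rw [← mul_pow]; exact pow_le_pow_left₀ (norm_nonneg _) (T.le_opNorm d) 2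
    have h4 : C * ‖T d‖ ^ 2 ≤ |C| * (‖T‖ ^ 2 * ‖d‖ ^ 2) :=
      (mul_le_mul_of_nonneg_right (le_abs_self C) (sq_nonneg _)).trans
        (mul_le_mul_of_nonneg_left h3 (abs_nonneg _))
    have h5 : L * ‖d‖ ^ 2 ≤ |L| * ‖d‖ ^ 2 :=
      mul_le_mul_of_nonneg_right (le_abs_self L) (sq_nonneg _)
    have h6 : 0 ≤ κ * ‖d‖ ^ 2 := by positivity
    have h7 : 0 ≤ |L| * ‖d‖ ^ 2 := by positivity
    have h8 : 0 ≤ |C| * (‖T‖ ^ 2 * ‖d‖ ^ 2) := by positivity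
    rw [_root_.abs_le]
    constructor <;> linarith
  have hbdd : BddBelow (Set.range D) := ⟨-B, by
    rintro _ ⟨x, rfl⟩
    have := hcoer x
    have h6 : 0 ≤ δ * ‖x‖ ^ 2 := by positivity
    linarith⟩
  set m : ℝ := sInf (Set.range D) with hm
  have hmle : ∀ x, m ≤ D x := fun x => csInf_le hbdd ⟨x, rfl⟩
  obtain ⟨y, -, hy, hyr⟩ := exists_seq_tendsto_sInf (Set.range_nonempty D) hbdd
  choose v hv using hyr
  have hDv : Tendsto (fun j => D (v j)) atTop (𝓝 m) := by simpa only [hv] using hy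
  obtain ⟨Y, hY⟩ := hDv.bddAbove_range
  have hvb : ∀ j, ‖v j‖ ≤ Real.sqrt ((Y + B) / δ) := fun j => by
    refine Real.le_sqrt_of_sq_le ?_
    rw [le_div_iff₀ hδ]
    have h1 := hcoer (v j)
    have h2 : D (v j) ≤ Y := hY ⟨j, rfl⟩
    linarith
  obtain ⟨w, θ, hθ, hw⟩ := exists_tendsto_of_minimizing T hκ hlow hmle hvb hDv
  have hDw : D w = m := tendsto_nhds_unique ((hcont.tendsto w).comp hw)
    (hDv.comp hθ.tendsto_atTop)
  exact ⟨w, eq_zero_of_forall_le_add (fun y => hDw ▸ hmle y) (hup w)⟩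

/-- The convex conjugate of a functional with `0 < σ ≤ ∇²K ≤ L`. -/
theorem QuadBounds.exists_conjugate [CompleteSpace H] {K : H → ℝ} {N : H → H} {σ L : ℝ}
    (hσ : 0 < σ) (hL : 0 < L) (h : QuadBounds K N σ L) :
    ∃ (K' : H → ℝ) (R : H → H), (∀ v, N (R v) = v) ∧ QuadBounds K' R (1 / L) (1 / σ) ∧
      ∀ u v, inner ℝ u v - K u ≤ K' v := by
  -- `N` is onto because `K - ⟨v, ·⟩` is strongly convex and coercive; no finite-rank correction is
  -- needed, hence `T = 0` and `C = 0`.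
  have hsurj : ∀ v, ∃ u, N u = v := by
    intro v
    obtain ⟨u, hu⟩ := exists_critical_of_coercive (F := ℝ) (0 : H →L[ℝ] ℝ)
      (D := fun u => K u - inner ℝ v u) (n := fun u => N u - v) (κ := σ / 2) (C := 0)
      (L := L / 2) (δ := σ / 4) (B := ‖N 0 - v‖ ^ 2 / σ - K 0) (by positivity) (by positivity)
      (fun x d => by
        have := (h x d).1
        simp only [inner_add_right, inner_sub_left]; linarith)
      (fun x d => by
        have := (h x d).2
        simp only [inner_add_right, inner_sub_left]; linarith)
      (fun x => by
        have h1 := (h 0 x).1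
        rw [zero_add] at h1
        have h2 : -(‖N 0 - v‖ * ‖x‖) ≤ inner ℝ (N 0 - v) x :=
          (_root_.abs_le.1 (abs_real_inner_le_norm _ _)).1
        rw [inner_sub_left] at h2
        have h3 : ‖N 0 - v‖ * ‖x‖ ≤ σ / 4 * ‖x‖ ^ 2 + ‖N 0 - v‖ ^ 2 / σ := by
          have h4 := sq_nonneg (σ / 2 * ‖x‖ - ‖N 0 - v‖)
          have h5 : σ / 4 * ‖x‖ ^ 2 + ‖N 0 - v‖ ^ 2 / σ - ‖N 0 - v‖ * ‖x‖ =
              (σ / 2 * ‖x‖ - ‖N 0 - v‖) ^ 2 / σ := by field_simp; ring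
          have h6 : 0 ≤ (σ / 2 * ‖x‖ - ‖N 0 - v‖) ^ 2 / σ := by positivity
          linarith
        linarith)
    exact ⟨u, sub_eq_zero.1 hu⟩
  choose R hR using hsurj
  have hfen : ∀ u v, inner ℝ u v - K u ≤ inner ℝ (R v) v - K (R v) := by
    intro u v
    have h1 := (h (R v) (u - R v)).1
    rw [hR, add_sub_cancel, inner_sub_right, real_inner_comm u v, real_inner_comm (R v) v] at h1
    have : 0 ≤ σ / 2 * ‖u - R v‖ ^ 2 := by positivity
    linarith
  refine ⟨fun v => inner ℝ (R v) v - K (R v), R, hR, fun v d => ⟨?_, ?_⟩, hfen⟩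
  -- The supremum defining the conjugate at `v + d` is tested at `R v + d/L`; the step length `1/L`
  -- maximizes `t‖d‖² - (L/2)t²‖d‖²`.
  · have h1 := hfen (R v + (1 / L : ℝ) • d) (v + d)
    have h2 := (h (R v) ((1 / L : ℝ) • d)).2
    rw [hR, norm_smul, mul_pow, Real.norm_eq_abs, sq_abs, inner_smul_right] at h2
    simp only [inner_add_left, inner_add_right, real_inner_smul_left,
      real_inner_self_eq_norm_sq] at h1 ⊢
    rw [real_inner_comm d v] at h2
    have h3 : L / 2 * ((1 / L) ^ 2 * ‖d‖ ^ 2) = 1 / L / 2 * ‖d‖ ^ 2 := by field_simp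
    have h4 : 1 / L * ‖d‖ ^ 2 = 2 * (1 / L / 2 * ‖d‖ ^ 2) := by ring
    rw [h3] at h2
    linarith
  -- Strong convexity at `R v` contributes `-(σ/2)‖e‖²`, which absorbs `⟨e, d⟩` by Young's
  -- inequality.
  · set e := R (v + d) - R v with he
    have h1 := (h (R v) e).1
    have hRe : R (v + d) = R v + e := by rw [he]; abel
    rw [hR] at h1
    simp only [hRe, inner_add_left, inner_add_right] at h1 ⊢
    rw [real_inner_comm e v] at h1
    have h2 : inner ℝ e d ≤ ‖e‖ * ‖d‖ := real_inner_le_norm _ _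
    have h3 : ‖e‖ * ‖d‖ ≤ σ / 2 * ‖e‖ ^ 2 + 1 / σ / 2 * ‖d‖ ^ 2 := by
      have h5 : σ / 2 * ‖e‖ ^ 2 + 1 / σ / 2 * ‖d‖ ^ 2 - ‖e‖ * ‖d‖ =
          (σ * ‖e‖ - ‖d‖) ^ 2 / (2 * σ) := by field_simp; ring
      have h6 : 0 ≤ (σ * ‖e‖ - ‖d‖) ^ 2 / (2 * σ) := by positivity
      linarith
    linarith

end Hilbert

/-! ## Diagonal operators -/

theorem hasSum_of_eq {ι E : Type*} [AddCommMonoid E] [TopologicalSpace E] {f g : ι → E} {a : E}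
    (h : HasSum f a) (hfg : ∀ i, f i = g i) : HasSum g a := by
  rwa [← funext hfg]

section Diagonal

variable {H : Type*} [NormedAddCommGroup H] [InnerProductSpace ℝ H] {ι : Type*}

/-- The operator with eigenvalues `κ i` on the orthonormal system `e`, and `0` on its
complement. -/
noncomputable def diagOp (e : ι → H) (κ : ι → ℝ) (v : H) : H :=
  ∑' i, (κ i * inner ℝ (e i) v) • e i

variable {e : ι → H} {κ κ' : ι → ℝ} {B B' : ℝ}

theorem summable_inner_sq (he : Orthonormal ℝ e) (v : H) :
    Summable fun i => inner ℝ (e i) v ^ 2 := by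
  simpa using he.inner_products_summable v

theorem tsum_inner_sq_le (he : Orthonormal ℝ e) (v : H) :
    ∑' i, inner ℝ (e i) v ^ 2 ≤ ‖v‖ ^ 2 := by
  simpa using he.tsum_inner_products_le v

theorem summable_mul_inner_sq (he : Orthonormal ℝ e) (hκ : ∀ i, |κ i| ≤ B) (v : H) :
    Summable fun i => (κ i * inner ℝ (e i) v) ^ 2 := by
  refine Summable.of_nonneg_of_le (fun i => sq_nonneg _) (fun i => ?_)
    ((summable_inner_sq he v).mul_left (B ^ 2))
  rw [mul_pow]
  refine mul_le_mul_of_nonneg_right ?_ (sq_nonneg _)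
  rw [← sq_abs]
  exact pow_le_pow_left₀ (abs_nonneg _) (hκ i) 2

/-- The coordinates with respect to finitely many members of an orthonormal system. -/
noncomputable def coordMap (e : ι → H) (J : Finset ι) : H →L[ℝ] (J → ℝ) :=
  ContinuousLinearMap.pi fun i => innerSL ℝ (e i)

/-- The target `J → ℝ` carries the sup norm, whence the factor `J.card`. This puts finite-rank
corrections in the form `C‖T d‖²` required by the minimization lemmas. -/
theorem sum_inner_sq_le (e : ι → H) (J : Finset ι) (v : H) :
    ∑ i ∈ J, inner ℝ (e i) v ^ 2 ≤ J.card * ‖coordMap e J v‖ ^ 2 := by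
  rw [← nsmul_eq_mul]
  refine Finset.sum_le_card_nsmul _ _ _ fun i hi => ?_
  rw [← sq_abs]
  exact pow_le_pow_left₀ (abs_nonneg _) (norm_le_pi_norm (coordMap e J v) ⟨i, hi⟩) 2

variable [CompleteSpace H]

theorem summable_smul_of_summable_sq (he : Orthonormal ℝ e) {a : ι → ℝ}
    (ha : Summable fun i => a i ^ 2) : Summable fun i => a i • e i := by
  have := (he.orthogonalFamily.summable_iff_norm_sq_summable (f := a)).2 (by simpa using ha)
  simpa using this

theorem hasSum_diagOp (he : Orthonormal ℝ e) (hκ : ∀ i, |κ i| ≤ B) (v : H) :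
    HasSum (fun i => (κ i * inner ℝ (e i) v) • e i) (diagOp e κ v) :=
  (summable_smul_of_summable_sq he (summable_mul_inner_sq he hκ v)).hasSum

theorem hasSum_inner_diagOp (he : Orthonormal ℝ e) (hκ : ∀ i, |κ i| ≤ B) (v w : H) :
    HasSum (fun i => κ i * inner ℝ (e i) v * inner ℝ (e i) w) (inner ℝ (diagOp e κ v) w) := by
  have h := (innerSL ℝ w).hasSum (hasSum_diagOp he hκ v)
  simp only [innerSL_apply_apply, inner_smul_right] at h
  rw [real_inner_comm]
  refine hasSum_of_eq h fun i => ?_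
  rw [real_inner_comm w]

theorem inner_diagOp (he : Orthonormal ℝ e) (hκ : ∀ i, |κ i| ≤ B) (v : H) (j : ι) :
    inner ℝ (e j) (diagOp e κ v) = κ j * inner ℝ (e j) v := by
  classical
  have h := hasSum_inner_diagOp he hκ v (e j)
  rw [real_inner_comm] at h
  have h' : HasSum (fun i => κ i * inner ℝ (e i) v * inner ℝ (e i) (e j))
      (κ j * inner ℝ (e j) v * inner ℝ (e j) (e j)) :=
    hasSum_single j fun i hi => by rw [orthonormal_iff_ite.1 he i j, if_neg hi, mul_zero]
  rw [h.unique h', orthonormal_iff_ite.1 he j j, if_pos rfl, mul_one]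

theorem diagOp_symm (he : Orthonormal ℝ e) (hκ : ∀ i, |κ i| ≤ B) (v w : H) :
    inner ℝ (diagOp e κ v) w = inner ℝ (diagOp e κ w) v := by
  refine (hasSum_inner_diagOp he hκ v w).unique ?_
  refine hasSum_of_eq (hasSum_inner_diagOp he hκ w v) fun i => ?_
  ring

theorem diagOp_add (he : Orthonormal ℝ e) (hκ : ∀ i, |κ i| ≤ B) (v w : H) :
    diagOp e κ (v + w) = diagOp e κ v + diagOp e κ w := by
  refine (hasSum_diagOp he hκ (v + w)).unique ?_
  refine hasSum_of_eq ((hasSum_diagOp he hκ v).add (hasSum_diagOp he hκ w)) fun i => ?_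
  rw [inner_add_right, mul_add, add_smul]

theorem inner_diagOp_add (he : Orthonormal ℝ e) (hκ : ∀ i, |κ i| ≤ B) (v d : H) :
    inner ℝ (diagOp e κ (v + d)) (v + d) = inner ℝ (diagOp e κ v) v
      + 2 * inner ℝ (diagOp e κ v) d + inner ℝ (diagOp e κ d) d := by
  rw [diagOp_add he hκ, inner_add_left, inner_add_right, inner_add_right,
    diagOp_symm he hκ d v]
  ring

/-- If all but finitely many eigenvalues are at most `ρ ≥ 0`, the quadratic form is at most
`ρ ‖v‖²` up to a form of finite rank. -/
theorem inner_diagOp_le (he : Orthonormal ℝ e) (hκ : ∀ i, |κ i| ≤ B) {ρ : ℝ} (hρ : 0 ≤ ρ)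
    (J : Finset ι) (hJ : ∀ i, i ∉ J → κ i ≤ ρ) (v : H) :
    inner ℝ (diagOp e κ v) v ≤ ρ * ‖v‖ ^ 2 + B * ∑ i ∈ J, inner ℝ (e i) v ^ 2 := by
  classical
  have h1 : HasSum (fun i => ρ * inner ℝ (e i) v ^ 2) (ρ * ∑' i, inner ℝ (e i) v ^ 2) :=
    (summable_inner_sq he v).hasSum.mul_left ρ
  have h2 : HasSum (fun i => if i ∈ J then B * inner ℝ (e i) v ^ 2 else 0)
      (∑ i ∈ J, B * inner ℝ (e i) v ^ 2) := by
    rw [← Finset.sum_congr rfl fun i (hi : i ∈ J) =>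
      if_pos (c := i ∈ J) (t := B * inner ℝ (e i) v ^ 2) (e := 0) hi]
    exact hasSum_sum_of_ne_finset_zero fun i hi => if_neg hi
  have h3 := hasSum_le (fun i => ?_) (hasSum_inner_diagOp he hκ v v) (h1.add h2)
  · rw [← Finset.mul_sum] at h3
    have := mul_le_mul_of_nonneg_left (tsum_inner_sq_le he v) hρ
    linarith
  · have hs := sq_nonneg (inner ℝ (e i) v)
    have hB := (le_abs_self _).trans (hκ i)
    rw [mul_assoc, ← sq]
    split_ifs with hi
    · have := mul_le_mul_of_nonneg_right hB hs
      have := mul_nonneg hρ hs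
      linarith
    · have := mul_le_mul_of_nonneg_right (hJ i hi) hs
      linarith

theorem abs_inner_diagOp_le (he : Orthonormal ℝ e) (hκ : ∀ i, |κ i| ≤ B) (hB : 0 ≤ B) (v : H) :
    |inner ℝ (diagOp e κ v) v| ≤ B * ‖v‖ ^ 2 := by
  have h1 : HasSum (fun i => B * inner ℝ (e i) v ^ 2) (B * ∑' i, inner ℝ (e i) v ^ 2) :=
    (summable_inner_sq he v).hasSum.mul_left B
  have h0 := mul_le_mul_of_nonneg_left (tsum_inner_sq_le he v) hB
  have h2 := hasSum_inner_diagOp he hκ v v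
  have h3 := hasSum_le (fun i => ?_) h2 h1
  have h4 := hasSum_le (fun i => ?_) h1.neg h2
  · rw [_root_.abs_le]
    constructor <;> linarith
  all_goals
    have hs := sq_nonneg (inner ℝ (e i) v)
    have hB' := _root_.abs_le.1 (hκ i)
    rw [mul_assoc, ← sq]
    nlinarith

theorem inner_diagOp_sub_le (he : Orthonormal ℝ e) (hκ : ∀ i, |κ i| ≤ B)
    (hκ' : ∀ i, |κ' i| ≤ B') {ε : ℝ} (hε : 0 ≤ ε) (h : ∀ i, |κ i - κ' i| ≤ ε) (v : H) :
    |inner ℝ (diagOp e κ v) v - inner ℝ (diagOp e κ' v) v| ≤ ε * ‖v‖ ^ 2 := by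
  have h1 := abs_inner_diagOp_le (κ := fun i => κ i - κ' i) he h hε v
  have h2 : inner ℝ (diagOp e (fun i => κ i - κ' i) v) v =
      inner ℝ (diagOp e κ v) v - inner ℝ (diagOp e κ' v) v := by
    refine (hasSum_inner_diagOp he h v v).unique ?_
    refine hasSum_of_eq ((hasSum_inner_diagOp he hκ v v).sub (hasSum_inner_diagOp he hκ' v v)) fun i => ?_
    ring
  rwa [← h2]

/-- Subtracting `½ ⟨diagOp v, v⟩` from a strongly convex functional. -/
theorem QuadBounds.sub_diagOp_lower (he : Orthonormal ℝ e) (hκ : ∀ i, |κ i| ≤ B) (hB : 0 ≤ B)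
    {ρ : ℝ} (hρ : 0 ≤ ρ) {J : Finset ι} (hJ : ∀ i, i ∉ J → κ i ≤ ρ) {K : H → ℝ} {N : H → H}
    {σ L : ℝ} (h : QuadBounds K N σ L) (x d : H) :
    (K x - inner ℝ (diagOp e κ x) x / 2) + inner ℝ (N x - diagOp e κ x) d
      + (σ - ρ) / 2 * ‖d‖ ^ 2 - (B * J.card / 2) * ‖coordMap e J d‖ ^ 2 ≤
      K (x + d) - inner ℝ (diagOp e κ (x + d)) (x + d) / 2 := by
  have h1 := (h x d).1
  have h2 := inner_diagOp_le he hκ hρ J hJ d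
  have h3 := mul_le_mul_of_nonneg_left (sum_inner_sq_le e J d) hB
  rw [inner_diagOp_add he hκ, inner_sub_left]
  linarith

theorem QuadBounds.sub_diagOp_upper (he : Orthonormal ℝ e) (hκ : ∀ i, |κ i| ≤ B) (hB : 0 ≤ B)
    {K : H → ℝ} {N : H → H} {σ L : ℝ} (h : QuadBounds K N σ L) (x d : H) :
    K (x + d) - inner ℝ (diagOp e κ (x + d)) (x + d) / 2 ≤
      (K x - inner ℝ (diagOp e κ x) x / 2) + inner ℝ (N x - diagOp e κ x) d
      + (L + B) / 2 * ‖d‖ ^ 2 := by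
  have h1 := (h x d).2
  have h2 := (_root_.abs_le.1 (abs_inner_diagOp_le he hκ hB d)).1
  rw [inner_diagOp_add he hκ, inner_sub_left]
  linarith

end Diagonal

/-! ## Superposition operators on `L²` -/

/-- The primitive `∫₀ˣ g(z,τ) dτ`. -/
noncomputable def primitive (g : Strip → ℝ → ℝ) (z : Strip) (x : ℝ) : ℝ :=
  ∫ τ in (0 : ℝ)..x, g z τ

/-- The slope of `g(z,·)` lies in `[σ, L]`. -/
def SlopeBounds (g : Strip → ℝ → ℝ) (σ L : ℝ) : Prop :=
  ∀ z, Monotone (fun x => g z x - σ * x) ∧ Antitone fun x => g z x - L * x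

section Superposition

variable {g : Strip → ℝ → ℝ} {σ L : ℝ}

theorem continuous_slice (hg : Continuous (Function.uncurry g)) (z : Strip) :
    Continuous (g z) := by fun_prop

theorem continuous_primitive (hg : Continuous (Function.uncurry g)) :
    Continuous (Function.uncurry (primitive g)) :=
  intervalIntegral.continuous_parametric_intervalIntegral_of_continuous
    (f := fun (q : Strip × ℝ) τ => g q.1 τ) (s := fun q : Strip × ℝ => q.2) (a₀ := 0)
    (by fun_prop) continuous_snd

theorem hasDerivAt_primitive (hg : Continuous (Function.uncurry g)) (z : Strip) (x : ℝ) :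
    HasDerivAt (primitive g z) (g z x) x :=
  (continuous_slice hg z).integral_hasStrictDerivAt 0 x |>.hasDerivAt

/-- A function whose derivative has the sign of the variable is nonnegative if it vanishes
at `0`. -/
theorem nonneg_of_deriv_sign {f f' : ℝ → ℝ} (hf : ∀ x, HasDerivAt f (f' x) x) (h0 : f 0 = 0)
    (hpos : ∀ x, 0 ≤ x → 0 ≤ f' x) (hneg : ∀ x, x ≤ 0 → f' x ≤ 0) (x : ℝ) : 0 ≤ f x := by
  have hc : Continuous f := continuous_iff_continuousAt.2 fun x => (hf x).continuousAt
  rcases le_total 0 x with hx | hx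
  · have := monotoneOn_of_deriv_nonneg (convex_Ici (0 : ℝ)) hc.continuousOn
      (fun y _ => (hf y).differentiableAt.differentiableWithinAt) (fun y hy => by
        rw [(hf y).deriv]; rw [interior_Ici] at hy; exact hpos y (le_of_lt hy))
    rw [← h0]
    exact this (Set.mem_Ici.2 le_rfl) hx hx
  · have := antitoneOn_of_deriv_nonpos (convex_Iic (0 : ℝ)) hc.continuousOn
      (fun y _ => (hf y).differentiableAt.differentiableWithinAt) (fun y hy => by
        rw [(hf y).deriv]; rw [interior_Iic] at hy; exact hneg y (le_of_lt hy))
    rw [← h0]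
    exact this hx (Set.mem_Iic.2 le_rfl) hx

/-- As a function of `d`, the difference of the two sides vanishes at `0`, and its derivative
`g(x+d) - g(x) - σd` has the sign of `d`. No differentiability of `g` is needed. -/
theorem primitive_add_lower (hg : Continuous (Function.uncurry g))
    (hs : ∀ z, Monotone fun x => g z x - σ * x) (z : Strip) (x d : ℝ) :
    σ / 2 * d ^ 2 ≤ primitive g z (x + d) - primitive g z x - g z x * d := by
  have key := nonneg_of_deriv_sign
    (f := fun d => primitive g z (x + d) - primitive g z x - g z x * d - σ / 2 * d ^ 2)
    (f' := fun d => g z (x + d) - g z x - σ * d) (fun d => ?_) (by simp) (fun d hd => ?_)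
    (fun d hd => ?_) d
  · linarith
  · have h1 : HasDerivAt (fun d => primitive g z (x + d)) (g z (x + d)) d := by
      simpa using (hasDerivAt_primitive hg z (x + d)).comp_const_add x d
    have h2 : HasDerivAt (fun d : ℝ => g z x * d) (g z x) d := by
      simpa using (hasDerivAt_id d).const_mul (g z x)
    have h3 : HasDerivAt (fun d : ℝ => σ / 2 * d ^ 2) (σ * d) d := by
      have := (hasDerivAt_pow 2 d).const_mul (σ / 2)
      have e : σ / 2 * ((2 : ℕ) * d ^ (2 - 1)) = σ * d := by norm_num; ring
      rwa [e] at this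
    exact ((h1.sub_const _).sub h2).sub h3
  · have := hs z (show x ≤ x + d by linarith)
    simp only at this
    linarith
  · have := hs z (show x + d ≤ x by linarith)
    simp only at this
    linarith

theorem primitive_neg (z : Strip) (x : ℝ) :
    primitive (fun z x => -g z x) z x = -primitive g z x :=
  intervalIntegral.integral_neg

theorem primitive_add_upper (hg : Continuous (Function.uncurry g))
    (hs : ∀ z, Antitone fun x => g z x - L * x) (z : Strip) (x d : ℝ) :
    primitive g z (x + d) - primitive g z x - g z x * d ≤ L / 2 * d ^ 2 := by
  have := primitive_add_lower (g := fun z x => -g z x) (σ := -L)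
    (by exact hg.neg) (fun z => by
      intro x y hxy
      have := hs z hxy
      simp only at this ⊢
      linarith) z x d
  rw [primitive_neg, primitive_neg] at this
  linarith

theorem exists_bound_slice (hg : Continuous (Function.uncurry g)) (R : ℝ) :
    ∃ C, 0 ≤ C ∧ ∀ z, ∀ x, |x| ≤ R → |g z x| ≤ C := by
  obtain ⟨C, hC⟩ := ((isCompact_univ (X := Strip)).prod
    (isCompact_Icc (a := -R) (b := R))).exists_bound_of_continuousOn hg.continuousOn
  refine ⟨|C|, abs_nonneg _, fun z x hx => ?_⟩
  exact (hC (z, x) ⟨trivial, _root_.abs_le.1 hx⟩).trans (le_abs_self C)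

theorem SlopeBounds.abs_le (h : SlopeBounds g σ L) (hg : Continuous (Function.uncurry g)) :
    ∃ C, 0 ≤ C ∧ ∀ z x, |g z x| ≤ (|σ| + |L|) * |x| + C := by
  obtain ⟨C, hC0, hC⟩ := exists_bound_slice hg 0
  refine ⟨C, hC0, fun z x => ?_⟩
  have h0 := _root_.abs_le.1 (hC z 0 (by simp))
  obtain ⟨h1, h2⟩ := h z
  have e1 : |σ * x| ≤ |σ| * |x| := (abs_mul _ _).le
  have e2 : |L * x| ≤ |L| * |x| := (abs_mul _ _).le
  have e3 := _root_.abs_le.1 e1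
  have e4 := _root_.abs_le.1 e2
  rw [_root_.abs_le, add_mul]
  have p1 : 0 ≤ |σ| * |x| := by positivity
  have p2 : 0 ≤ |L| * |x| := by positivity
  rcases le_total 0 x with hx | hx
  · have a1 := h1 hx
    have a2 := h2 hx
    simp only at a1 a2
    constructor <;> linarith
  · have a1 := h1 hx
    have a2 := h2 hx
    simp only at a1 a2
    constructor <;> linarith

theorem memLp_comp (hg : Continuous (Function.uncurry g)) (h : SlopeBounds g σ L)
    (u : L2Strip) : MemLp (fun z => g z (u z)) 2 stripMeasure := by
  obtain ⟨C, hC0, hC⟩ := h.abs_le hg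
  have hmeas : AEStronglyMeasurable (fun z => g z (u z)) stripMeasure :=
    hg.comp_aestronglyMeasurable
      (aestronglyMeasurable_id.prodMk (Lp.aestronglyMeasurable u))
  have hdom : MemLp (fun z => (|σ| + |L|) * ‖u z‖ + C) 2 stripMeasure :=
    ((Lp.memLp u).norm.const_mul _).add (memLp_const C)
  refine hdom.mono' hmeas (ae_of_all _ fun z => ?_)
  simpa using hC z (u z)

theorem integrable_primitive (hg : Continuous (Function.uncurry g)) (h : SlopeBounds g σ L)
    (u : L2Strip) : Integrable (fun z => primitive g z (u z)) stripMeasure := by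
  obtain ⟨C, hC0, hC⟩ := h.abs_le hg
  have hmeas : AEStronglyMeasurable (fun z => primitive g z (u z)) stripMeasure :=
    (continuous_primitive hg).comp_aestronglyMeasurable
      (aestronglyMeasurable_id.prodMk (Lp.aestronglyMeasurable u))
  have hu2 : Integrable (fun z => (u z) ^ 2) stripMeasure := (Lp.memLp u).integrable_sq
  have hu1 : Integrable (fun z => ‖u z‖) stripMeasure :=
    ((Lp.memLp u).integrable (by norm_num)).norm
  refine ((hu2.const_mul (|σ| + |L|)).add (hu1.const_mul C)).mono' hmeas
    (ae_of_all _ fun z => ?_)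
  have := intervalIntegral.norm_integral_le_of_norm_le_const (a := 0) (b := u z)
    (f := g z) (C := (|σ| + |L|) * |u z| + C) (fun τ hτ => by
      refine (hC z τ).trans ?_
      have : |τ| ≤ |u z| := by
        rcases le_total 0 (u z) with h0 | h0
        · rw [Set.uIoc_of_le h0] at hτ
          rw [abs_of_pos hτ.1, abs_of_nonneg h0]; exact hτ.2
        · rw [Set.uIoc_of_ge h0] at hτ
          rw [abs_of_nonpos hτ.2, abs_of_nonpos h0]; linarith [hτ.1]
      gcongr)
  refine this.trans (le_of_eq ?_)
  simp only [Pi.add_apply, sub_zero, Real.norm_eq_abs]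
  rw [← sq_abs (u z)]
  ring

/-- The superposition operator `u ↦ g(·, u(·))` on `L²`. -/
noncomputable def superpose (g : Strip → ℝ → ℝ) (hg : Continuous (Function.uncurry g)) {σ L : ℝ}
    (h : SlopeBounds g σ L) (u : L2Strip) : L2Strip :=
  (memLp_comp hg h u).toLp _

theorem coeFn_superpose (hg : Continuous (Function.uncurry g)) (h : SlopeBounds g σ L)
    (u : L2Strip) : superpose g hg h u =ᵐ[stripMeasure] fun z => g z (u z) :=
  (memLp_comp hg h u).coeFn_toLp

theorem inner_eq_integral (u v : L2Strip) :
    inner ℝ u v = ∫ z, u z * v z ∂stripMeasure := by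
  rw [L2.inner_def]
  exact integral_congr_ae (ae_of_all _ fun z => by simp [mul_comm])

theorem integrable_mul_L2 (u v : L2Strip) :
    Integrable (fun z => u z * v z) stripMeasure :=
  (Lp.memLp u).integrable_mul (Lp.memLp v)

theorem norm_sq_eq_integral (u : L2Strip) :
    ‖u‖ ^ 2 = ∫ z, (u z) ^ 2 ∂stripMeasure := by
  rw [← real_inner_self_eq_norm_sq, inner_eq_integral]
  simp only [sq]

/-- The pointwise bounds on the primitive are integrated. First-order expansions with quadratic
remainder are all that the variational argument uses, so no derivative of the superposition operator
itself is needed. -/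
theorem quadBounds_superpose (hg : Continuous (Function.uncurry g)) (h : SlopeBounds g σ L) :
    QuadBounds (fun u : L2Strip => ∫ z, primitive g z (u z) ∂stripMeasure)
      (superpose g hg h) σ L := by
  intro u d
  have i1 := integrable_primitive hg h (u + d)
  have i2 := integrable_primitive hg h u
  have i3 := integrable_mul_L2 (superpose g hg h u) d
  have i4 : Integrable (fun z => (d z) ^ 2) stripMeasure := (Lp.memLp d).integrable_sq
  simp only
  rw [inner_eq_integral, ← integral_sub i1 i2, ← integral_sub (by exact i1.sub i2) i3,
    norm_sq_eq_integral, ← integral_const_mul, ← integral_const_mul]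
  constructor
  · refine integral_mono_ae (i4.const_mul _) ((i1.sub i2).sub i3) ?_
    filter_upwards [Lp.coeFn_add u d, coeFn_superpose hg h u] with z h1 h2
    rw [h1, h2]
    exact primitive_add_lower hg (fun z => (h z).1) z (u z) (d z)
  · refine integral_mono_ae ((i1.sub i2).sub i3) (i4.const_mul _) ?_
    filter_upwards [Lp.coeFn_add u d, coeFn_superpose hg h u] with z h1 h2
    rw [h1, h2]
    exact primitive_add_upper hg (fun z => (h z).2) z (u z) (d z)

end Superposition

/-! ## The piecewise linear nonlinearity -/

/-- The function `α u⁺ - β u⁻`. -/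
def jump (α β : ℝ) (_ : Strip) (x : ℝ) : ℝ := α * max x 0 - β * max (-x) 0

theorem continuous_jump (α β : ℝ) : Continuous (Function.uncurry (jump α β)) := by
  unfold jump Function.uncurry; fun_prop

theorem jump_of_nonneg (α β : ℝ) (z : Strip) {x : ℝ} (hx : 0 ≤ x) : jump α β z x = α * x := by
  rw [jump, max_eq_left hx, max_eq_right (by linarith)]; ring

theorem jump_of_nonpos (α β : ℝ) (z : Strip) {x : ℝ} (hx : x ≤ 0) : jump α β z x = β * x := by
  rw [jump, max_eq_right hx, max_eq_left (by linarith)]; ring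

theorem slopeBounds_jump (α β : ℝ) : SlopeBounds (jump α β) (min α β) (max α β) := by
  intro z
  have h1 := min_le_left α β
  have h2 := min_le_right α β
  have h3 := le_max_left α β
  have h4 := le_max_right α β
  constructor
  · intro x y hxy
    simp only
    rcases le_total 0 x with hx | hx <;> rcases le_total 0 y with hy | hy
    · rw [jump_of_nonneg _ _ _ hx, jump_of_nonneg _ _ _ hy]; nlinarith
    · rw [le_antisymm (hxy.trans hy) hx, le_antisymm hy (hx.trans hxy)]
    · rw [jump_of_nonpos _ _ _ hx, jump_of_nonneg _ _ _ hy]; nlinarith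
    · rw [jump_of_nonpos _ _ _ hx, jump_of_nonpos _ _ _ hy]; nlinarith
  · intro x y hxy
    simp only
    rcases le_total 0 x with hx | hx <;> rcases le_total 0 y with hy | hy
    · rw [jump_of_nonneg _ _ _ hx, jump_of_nonneg _ _ _ hy]; nlinarith
    · rw [le_antisymm (hxy.trans hy) hx, le_antisymm hy (hx.trans hxy)]
    · rw [jump_of_nonpos _ _ _ hx, jump_of_nonneg _ _ _ hy]; nlinarith
    · rw [jump_of_nonpos _ _ _ hx, jump_of_nonpos _ _ _ hy]; nlinarith

theorem primitive_jump (α β : ℝ) (z : Strip) (x : ℝ) :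
    primitive (jump α β) z x = α / 2 * (max x 0) ^ 2 + β / 2 * (max (-x) 0) ^ 2 := by
  have hlin : ∀ c : ℝ, ∫ τ in (0 : ℝ)..x, c * τ = c / 2 * x ^ 2 := fun c => by
    rw [intervalIntegral.integral_const_mul, integral_id]; ring
  rcases le_total 0 x with hx | hx
  · rw [max_eq_left hx, max_eq_right (by linarith), primitive,
      intervalIntegral.integral_congr (g := fun τ => α * τ) (fun τ hτ => ?_), hlin]
    · ring
    · rw [Set.uIcc_of_le hx] at hτ
      exact jump_of_nonneg _ _ _ hτ.1
  · rw [max_eq_right hx, max_eq_left (by linarith), primitive,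
      intervalIntegral.integral_congr (g := fun τ => β * τ) (fun τ hτ => ?_), hlin]
    · ring
    · rw [Set.uIcc_of_ge hx] at hτ
      exact jump_of_nonpos _ _ _ hτ.2

/-- The functional `½ (α ‖u⁺‖² + β ‖u⁻‖²)`. -/
noncomputable def jumpEnergy (α β : ℝ) (u : L2Strip) : ℝ :=
  ∫ z, primitive (jump α β) z (u z) ∂stripMeasure

noncomputable def jumpOp (α β : ℝ) : L2Strip → L2Strip :=
  superpose (jump α β) (continuous_jump α β) (slopeBounds_jump α β)

theorem norm_sq_posPart (u : L2Strip) :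
    ‖Lp.posPart u‖ ^ 2 = ∫ z, (max (u z) 0) ^ 2 ∂stripMeasure := by
  rw [norm_sq_eq_integral]
  refine integral_congr_ae ?_
  filter_upwards [Lp.coeFn_posPart u] with z hz
  rw [hz]

theorem norm_sq_negPart (u : L2Strip) :
    ‖Lp.negPart u‖ ^ 2 = ∫ z, (max (-u z) 0) ^ 2 ∂stripMeasure := by
  rw [norm_sq_eq_integral]
  refine integral_congr_ae ?_
  filter_upwards [Lp.coeFn_negPart_eq_max u] with z hz
  rw [hz]

theorem integrable_posPart_sq (u : L2Strip) :
    Integrable (fun z => (max (u z) 0) ^ 2) stripMeasure := by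
  refine (Lp.memLp (Lp.posPart u)).integrable_sq.congr ?_
  filter_upwards [Lp.coeFn_posPart u] with z hz
  rw [hz]

theorem integrable_negPart_sq (u : L2Strip) :
    Integrable (fun z => (max (-u z) 0) ^ 2) stripMeasure := by
  refine (Lp.memLp (Lp.negPart u)).integrable_sq.congr ?_
  filter_upwards [Lp.coeFn_negPart_eq_max u] with z hz
  rw [hz]

theorem jumpEnergy_eq (α β : ℝ) (u : L2Strip) :
    jumpEnergy α β u = α / 2 * ‖Lp.posPart u‖ ^ 2 + β / 2 * ‖Lp.negPart u‖ ^ 2 := by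
  rw [norm_sq_posPart, norm_sq_negPart, ← integral_const_mul, ← integral_const_mul,
    ← integral_add ((integrable_posPart_sq u).const_mul _) ((integrable_negPart_sq u).const_mul _)]
  exact integral_congr_ae (ae_of_all _ fun z => primitive_jump α β z (u z))

theorem norm_sq_posPart_add_negPart (u : L2Strip) :
    ‖Lp.posPart u‖ ^ 2 + ‖Lp.negPart u‖ ^ 2 = ‖u‖ ^ 2 := by
  rw [norm_sq_posPart, norm_sq_negPart, norm_sq_eq_integral,
    ← integral_add (integrable_posPart_sq u) (integrable_negPart_sq u)]
  refine integral_congr_ae (ae_of_all _ fun z => ?_)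
  simp only
  rcases le_total 0 (u z) with h | h
  · rw [max_eq_left h, max_eq_right (by linarith)]; ring
  · rw [max_eq_right h, max_eq_left (by linarith)]; ring

theorem coeFn_jumpOp (α β : ℝ) (u : L2Strip) :
    jumpOp α β u =ᵐ[stripMeasure] fun z => jump α β z (u z) :=
  coeFn_superpose _ _ u

theorem quadBounds_jump (α β : ℝ) :
    QuadBounds (jumpEnergy α β) (jumpOp α β) (min α β) (max α β) :=
  quadBounds_superpose _ _

theorem inner_jumpOp_self (α β : ℝ) (u : L2Strip) :
    inner ℝ (jumpOp α β u) u = 2 * jumpEnergy α β u := by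
  rw [inner_eq_integral, jumpEnergy, ← integral_const_mul]
  refine integral_congr_ae ?_
  filter_upwards [coeFn_jumpOp α β u] with z hz
  rw [hz, primitive_jump]
  rcases le_total 0 (u z) with h | h
  · rw [jump_of_nonneg _ _ _ h, max_eq_left h, max_eq_right (by linarith)]; ring
  · rw [jump_of_nonpos _ _ _ h, max_eq_right h, max_eq_left (by linarith)]; ring

/-- Positive factors preserve the sign of `u`, so the slopes multiply. In particular `jumpOp (1/α)
(1/β)` inverts `jumpOp α β` for positive `α`, `β`. -/
theorem jumpOp_jumpOp {α β α' β' : ℝ} (hα : 0 < α) (hβ : 0 < β) (u : L2Strip) :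
    jumpOp α' β' (jumpOp α β u) = jumpOp (α' * α) (β' * β) u := by
  refine Lp.ext ?_
  filter_upwards [coeFn_jumpOp α β u, coeFn_jumpOp α' β' (jumpOp α β u),
    coeFn_jumpOp (α' * α) (β' * β) u] with z h1 h2 h3
  rw [h2, h3, h1]
  rcases le_total 0 (u z) with h | h
  · rw [jump_of_nonneg α β _ h, jump_of_nonneg _ _ _ h, jump_of_nonneg _ _ _ (by positivity)]
    ring
  · rw [jump_of_nonpos α β _ h, jump_of_nonpos _ _ _ h, jump_of_nonpos _ _ _ (by nlinarith)]
    ring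

theorem jumpOp_add_smul (α β c : ℝ) (u : L2Strip) :
    jumpOp α β u + c • u = jumpOp (α + c) (β + c) u := by
  refine Lp.ext ?_
  filter_upwards [coeFn_jumpOp α β u, coeFn_jumpOp (α + c) (β + c) u, Lp.coeFn_smul c u,
    Lp.coeFn_add (jumpOp α β u) (c • u)] with z h1 h2 h3 h4
  rw [h4, Pi.add_apply, h1, h2, h3, Pi.smul_apply, smul_eq_mul]
  rcases le_total 0 (u z) with h | h
  · rw [jump_of_nonneg _ _ _ h, jump_of_nonneg _ _ _ h]; ring
  · rw [jump_of_nonpos _ _ _ h, jump_of_nonpos _ _ _ h]; ring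

theorem jumpOp_one (u : L2Strip) : jumpOp 1 1 u = u := by
  refine Lp.ext ?_
  filter_upwards [coeFn_jumpOp 1 1 u] with z h1
  rw [h1]
  rcases le_total 0 (u z) with h | h
  · rw [jump_of_nonneg _ _ _ h, one_mul]
  · rw [jump_of_nonpos _ _ _ h, one_mul]

theorem jumpEnergy_lower {α β m : ℝ} (hα : m ≤ α) (hβ : m ≤ β) (u : L2Strip) :
    m / 2 * ‖u‖ ^ 2 ≤ jumpEnergy α β u := by
  rw [jumpEnergy_eq, ← norm_sq_posPart_add_negPart]
  nlinarith [sq_nonneg ‖Lp.posPart u‖, sq_nonneg ‖Lp.negPart u‖]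

theorem abs_jumpEnergy_sub_le {α β α' β' ε : ℝ} (hα : |α - α'| ≤ ε) (hβ : |β - β'| ≤ ε)
    (u : L2Strip) : |jumpEnergy α β u - jumpEnergy α' β' u| ≤ ε / 2 * ‖u‖ ^ 2 := by
  rw [jumpEnergy_eq, jumpEnergy_eq, ← norm_sq_posPart_add_negPart u]
  have h1 := _root_.abs_le.1 hα
  have h2 := _root_.abs_le.1 hβ
  rw [_root_.abs_le]
  constructor <;> nlinarith [sq_nonneg ‖Lp.posPart u‖, sq_nonneg ‖Lp.negPart u‖]

/-! ## Integration by parts on the strip -/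

theorem IsSmooth.hasDerivAt_partialS {f : ℝ × Circ → ℝ} (hf : IsSmooth f) (s : ℝ) (t : Circ) :
    HasDerivAt (fun σ => f (σ, t)) (partialS f (s, t)) s := by
  induction t using QuotientAddGroup.induction_on with
  | H t =>
    have h1 : Differentiable ℝ (fun q : ℝ × ℝ => f (q.1, (q.2 : Circ))) :=
      ContDiff.differentiable hf (by simp)
    have h2 : Differentiable ℝ (fun σ : ℝ => f (σ, (t : Circ))) :=
      h1.comp (g := fun q : ℝ × ℝ => f (q.1, (q.2 : Circ))) (f := fun σ : ℝ => (σ, t))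
        (by fun_prop)
    exact (h2 s).hasDerivAt

theorem IsSmooth.differentiable_snd {f : ℝ × Circ → ℝ} (hf : IsSmooth f) (s : ℝ) :
    Differentiable ℝ (fun τ : ℝ => f (s, (τ : Circ))) := by
  have h1 : Differentiable ℝ (fun q : ℝ × ℝ => f (q.1, (q.2 : Circ))) :=
    ContDiff.differentiable hf (by simp)
  exact h1.comp (g := fun q : ℝ × ℝ => f (q.1, (q.2 : Circ))) (f := fun τ : ℝ => (s, τ))
    (by fun_prop)

theorem IsSmooth.hasDerivAt_partialT {f : ℝ × Circ → ℝ} (hf : IsSmooth f) (s t : ℝ) :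
    HasDerivAt (fun τ : ℝ => f (s, (τ : Circ))) (partialT f (s, (t : Circ))) t := by
  have h := (hf.differentiable_snd s t).hasDerivAt
  suffices e : partialT f (s, (t : Circ)) = deriv (fun τ : ℝ => f (s, (τ : Circ))) t by rwa [e]
  have := deriv_comp_const_add (f := fun τ : ℝ => f (s, (τ : Circ))) t 0
  rw [add_zero] at this
  rw [← this, partialT]
  rfl

theorem IsSmooth.mul {f g : ℝ × Circ → ℝ} (hf : IsSmooth f) (hg : IsSmooth g) :
    IsSmooth (fun q => f q * g q) :=
  ContDiff.mul hf hg

theorem IsSmooth.partialS_mul {f g : ℝ × Circ → ℝ} (hf : IsSmooth f) (hg : IsSmooth g)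
    (q : ℝ × Circ) :
    partialS (fun q => f q * g q) q = partialS f q * g q + f q * partialS g q :=
  ((hf.hasDerivAt_partialS q.1 q.2).mul (hg.hasDerivAt_partialS q.1 q.2)).deriv

theorem IsSmooth.partialT_mul {f g : ℝ × Circ → ℝ} (hf : IsSmooth f) (hg : IsSmooth g)
    (q : ℝ × Circ) :
    partialT (fun q => f q * g q) q = partialT f q * g q + f q * partialT g q := by
  obtain ⟨s, t⟩ := q
  induction t using QuotientAddGroup.induction_on with
  | H t =>
    exact ((hf.mul hg).hasDerivAt_partialT s t).unique
      ((hf.hasDerivAt_partialT s t).mul (hg.hasDerivAt_partialT s t))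

theorem integrable_of_continuous {g : ℝ × Circ → ℝ} (hg : Continuous g) :
    Integrable (fun z => g (incl z)) stripMeasure := by
  have hg' : Continuous (fun z : Strip => g (incl z)) := hg.comp continuous_incl
  obtain ⟨C, hC⟩ := (isCompact_univ (X := Strip)).exists_bound_of_continuousOn hg'.continuousOn
  exact Integrable.of_bound hg'.aestronglyMeasurable C (ae_of_all _ fun z => hC z trivial)

theorem integral_intervalMeasure (g : ℝ → ℝ) :
    ∫ s, g (s : ℝ) ∂intervalMeasure = ∫ s in (0 : ℝ)..π, g s := by
  rw [intervalIntegral.integral_of_le pi_pos.le, ← integral_Icc_eq_integral_Ioc]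
  exact integral_subtype_comap measurableSet_Icc g

theorem integral_partialS_eq_zero {f : ℝ × Circ → ℝ} (hf : IsSmooth f)
    (h0 : ∀ t, f (0, t) = 0) (hπ : ∀ t, f (π, t) = 0) :
    ∫ z, partialS f (incl z) ∂stripMeasure = 0 := by
  have hint := integrable_of_continuous hf.continuous_partialS
  rw [stripMeasure] at hint ⊢
  rw [integral_prod_symm _ hint]
  refine integral_eq_zero_of_ae (ae_of_all _ fun t => ?_)
  have h1 := integral_intervalMeasure (fun s => partialS f (s, t))
  have h2 : ∫ s in (0 : ℝ)..π, partialS f (s, t) = f (π, t) - f (0, t) :=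
    intervalIntegral.integral_eq_sub_of_hasDerivAt
      (fun s _ => hf.hasDerivAt_partialS s t)
      ((hf.continuous_partialS.comp (by fun_prop :
        Continuous fun s : ℝ => (s, t))).intervalIntegrable _ _)
  rw [h0, hπ, sub_zero] at h2
  exact h1.trans h2

theorem integral_partialT_eq_zero {f : ℝ × Circ → ℝ} (hf : IsSmooth f) :
    ∫ z, partialT f (incl z) ∂stripMeasure = 0 := by
  have hint := integrable_of_continuous hf.continuous_partialT
  rw [stripMeasure] at hint ⊢
  rw [integral_prod _ hint]
  refine integral_eq_zero_of_ae (ae_of_all _ fun s => ?_)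
  have h1 := AddCircle.intervalIntegral_preimage (2 * π) 0 (fun t => partialT f ((s : ℝ), t))
  have h2 : ∫ t in (0 : ℝ)..(0 + 2 * π), partialT f ((s : ℝ), (t : Circ)) =
      f ((s : ℝ), ((0 + 2 * π : ℝ) : Circ)) - f ((s : ℝ), ((0 : ℝ) : Circ)) :=
    intervalIntegral.integral_eq_sub_of_hasDerivAt (f := fun t : ℝ => f ((s : ℝ), (t : Circ)))
      (fun t _ => hf.hasDerivAt_partialT s t)
      ((hf.continuous_partialT.comp (continuous_const.prodMk
        (AddCircle.continuous_mk' (2 * π)))).intervalIntegrable _ _)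
  have h3 : ((0 + 2 * π : ℝ) : Circ) = ((0 : ℝ) : Circ) := by
    rw [zero_add, AddCircle.coe_period]; rfl
  rw [h3, sub_self] at h2
  exact h1.symm.trans h2

theorem integral_mul_partialS {f g : ℝ × Circ → ℝ} (hf : IsSmooth f) (hg : IsSmooth g)
    (h0 : ∀ t, f (0, t) = 0) (hπ : ∀ t, f (π, t) = 0) :
    ∫ z, f (incl z) * partialS g (incl z) ∂stripMeasure =
      -∫ z, partialS f (incl z) * g (incl z) ∂stripMeasure := by
  have h := integral_partialS_eq_zero (hf.mul hg) (fun t => by rw [h0, zero_mul])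
    (fun t => by rw [hπ, zero_mul])
  simp only [hf.partialS_mul hg] at h
  rw [integral_add (by exact integrable_of_continuous (hf.continuous_partialS.mul hg.continuous))
    (by exact integrable_of_continuous (hf.continuous.mul hg.continuous_partialS))] at h
  linarith

theorem integral_mul_partialT {f g : ℝ × Circ → ℝ} (hf : IsSmooth f) (hg : IsSmooth g) :
    ∫ z, f (incl z) * partialT g (incl z) ∂stripMeasure =
      -∫ z, partialT f (incl z) * g (incl z) ∂stripMeasure := by
  have h := integral_partialT_eq_zero (hf.mul hg)
  simp only [hf.partialT_mul hg] at h
  rw [integral_add (by exact integrable_of_continuous (hf.continuous_partialT.mul hg.continuous))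
    (by exact integrable_of_continuous (hf.continuous.mul hg.continuous_partialT))] at h
  linarith

/-- The restriction of a continuous function to the strip, as an element of `L²`. -/
noncomputable def toL2 (f : ℝ × Circ → ℝ) (hf : Continuous f) : L2Strip :=
  ContinuousMap.toLp 2 stripMeasure ℝ ⟨fun z => f (incl z), hf.comp continuous_incl⟩

theorem coeFn_toL2 {f : ℝ × Circ → ℝ} (hf : Continuous f) :
    toL2 f hf =ᵐ[stripMeasure] fun z => f (incl z) :=
  ContinuousMap.coeFn_toLp _ _

theorem integral_toL2_mul {f g : ℝ × Circ → ℝ} (hf : Continuous f) :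
    ∫ z, toL2 f hf z * g (incl z) ∂stripMeasure =
      ∫ z, f (incl z) * g (incl z) ∂stripMeasure := by
  refine integral_congr_ae ?_
  filter_upwards [coeFn_toL2 hf] with z hz
  rw [hz]

theorem inner_toL2 (x : L2Strip) {f : ℝ × Circ → ℝ} (hf : Continuous f) :
    inner ℝ x (toL2 f hf) = ∫ z, x z * f (incl z) ∂stripMeasure := by
  rw [inner_eq_integral]
  refine integral_congr_ae ?_
  filter_upwards [coeFn_toL2 hf] with z hz
  rw [hz]

/-! ## Test functions without compact support in `t`-derivatives -/

/-- A smooth cut-off function equal to `1` on most of `]0,π[`. -/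
noncomputable def cutoff (j : ℕ) (s : ℝ) : ℝ :=
  Real.smoothTransition ((j + 1) * s - 1) * Real.smoothTransition ((j + 1) * (π - s) - 1)

theorem contDiff_cutoff (j : ℕ) : ContDiff ℝ ∞ (cutoff j) := by
  unfold cutoff
  exact (Real.smoothTransition.contDiff.comp (by fun_prop)).mul
    (Real.smoothTransition.contDiff.comp (by fun_prop))

theorem abs_cutoff_le (j : ℕ) (s : ℝ) : |cutoff j s| ≤ 1 := by
  rw [cutoff, abs_mul, abs_of_nonneg (Real.smoothTransition.nonneg _),
    abs_of_nonneg (Real.smoothTransition.nonneg _)]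
  exact mul_le_one₀ (Real.smoothTransition.le_one _) (Real.smoothTransition.nonneg _)
    (Real.smoothTransition.le_one _)

theorem cutoff_eq_zero (j : ℕ) {s : ℝ} (hs : s ∉ Set.Icc (1 / (j + 1) : ℝ) (π - 1 / (j + 1))) :
    cutoff j s = 0 := by
  have hj : (0 : ℝ) < j + 1 := by positivity
  rw [Set.mem_Icc, not_and_or, not_le, not_le] at hs
  rw [cutoff]
  rcases hs with hs | hs
  · rw [Real.smoothTransition.zero_of_nonpos, zero_mul]
    rw [lt_div_iff₀ hj] at hs; linarith
  · rw [Real.smoothTransition.zero_of_nonpos (x := (j + 1) * (π - s) - 1), mul_zero]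
    have : π - s < 1 / (j + 1) := by linarith
    rw [lt_div_iff₀ hj] at this; linarith

theorem tendsto_cutoff {s : ℝ} (hs : s ∈ Set.Ioo (0 : ℝ) π) :
    Tendsto (fun j => cutoff j s) atTop (𝓝 1) := by
  have key : ∀ r : ℝ, 0 < r → ∀ᶠ j : ℕ in atTop, 1 ≤ (j + 1 : ℝ) * r - 1 := by
    intro r hr
    obtain ⟨J, hJ⟩ := exists_nat_gt (2 / r)
    filter_upwards [eventually_ge_atTop J] with j hj
    have h1 : 2 / r < (j + 1 : ℝ) := by
      have : (J : ℝ) ≤ j := by exact_mod_cast hj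
      linarith
    rw [div_lt_iff₀ hr] at h1
    linarith
  refine tendsto_const_nhds.congr' ?_
  filter_upwards [key s hs.1, key (π - s) (by linarith [hs.2])] with j h1 h2
  rw [cutoff, Real.smoothTransition.one_of_one_le h1, Real.smoothTransition.one_of_one_le h2,
    one_mul]

theorem ae_mem_Ioo : ∀ᵐ z ∂stripMeasure, ((z.1 : ℝ)) ∈ Set.Ioo (0 : ℝ) π := by
  have h : ∀ᵐ s : Set.Icc (0 : ℝ) π ∂intervalMeasure, (s : ℝ) ∈ Set.Ioo (0 : ℝ) π := by
    rw [intervalMeasure, ae_iff, (MeasurableEmbedding.subtype_coe measurableSet_Icc).comap_apply]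
    refine measure_mono_null (t := {0, π}) ?_ ((Set.toFinite _).measure_zero _)
    rintro _ ⟨s, hs, rfl⟩
    have h1 := s.2
    by_contra h2
    simp only [Set.mem_insert_iff, Set.mem_singleton_iff, not_or] at h2
    exact hs ⟨lt_of_le_of_ne h1.1 (Ne.symm h2.1), lt_of_le_of_ne h1.2 h2.2⟩
  exact Measure.quasiMeasurePreserving_fst.ae h

/-- The cut-off depends on `s` only and so commutes with `∂/∂t`; it can be removed by dominated
convergence. No boundary condition on `x` is involved. -/
theorem HasWeakGradient.integral_partialT {x xs xt : L2Strip} (h : HasWeakGradient x xs xt)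
    {f : ℝ × Circ → ℝ} (hf : IsSmooth f) :
    ∫ z, x z * partialT f (incl z) ∂stripMeasure = -∫ z, xt z * f (incl z) ∂stripMeasure := by
  have hlim : ∀ (y : L2Strip) (g : ℝ × Circ → ℝ), Continuous g →
      Tendsto (fun j : ℕ => ∫ z, y z * (cutoff j (incl z).1 * g (incl z)) ∂stripMeasure) atTop
        (𝓝 (∫ z, y z * g (incl z) ∂stripMeasure)) := by
    intro y g hg
    refine tendsto_integral_of_dominated_convergence (fun z => ‖y z * g (incl z)‖)
      (fun j => ?_) (integrable_mul_of_continuous y hg).norm (fun j => ae_of_all _ fun z => ?_) ?_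
    · exact (integrable_mul_of_continuous y
        (((contDiff_cutoff j).continuous.comp continuous_fst).mul hg)).aestronglyMeasurable
    · rw [mul_left_comm, norm_mul]
      exact mul_le_of_le_one_left (norm_nonneg _) (abs_cutoff_le j _)
    · filter_upwards [ae_mem_Ioo] with z hz
      have := ((tendsto_cutoff hz).mul_const (g (incl z))).const_mul (y z)
      rwa [one_mul] at this
  have hsm : ∀ j, IsSmooth (fun q => cutoff j q.1 * f q) := fun j =>
    ((contDiff_cutoff j).comp contDiff_fst).mul hf
  have hsupp : ∀ j, tsupport (fun q => cutoff j q.1 * f q) ⊆ Set.Ioo (0 : ℝ) π ×ˢ Set.univ := by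
    intro j
    have hj : (0 : ℝ) < 1 / (j + 1) := by positivity
    have hcl : IsClosed (Set.Icc (1 / (j + 1) : ℝ) (π - 1 / (j + 1)) ×ˢ (Set.univ : Set Circ)) :=
      isClosed_Icc.prod isClosed_univ
    refine (closure_minimal (fun q hq => ?_) hcl).trans
      (Set.prod_mono (fun s hs => ⟨by linarith [hs.1], by linarith [hs.2]⟩) le_rfl)
    refine ⟨?_, trivial⟩
    by_contra hq'
    exact hq (by simp only [cutoff_eq_zero j hq', zero_mul])
  have heq := fun j => (h _ (hsm j) (hsupp j)).2
  have hpt : ∀ j q, partialT (fun q => cutoff j q.1 * f q) q = cutoff j q.1 * partialT f q :=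
    fun j q => deriv_const_mul_field (cutoff j q.1)
  simp only [hpt] at heq
  refine tendsto_nhds_unique (hlim x _ hf.continuous_partialT) ?_
  simp only [heq]
  exact (hlim xt f hf.continuous).neg

/-! ## The eigenmodes -/

/-- Indices of the eigenmodes: `((j, n), false)` stands for `φ_{(j+1,n)}` and `((j, n), true)`
for `ψ_{(j+1,n)}`. -/
abbrev ModeIndex : Type := (ℕ × ℕ) × Bool

/-- The frequency in `s`. -/
def freqS (i : ModeIndex) : ℕ := i.1.1 + 1

/-- The frequency in `t`. -/
def freqT (i : ModeIndex) : ℕ := i.1.2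

/-- `cos (n t)` or `sin (n t)`. -/
noncomputable def trigT (b : Bool) (n : ℕ) (t : Circ) : ℝ :=
  if b then (fourier (n : ℤ) t : ℂ).im else (fourier (n : ℤ) t : ℂ).re

theorem trigT_coe (b : Bool) (n : ℕ) (t : ℝ) :
    trigT b n (t : Circ) = if b then Real.sin (n * t) else Real.cos (n * t) := by
  cases b <;> simp only [trigT, fourier_coe_eq, Complex.exp_ofReal_mul_I_re,
    Complex.exp_ofReal_mul_I_im] <;> simp

/-- The sign in the derivative of `trigT`. -/
def trigSign (b : Bool) : ℝ := if b then 1 else -1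

theorem hasDerivAt_trigT (b : Bool) (n : ℕ) (t : Circ) :
    HasDerivAt (fun τ : ℝ => trigT b n (t + (τ : Circ))) (trigSign b * n * trigT (!b) n t) 0 := by
  induction t using QuotientAddGroup.induction_on with
  | H t =>
    have hlin : HasDerivAt (fun τ : ℝ => n * (t + τ)) (n : ℝ) 0 := by
      simpa using ((hasDerivAt_id (0 : ℝ)).const_add t).const_mul (n : ℝ)
    have e : (fun τ : ℝ => trigT b n ((t : Circ) + (τ : Circ))) =
        fun τ : ℝ => if b then Real.sin (n * (t + τ)) else Real.cos (n * (t + τ)) := by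
      funext τ
      rw [← trigT_coe]
      rfl
    have e' := trigT_coe (!b) n t
    change HasDerivAt (fun τ : ℝ => trigT b n ((t : Circ) + (τ : Circ)))
      (trigSign b * n * trigT (!b) n (t : Circ)) 0
    rw [e, e']
    cases b
    · have := hlin.cos
      simp only [add_zero] at this
      simp only [trigSign, Bool.not_false, if_true, Bool.false_eq_true, if_false]
      convert this using 1
      ring
    · have := hlin.sin
      simp only [add_zero] at this
      simp only [trigSign, Bool.not_true, if_true, Bool.false_eq_true, if_false]
      convert this using 1
      ring

/-- The eigenmode `φ` or `ψ`, as a function on `ℝ × 𝕋`. -/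
noncomputable def modeFun (i : ModeIndex) (q : ℝ × Circ) : ℝ :=
  √2 / π * Real.sin (freqS i * q.1) * trigT i.2 (freqT i) q.2

/-- The derivative of the eigenmode in `s`. -/
noncomputable def modeFunS (i : ModeIndex) (q : ℝ × Circ) : ℝ :=
  √2 / π * (freqS i * Real.cos (freqS i * q.1)) * trigT i.2 (freqT i) q.2

/-- The derivative of the eigenmode in `t`. -/
noncomputable def modeFunT (i : ModeIndex) (q : ℝ × Circ) : ℝ :=
  √2 / π * Real.sin (freqS i * q.1) * (trigSign i.2 * freqT i * trigT (!i.2) (freqT i) q.2)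

theorem contDiff_trigT (b : Bool) (n : ℕ) :
    ContDiff ℝ ∞ (fun q : ℝ × ℝ => trigT b n (q.2 : Circ)) := by
  simp only [trigT_coe]
  cases b
  · simp only [Bool.false_eq_true, if_false]; fun_prop
  · simp only [if_true]; fun_prop

theorem isSmooth_modeFun (i : ModeIndex) : IsSmooth (modeFun i) := by
  unfold IsSmooth modeFun
  exact ContDiff.mul (by fun_prop) (contDiff_trigT _ _)

theorem isSmooth_modeFunS (i : ModeIndex) : IsSmooth (modeFunS i) := by
  unfold IsSmooth modeFunS
  exact ContDiff.mul (by fun_prop) (contDiff_trigT _ _)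

theorem isSmooth_modeFunT (i : ModeIndex) : IsSmooth (modeFunT i) := by
  unfold IsSmooth modeFunT
  exact ContDiff.mul (by fun_prop) (ContDiff.mul contDiff_const (contDiff_trigT _ _))

theorem hasDerivAt_mul_left (m s : ℝ) : HasDerivAt (fun σ : ℝ => m * σ) m s := by
  simpa using (hasDerivAt_id s).const_mul m

theorem partialS_modeFun (i : ModeIndex) : partialS (modeFun i) = modeFunS i := by
  funext q
  have := (((hasDerivAt_mul_left (freqS i) q.1).sin).const_mul (√2 / π)).mul_const
    (trigT i.2 (freqT i) q.2)
  refine this.deriv.trans ?_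
  rw [modeFunS]; ring

theorem partialS_modeFunS (i : ModeIndex) (q : ℝ × Circ) :
    partialS (modeFunS i) q = -(freqS i : ℝ) ^ 2 * modeFun i q := by
  have := ((((hasDerivAt_mul_left (freqS i) q.1).cos).const_mul (freqS i : ℝ)).const_mul
    (√2 / π)).mul_const (trigT i.2 (freqT i) q.2)
  refine this.deriv.trans ?_
  rw [modeFun]; ring

theorem partialT_modeFun (i : ModeIndex) : partialT (modeFun i) = modeFunT i := by
  funext q
  exact ((hasDerivAt_trigT i.2 (freqT i) q.2).const_mul
    (√2 / π * Real.sin (freqS i * q.1))).deriv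

theorem trigSign_mul_not (b : Bool) : trigSign b * trigSign (!b) = -1 := by
  cases b <;> simp [trigSign]

theorem partialT_modeFunT (i : ModeIndex) (q : ℝ × Circ) :
    partialT (modeFunT i) q = -(freqT i : ℝ) ^ 2 * modeFun i q := by
  have := ((hasDerivAt_trigT (!i.2) (freqT i) q.2).const_mul (trigSign i.2 * freqT i)).const_mul
    (√2 / π * Real.sin (freqS i * q.1))
  refine this.deriv.trans ?_
  rw [modeFun, Bool.not_not]
  linear_combination (√2 / π * Real.sin (freqS i * q.1) * freqT i ^ 2 *
    trigT i.2 (freqT i) q.2) * trigSign_mul_not i.2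

theorem modeFun_zero (i : ModeIndex) (t : Circ) : modeFun i (0, t) = 0 := by
  simp [modeFun]

theorem modeFun_pi (i : ModeIndex) (t : Circ) : modeFun i (π, t) = 0 := by
  simp [modeFun, Real.sin_nat_mul_pi]

/-- The eigenmode and its derivatives in `L²`. -/
noncomputable def mode (i : ModeIndex) : L2Strip := toL2 (modeFun i) (isSmooth_modeFun i).continuous

noncomputable def modeS (i : ModeIndex) : L2Strip :=
  toL2 (modeFunS i) (isSmooth_modeFunS i).continuous

noncomputable def modeT (i : ModeIndex) : L2Strip :=
  toL2 (modeFunT i) (isSmooth_modeFunT i).continuous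

theorem phi_eq_mode (j n : ℕ) : phi (j + 1) n = mode ((j, n), false) := by
  rw [phi, mode, toL2]
  congr 1

theorem psi_eq_mode (j n : ℕ) : psi (j + 1) n = mode ((j, n), true) := by
  rw [psi, mode, toL2]
  congr 1

theorem hasZeroTrace_mode (i : ModeIndex) : HasZeroTrace (mode i) (modeS i) := by
  intro f hf
  rw [mode, modeS, integral_toL2_mul, integral_toL2_mul,
    integral_mul_partialS (isSmooth_modeFun i) hf (modeFun_zero i) (modeFun_pi i),
    partialS_modeFun]

theorem hasWeakGradient_mode (i : ModeIndex) :
    HasWeakGradient (mode i) (modeS i) (modeT i) := by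
  refine fun f hf _ => ⟨hasZeroTrace_mode i f hf, ?_⟩
  rw [mode, modeT, integral_toL2_mul, integral_toL2_mul,
    integral_mul_partialT (isSmooth_modeFun i) hf, partialT_modeFun]

/-- The test function is the `s`-derivative of the mode, a cosine in `s` that need not vanish on the
boundary; hence the zero trace is needed, not just the weak gradient. -/
theorem HasZeroTrace.inner_modeS {x xs : L2Strip} (h : HasZeroTrace x xs) (i : ModeIndex) :
    inner ℝ xs (modeS i) = (freqS i : ℝ) ^ 2 * inner ℝ x (mode i) := by
  have h1 := h _ (isSmooth_modeFunS i)
  simp only [partialS_modeFunS] at h1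
  rw [modeS, mode, inner_toL2, inner_toL2, ← integral_const_mul]
  rw [← neg_eq_iff_eq_neg, ← integral_neg] at h1
  rw [← h1]
  exact integral_congr_ae (ae_of_all _ fun z => by simp only; ring)

theorem HasWeakGradient.inner_modeT {x xs xt : L2Strip} (h : HasWeakGradient x xs xt)
    (i : ModeIndex) : inner ℝ xt (modeT i) = (freqT i : ℝ) ^ 2 * inner ℝ x (mode i) := by
  have h1 := h.integral_partialT (isSmooth_modeFunT i)
  simp only [partialT_modeFunT] at h1
  rw [modeT, mode, inner_toL2, inner_toL2, ← integral_const_mul]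
  rw [← neg_eq_iff_eq_neg, ← integral_neg] at h1
  rw [← h1]
  exact integral_congr_ae (ae_of_all _ fun z => by simp only; ring)

/-- For `n ≠ 0` the `t`-derivative of `φ` is `-nψ`, and the integral of `φ ∂φ/∂t` vanishes by
periodicity; for `n = 0` the sine mode is zero. -/
theorem inner_mode_not (p : ℕ × ℕ) : inner ℝ (mode (p, false)) (mode (p, true)) = 0 := by
  by_cases hn : p.2 = 0
  · have h0 : modeFun (p, true) = fun _ => 0 := by
      funext q
      simp [modeFun, freqT, hn, trigT]
    rw [mode, mode, inner_toL2, h0]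
    simp
  · have h1 := integral_mul_partialT (isSmooth_modeFun (p, false)) (isSmooth_modeFun (p, false))
    rw [partialT_modeFun] at h1
    have h2 : ∀ q, modeFunT (p, false) q = -(p.2 : ℝ) * modeFun (p, true) q := by
      intro q
      simp only [modeFunT, modeFun, freqT, freqS, trigSign]
      simp
      ring
    simp only [h2] at h1
    rw [mode, mode, inner_toL2, integral_toL2_mul]
    have h3 : ∀ z, modeFun (p, false) (incl z) * (-(p.2 : ℝ) * modeFun (p, true) (incl z)) =
        -(p.2 : ℝ) * (modeFun (p, false) (incl z) * modeFun (p, true) (incl z)) := fun z => by ring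
    have h4 : ∀ z, -(p.2 : ℝ) * modeFun (p, true) (incl z) * modeFun (p, false) (incl z) =
        -(p.2 : ℝ) * (modeFun (p, false) (incl z) * modeFun (p, true) (incl z)) := fun z => by ring
    simp only [h3, h4, integral_const_mul] at h1
    have h5 : (p.2 : ℝ) ≠ 0 := by exact_mod_cast hn
    have h6 : (p.2 : ℝ) * ∫ z, modeFun (p, false) (incl z) * modeFun (p, true) (incl z)
        ∂stripMeasure = 0 := by linarith
    exact (mul_eq_zero.1 h6).resolve_left h5

/-- Modes with different frequencies in `s` or in `t` are orthogonal because pairing their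
derivatives in that variable is symmetric but yields two different factors. No trigonometric
integral is computed. -/
theorem inner_mode_of_ne {i j : ModeIndex} (hij : i ≠ j) : inner ℝ (mode i) (mode j) = 0 := by
  by_cases hS : freqS i = freqS j
  · by_cases hT : freqT i = freqT j
    · obtain ⟨p, b⟩ := i
      obtain ⟨p', b'⟩ := j
      have hp : p = p' := Prod.ext (Nat.succ_injective hS) hT
      subst hp
      have hb : b ≠ b' := fun h => hij (by rw [h])
      cases b <;> cases b' <;> first | exact absurd rfl hb | skip
      · exact inner_mode_not p
      · rw [real_inner_comm]; exact inner_mode_not p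
    · have h1 := (hasWeakGradient_mode i).inner_modeT j
      have h2 := (hasWeakGradient_mode j).inner_modeT i
      rw [real_inner_comm, h1, real_inner_comm (mode i) (mode j)] at h2
      have h3 : ((freqT j : ℝ) ^ 2 - (freqT i : ℝ) ^ 2) * inner ℝ (mode i) (mode j) = 0 := by
        linarith
      refine (mul_eq_zero.1 h3).resolve_left fun h4 => hT ?_
      have h5 : (freqT j : ℝ) = freqT i :=
        (pow_left_inj₀ (Nat.cast_nonneg _) (Nat.cast_nonneg _) two_ne_zero).1 (sub_eq_zero.1 h4)
      exact_mod_cast h5.symm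
  · have h1 := (hasZeroTrace_mode i).inner_modeS j
    have h2 := (hasZeroTrace_mode j).inner_modeS i
    rw [real_inner_comm, h1, real_inner_comm (mode i) (mode j)] at h2
    have h3 : ((freqS j : ℝ) ^ 2 - (freqS i : ℝ) ^ 2) * inner ℝ (mode i) (mode j) = 0 := by
      linarith
    refine (mul_eq_zero.1 h3).resolve_left fun h4 => hS ?_
    have h5 : (freqS j : ℝ) = freqS i :=
      (pow_left_inj₀ (Nat.cast_nonneg _) (Nat.cast_nonneg _) two_ne_zero).1 (sub_eq_zero.1 h4)
    exact_mod_cast h5.symm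

/-- Indices of the nonzero eigenmodes. -/
abbrev NonzeroIndex : Type := {i : ModeIndex // mode i ≠ 0}

/-- The normalized eigenmodes. -/
noncomputable def unitMode (i : NonzeroIndex) : L2Strip := ‖mode i‖⁻¹ • mode i

/-- Discarding the zero modes and normalizing is necessary: `ψ_{(m,0)} = 0` and `φ_{(m,0)}` has norm
`√2`. -/
theorem orthonormal_unitMode : Orthonormal ℝ unitMode := by
  refine ⟨fun i => ?_, fun i j hij => ?_⟩
  · rw [unitMode, norm_smul, norm_inv, norm_norm,
      inv_mul_cancel₀ (norm_ne_zero_iff.2 i.2)]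
  · simp only [unitMode]
    rw [inner_smul_left, inner_smul_right,
      inner_mode_of_ne fun h => hij (Subtype.ext h), mul_zero, mul_zero]

/-- The eigenvalue `m² - n²` of the mode. -/
def modeEig (i : ModeIndex) : ℝ := (freqS i : ℝ) ^ 2 - (freqT i : ℝ) ^ 2

theorem coeff_smul_mode (i : NonzeroIndex) (v : L2Strip) :
    coeff (mode i) v • mode i = inner ℝ (unitMode i) v • unitMode i := by
  have h : ‖mode i‖ ≠ 0 := norm_ne_zero_iff.2 i.2
  rw [unitMode, coeff, real_inner_smul_left, smul_smul]
  congr 1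
  field_simp

/-- The multipliers of `(c - □)⁻¹`. -/
noncomputable def resolventMul (c : ℝ) (i : NonzeroIndex) : ℝ := (c - modeEig i)⁻¹

/-- Zero modes contribute nothing, and the series over all modes is regrouped into the pairs `φ`,
`ψ` with the same `(m, n)`. -/
theorem resolventOp_eq_diagOp {c B : ℝ} (hB : ∀ i, |resolventMul c i| ≤ B) (v : L2Strip) :
    resolventOp c v = diagOp unitMode (resolventMul c) v := by
  have h1 := hasSum_diagOp orthonormal_unitMode hB v
  set F : ModeIndex → L2Strip := fun i => (c - modeEig i)⁻¹ • (coeff (mode i) v • mode i) with hF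
  have h2 : HasSum (F ∘ ((↑) : {i | mode i ≠ 0} → ModeIndex))
      (diagOp unitMode (resolventMul c) v) := by
    refine hasSum_of_eq h1 fun i => ?_
    simp only [hF, Function.comp_apply]
    rw [coeff_smul_mode, smul_smul]
    rfl
  rw [hasSum_subtype_iff_of_support_subset] at h2
  · have h3 : HasSum (fun p : ℕ × ℕ => ∑ b : Bool, F (p, b)) (diagOp unitMode (resolventMul c) v) :=
      h2.prod_fiberwise fun p => hasSum_fintype _
    rw [resolventOp, ← h3.tsum_eq]
    refine tsum_congr fun p => ?_
    rw [Fintype.sum_bool, phi_eq_mode, psi_eq_mode, smul_add, sub_add]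
    exact add_comm _ _
  · intro i hi h0
    exact hi (by simp only [hF, h0, smul_zero])

/-! ## Weak solutions from fixed points of the resolvent -/

/-- Used for the derivatives of the modes, which are orthogonal but not normalized and may vanish;
hence the passage to one-dimensional spans. -/
theorem summable_of_orthogonal {H ι : Type*} [NormedAddCommGroup H] [InnerProductSpace ℝ H]
    [CompleteSpace H] {f : ι → H} (hf : ∀ i j, i ≠ j → inner ℝ (f i) (f j) = 0)
    (hs : Summable fun i => ‖f i‖ ^ 2) : Summable f := by
  have hV : OrthogonalFamily ℝ (fun i => Submodule.span ℝ {f i})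
      (fun i => (Submodule.span ℝ {f i}).subtypeₗᵢ) := by
    rintro i j hij ⟨v, hv⟩ ⟨w, hw⟩
    obtain ⟨a, rfl⟩ := Submodule.mem_span_singleton.1 hv
    obtain ⟨b, rfl⟩ := Submodule.mem_span_singleton.1 hw
    simp [real_inner_smul_left, real_inner_smul_right, hf i j hij]
  exact (hV.summable_iff_norm_sq_summable
    (f := fun i => ⟨f i, Submodule.mem_span_singleton_self _⟩)).2 (by simpa using hs)

/-- For a fixed test function each condition equates continuous functions of the triple, and
`rangeSpace` is closed. Convergent series of modes with their derivatives therefore remain in the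
space. -/
theorem isClosed_sobolevSpace : IsClosed (sobolevSpace : Set (L2Strip × L2Strip × L2Strip)) := by
  have key : ∀ {f g : ℝ × Circ → ℝ} (_ : Continuous f) (_ : Continuous g)
      {a b : L2Strip × L2Strip × L2Strip → L2Strip} (_ : Continuous a) (_ : Continuous b),
      IsClosed {w | ∫ z, a w z * f (incl z) ∂stripMeasure =
        -∫ z, b w z * g (incl z) ∂stripMeasure} := by
    intro f g hf hg a b ha hb
    simp only [← inner_toL2 _ hf, ← inner_toL2 _ hg]
    exact isClosed_eq (ha.inner continuous_const) (hb.inner continuous_const).neg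
  have h1 : IsClosed {w : L2Strip × L2Strip × L2Strip | w.1 ∈ rangeSpace} :=
    (Submodule.isClosed_topologicalClosure _).preimage continuous_fst
  have h2 : IsClosed {w : L2Strip × L2Strip × L2Strip | HasWeakGradient w.1 w.2.1 w.2.2} := by
    simp only [HasWeakGradient, Set.ofPred_forall, Set.ofPred_and]
    refine isClosed_iInter fun f => isClosed_iInter fun hf => isClosed_iInter fun _ => ?_
    exact (key hf.continuous_partialS hf.continuous (by fun_prop) (by fun_prop)).inter
      (key hf.continuous_partialT hf.continuous (by fun_prop) (by fun_prop))
  have h3 : IsClosed {w : L2Strip × L2Strip × L2Strip | HasZeroTrace w.1 w.2.1} := by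
    simp only [HasZeroTrace, Set.ofPred_forall]
    refine isClosed_iInter fun f => isClosed_iInter fun hf => ?_
    exact key hf.continuous_partialS hf.continuous (by fun_prop) (by fun_prop)
  exact h1.inter (h2.inter h3)

theorem mode_mem_rangeSpace {i : ModeIndex} (hi : freqS i ≠ freqT i) : mode i ∈ rangeSpace := by
  refine Submodule.le_topologicalClosure _ (Submodule.subset_span ?_)
  obtain ⟨⟨j, n⟩, b⟩ := i
  refine ⟨j + 1, n, by omega, hi, ?_⟩
  cases b
  · exact Or.inl (phi_eq_mode j n).symm
  · exact Or.inr (psi_eq_mode j n).symm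

theorem mode_mem_kernelSpace {i : ModeIndex} (hi : freqS i = freqT i) : mode i ∈ kernelSpace := by
  refine Submodule.le_topologicalClosure _ (Submodule.subset_span ?_)
  obtain ⟨⟨j, n⟩, b⟩ := i
  have hi' : j + 1 = n := hi
  subst hi'
  refine ⟨j + 1, by omega, ?_⟩
  cases b
  · exact Or.inl (phi_eq_mode j _).symm
  · exact Or.inr (psi_eq_mode j _).symm

theorem mode_mem_sobolevSpace {i : ModeIndex} (hi : freqS i ≠ freqT i) :
    (mode i, modeS i, modeT i) ∈ sobolevSpace :=
  ⟨mode_mem_rangeSpace hi, hasWeakGradient_mode i, hasZeroTrace_mode i⟩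

theorem inner_eq_zero_of_mem_closure {S : Set L2Strip} {w x : L2Strip}
    (hS : ∀ e ∈ S, inner ℝ w e = 0) (hx : x ∈ (Submodule.span ℝ S).topologicalClosure) :
    inner ℝ w x = 0 := by
  have h1 : (Submodule.span ℝ S).topologicalClosure ≤ (innerSL ℝ w).toLinearMap.ker := by
    refine Submodule.topologicalClosure_minimal _ (Submodule.span_le.2 fun e he => ?_) ?_
    · simpa using hS e he
    · exact (innerSL ℝ w).isClosed_ker
  simpa using h1 hx

theorem phi_eq_mode' {m : ℕ} (hm : 1 ≤ m) (n : ℕ) : phi m n = mode ((m - 1, n), false) := by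
  obtain ⟨j, rfl⟩ := Nat.exists_eq_add_of_le' hm
  exact phi_eq_mode j n

theorem psi_eq_mode' {m : ℕ} (hm : 1 ≤ m) (n : ℕ) : psi m n = mode ((m - 1, n), true) := by
  obtain ⟨j, rfl⟩ := Nat.exists_eq_add_of_le' hm
  exact psi_eq_mode j n

theorem inner_eq_zero_of_mem_rangeSpace {w x : L2Strip}
    (hw : ∀ i, freqS i ≠ freqT i → inner ℝ w (mode i) = 0) (hx : x ∈ rangeSpace) :
    inner ℝ w x = 0 := by
  refine inner_eq_zero_of_mem_closure ?_ hx
  rintro e ⟨m, n, hm, hmn, rfl | rfl⟩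
  · rw [phi_eq_mode' hm]
    exact hw _ (by simp only [freqS, freqT]; omega)
  · rw [psi_eq_mode' hm]
    exact hw _ (by simp only [freqS, freqT]; omega)

theorem inner_eq_zero_of_mem_kernelSpace {w x : L2Strip}
    (hw : ∀ i, freqS i = freqT i → inner ℝ w (mode i) = 0) (hx : x ∈ kernelSpace) :
    inner ℝ w x = 0 := by
  refine inner_eq_zero_of_mem_closure ?_ hx
  rintro e ⟨m, hm, rfl | rfl⟩
  · rw [phi_eq_mode' hm]
    exact hw _ (by simp only [freqS, freqT]; omega)
  · rw [psi_eq_mode' hm]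
    exact hw _ (by simp only [freqS, freqT]; omega)

theorem inner_unitMode (i : NonzeroIndex) (v : L2Strip) :
    inner ℝ (unitMode i) v = ‖mode i‖⁻¹ * inner ℝ (mode i) v :=
  real_inner_smul_left _ _ _

theorem inner_mode_eq (i : NonzeroIndex) (v : L2Strip) :
    inner ℝ (mode i) v = ‖mode i‖ * inner ℝ (unitMode i) v := by
  rw [inner_unitMode, mul_inv_cancel_left₀ (norm_ne_zero_iff.2 i.2)]

/-- A vector with vanishing unit-mode coefficients is orthogonal to all modes. -/
theorem inner_mode_eq_zero {w : L2Strip} {i : ModeIndex}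
    (h : ∀ hi : mode i ≠ 0, inner ℝ (unitMode ⟨i, hi⟩) w = 0) : inner ℝ w (mode i) = 0 := by
  by_cases hi : mode i = 0
  · rw [hi, inner_zero_right]
  · rw [real_inner_comm, inner_mode_eq ⟨i, hi⟩, h hi, mul_zero]

/-- Eigenvalues outside the kernel are at least as large as the frequencies. -/
theorem add_freq_le_abs_modeEig {i : ModeIndex} (hi : freqS i ≠ freqT i) :
    (freqS i : ℝ) + freqT i ≤ |modeEig i| := by
  have h1 : modeEig i = ((freqS i : ℝ) - freqT i) * ((freqS i : ℝ) + freqT i) := by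
    rw [modeEig]; ring
  have h2 : (1 : ℝ) ≤ |(freqS i : ℝ) - freqT i| := by
    have h3 : (freqS i : ℤ) - freqT i ≠ 0 := by
      rw [sub_ne_zero]; exact_mod_cast hi
    have := Int.one_le_abs h3
    exact_mod_cast this
  have h4 : (0 : ℝ) ≤ (freqS i : ℝ) + freqT i := by positivity
  rw [h1, abs_mul, abs_of_nonneg h4]
  exact le_mul_of_one_le_left h4 h2

/-- The weak solution associated with a solution of `u = (c - □)⁻¹ v`. -/
theorem exists_weak_of_diagOp {c B : ℝ} (hc : ∀ i : NonzeroIndex, c ≠ modeEig i)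
    (hB : ∀ i, |resolventMul c i| ≤ B) (v : L2Strip) :
    ∃ w : sobolevSpace × kernelSpace, toFunction w = diagOp unitMode (resolventMul c) v ∧
      ∀ d : sobolevSpace × kernelSpace,
        inner ℝ (w.1 : L2Strip × L2Strip × L2Strip).2.1 (d.1 : L2Strip × L2Strip × L2Strip).2.1
          - inner ℝ (w.1 : L2Strip × L2Strip × L2Strip).2.2
              (d.1 : L2Strip × L2Strip × L2Strip).2.2 =
        inner ℝ (c • toFunction w - v) (toFunction d) := by
  classical
  set u := diagOp unitMode (resolventMul c) v with hu
  set α : NonzeroIndex → ℝ := fun i => resolventMul c i * inner ℝ (unitMode i) v with hα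
  have hαs : Summable fun i => α i ^ 2 := summable_mul_inner_sq orthonormal_unitMode hB v
  set S : Set NonzeroIndex := {i | freqS i.1 ≠ freqT i.1} with hS
  -- the three series
  set β : NonzeroIndex → ℝ := S.indicator fun i => α i * ‖mode i‖⁻¹ with hβ
  -- The gain of one derivative: off the kernel the frequencies are at most `|λ|`, where `λ` is the
  -- eigenvalue of the mode, and `λ/(c - λ) = c/(c - λ) - 1` is bounded.
  have hfreq : ∀ i, i ∈ S → ∀ r : ℝ, 0 ≤ r → r ≤ freqS i.1 + freqT i.1 →
      r ^ 2 * α i ^ 2 ≤ (1 + |c| * B) ^ 2 * inner ℝ (unitMode i) v ^ 2 := by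
    intro i hi r hr0 hr
    have h1 := hr.trans (add_freq_le_abs_modeEig hi)
    have h2 : modeEig i * resolventMul c i = c * resolventMul c i - 1 := by
      have : c - modeEig i ≠ 0 := sub_ne_zero.2 (hc i)
      rw [resolventMul]
      field_simp
      ring
    have h3 : |modeEig i * resolventMul c i| ≤ 1 + |c| * B := by
      rw [h2]
      refine (abs_sub _ _).trans ?_
      rw [abs_mul, abs_one]
      have := mul_le_mul_of_nonneg_left (hB i) (abs_nonneg c)
      linarith
    have h4 : |r * resolventMul c i| ≤ 1 + |c| * B := by
      refine le_trans ?_ h3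
      rw [abs_mul, abs_mul, abs_of_nonneg hr0]
      exact mul_le_mul_of_nonneg_right h1 (abs_nonneg _)
    have h5 := pow_le_pow_left₀ (abs_nonneg _) h4 2
    rw [sq_abs] at h5
    calc r ^ 2 * α i ^ 2 = (r * resolventMul c i) ^ 2 * inner ℝ (unitMode i) v ^ 2 := by
          rw [hα]; ring
      _ ≤ _ := mul_le_mul_of_nonneg_right h5 (sq_nonneg _)
  have hdom : Summable fun i => (1 + |c| * B) ^ 2 * inner ℝ (unitMode i) v ^ 2 :=
    (summable_inner_sq orthonormal_unitMode v).mul_left _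
  have hnS : ∀ i, ‖modeS i‖ ^ 2 = (freqS i : ℝ) ^ 2 * ‖mode i‖ ^ 2 := fun i => by
    rw [← real_inner_self_eq_norm_sq, (hasZeroTrace_mode i).inner_modeS,
      real_inner_self_eq_norm_sq]
  have hnT : ∀ i, ‖modeT i‖ ^ 2 = (freqT i : ℝ) ^ 2 * ‖mode i‖ ^ 2 := fun i => by
    rw [← real_inner_self_eq_norm_sq, (hasWeakGradient_mode i).inner_modeT,
      real_inner_self_eq_norm_sq]
  have hsumm : ∀ (f : ModeIndex → L2Strip) (r : ModeIndex → ℝ),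
      (∀ i, 0 ≤ r i ∧ r i ≤ freqS i + freqT i) → (∀ i, ‖f i‖ ^ 2 = r i ^ 2 * ‖mode i‖ ^ 2) →
      (∀ i j, i ≠ j → inner ℝ (f i) (f j) = 0) →
      Summable fun i : NonzeroIndex => β i • f i := by
    intro f r hr hf hort
    refine summable_of_orthogonal (fun i j hij => ?_) ?_
    · rw [real_inner_smul_left, real_inner_smul_right, hort _ _ fun h => hij (Subtype.ext h)]
      ring
    · refine Summable.of_nonneg_of_le (fun i => sq_nonneg _) (fun i => ?_) hdom
      by_cases hi : i ∈ S
      · have hi0 : ‖mode i‖ ≠ 0 := norm_ne_zero_iff.2 i.2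
        rw [norm_smul, mul_pow, hf, Real.norm_eq_abs, sq_abs, hβ, Set.indicator_of_mem hi]
        refine le_trans (le_of_eq ?_) (hfreq i hi (r i) (hr i).1 (hr i).2)
        field_simp
      · rw [hβ, Set.indicator_of_notMem hi, zero_smul, norm_zero, zero_pow two_ne_zero]
        exact mul_nonneg (sq_nonneg _) (sq_nonneg _)
  have hs2 := hsumm modeS (fun i => freqS i)
    (fun i => ⟨Nat.cast_nonneg _, le_add_of_nonneg_right (Nat.cast_nonneg _)⟩) hnS
    (fun i j hij => by
      rw [(hasZeroTrace_mode i).inner_modeS, inner_mode_of_ne hij, mul_zero])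
  have hs3 := hsumm modeT (fun i => freqT i)
    (fun i => ⟨Nat.cast_nonneg _, le_add_of_nonneg_left (Nat.cast_nonneg _)⟩) hnT
    (fun i j hij => by
      rw [(hasWeakGradient_mode i).inner_modeT, inner_mode_of_ne hij, mul_zero])
  have hs1 := hsumm mode (fun _ => 1)
    (fun i => ⟨zero_le_one, by
      have : 1 ≤ freqS i := by unfold freqS; omega
      have h1 : (1 : ℝ) ≤ freqS i := by exact_mod_cast this
      exact h1.trans (le_add_of_nonneg_right (Nat.cast_nonneg _))⟩) (fun i => by ring)
    (fun i j hij => inner_mode_of_ne hij)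
  have hX := hs1.hasSum.prodMk (hs2.hasSum.prodMk hs3.hasSum)
  set x := ∑' i : NonzeroIndex, β i • mode i with hx
  set xs := ∑' i : NonzeroIndex, β i • modeS i with hxs
  set xt := ∑' i : NonzeroIndex, β i • modeT i with hxt
  have hmem : (x, xs, xt) ∈ sobolevSpace := by
    refine isClosed_sobolevSpace.mem_of_tendsto hX (Eventually.of_forall fun F => ?_)
    refine sobolevSpace.sum_mem fun i _ => ?_
    by_cases hi : i ∈ S
    · exact sobolevSpace.smul_mem (β i) (mode_mem_sobolevSpace hi)
    · simp only [hβ, Set.indicator_of_notMem hi, zero_smul]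
      exact sobolevSpace.zero_mem
  have hU := hasSum_diagOp orthonormal_unitMode hB v
  rw [← hu] at hU
  -- Terms outside the kernel cancel, so only modes with `m = n` remain in `u - x`.
  have hY : HasSum (fun i => α i • unitMode i - β i • mode i) (u - x) := hU.sub hs1.hasSum
  have hymem : u - x ∈ kernelSpace := by
    refine (Submodule.isClosed_topologicalClosure _).mem_of_tendsto hY
      (Eventually.of_forall fun F => ?_)
    refine kernelSpace.sum_mem fun i _ => ?_
    by_cases hi : i ∈ S
    · have : α i • unitMode i - β i • mode i = 0 := by
        rw [hβ, Set.indicator_of_mem hi, unitMode, smul_smul, sub_self]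
      rw [this]
      exact kernelSpace.zero_mem
    · rw [hβ, Set.indicator_of_notMem hi, zero_smul, sub_zero, unitMode]
      exact kernelSpace.smul_mem _ (kernelSpace.smul_mem _
        (mode_mem_kernelSpace (not_not.1 hi)))
  refine ⟨(⟨(x, xs, xt), hmem⟩, ⟨u - x, hymem⟩), by simp [toFunction], ?_⟩
  rintro ⟨⟨⟨x', xs', xt'⟩, hx'⟩, ⟨y', hy'⟩⟩
  obtain ⟨hxr, hxg, hxz⟩ := hx'
  simp only [toFunction] at hxr hxg hxz ⊢
  rw [add_sub_cancel, inner_add_right]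
  -- coefficients of `c u - v`
  have hcoef : ∀ i : NonzeroIndex, inner ℝ (unitMode i) (c • u - v) = modeEig i * α i := fun i => by
    have : c - modeEig i ≠ 0 := sub_ne_zero.2 (hc i)
    rw [inner_sub_right, inner_smul_right, hu, inner_diagOp orthonormal_unitMode hB, hα]
    simp only [resolventMul]
    field_simp
    ring
  have hker : inner ℝ (c • u - v) y' = 0 := by
    refine inner_eq_zero_of_mem_kernelSpace (fun i hi => inner_mode_eq_zero fun h => ?_) hy'
    rw [hcoef ⟨i, h⟩, modeEig, hi, sub_self, zero_mul]
  rw [hker, add_zero]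
  have h1 : HasSum (fun i : NonzeroIndex => modeEig i * α i * inner ℝ (unitMode i) x')
      (inner ℝ (c • u - v) x') := by
    have hκ1 : ∀ i : NonzeroIndex, |(fun _ => (1 : ℝ)) i| ≤ 1 := fun i => by simp
    have h2 := hasSum_inner_diagOp orthonormal_unitMode hκ1 (c • u - v) x'
    -- With all multipliers `1`, `diagOp` is the projection onto the closed span of the modes. Its
    -- residual is orthogonal to `rangeSpace`, so completeness of the modes in `L²` is never used.
    have h3 : inner ℝ (c • u - v - diagOp unitMode (fun _ => 1) (c • u - v)) x' = 0 := by
      refine inner_eq_zero_of_mem_rangeSpace (fun i _ => inner_mode_eq_zero fun h => ?_) hxr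
      rw [inner_sub_right, inner_diagOp orthonormal_unitMode hκ1, one_mul, sub_self]
    rw [inner_sub_left, sub_eq_zero] at h3
    rw [h3]
    exact hasSum_of_eq h2 fun i => by rw [one_mul, hcoef]
  have h2 := (hs2.hasSum.mapL (innerSL ℝ xs')).sub (hs3.hasSum.mapL (innerSL ℝ xt'))
  simp only [innerSL_apply_apply, inner_smul_right, hxz.inner_modeS, hxg.inner_modeT] at h2
  rw [real_inner_comm, real_inner_comm xt']
  refine h2.unique (hasSum_of_eq h1 fun i => ?_)
  by_cases hi : i ∈ S
  · rw [hβ, Set.indicator_of_mem hi, modeEig, inner_unitMode, real_inner_comm x']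
    ring
  · rw [hβ, Set.indicator_of_notMem hi, modeEig, not_not.1 hi]
    ring

/-! ## Gaps between consecutive eigenvalues -/

theorem isWaveEigenvalue_odd (j : ℕ) : IsWaveEigenvalue ((2 * j + 1 : ℕ) : ℤ) :=
  ⟨j + 1, j, by omega, by push_cast; ring⟩

theorem isWaveEigenvalue_neg_odd (j : ℕ) : IsWaveEigenvalue (-((2 * (j + 1) + 1 : ℕ) : ℤ)) :=
  ⟨j + 1, j + 2, by omega, by push_cast; ring⟩

theorem isWaveEigenvalue_zero : IsWaveEigenvalue 0 := ⟨1, 1, le_rfl, by ring⟩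

theorem infinite_nonneg_eigenvalues :
    (Set.ofPred fun j : ℕ => IsWaveEigenvalue (j : ℤ)).Infinite :=
  Set.infinite_of_injective_forall_mem (f := fun j : ℕ => 2 * j + 1)
    (fun i j h => by simpa using h) isWaveEigenvalue_odd

theorem infinite_nonpos_eigenvalues :
    (Set.ofPred fun j : ℕ => IsWaveEigenvalue (-(j : ℤ))).Infinite :=
  Set.infinite_of_injective_forall_mem (f := fun j : ℕ => 2 * (j + 1) + 1)
    (fun i j h => by simpa using h) isWaveEigenvalue_neg_odd

theorem nth_gap {P : ℕ → Prop} (hP : (Set.ofPred P).Infinite) {j : ℕ} (hj : P j) (n : ℕ) :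
    j ≤ Nat.nth P n ∨ Nat.nth P (n + 1) ≤ j := by
  classical
  rw [← Nat.nth_count hj, Nat.nth_le_nth hP, Nat.nth_le_nth hP]
  omega

theorem eigInt_natCast (n : ℕ) :
    eigInt n = (Nat.nth (fun j : ℕ => IsWaveEigenvalue (j : ℤ)) n : ℤ) := rfl

/-- Both one-sided enumerations start at the eigenvalue `0`, so they agree at index `0` and the
negative side can be treated with natural indices throughout. -/
theorem eigInt_neg_natCast (n : ℕ) :
    eigInt (-(n : ℤ)) = -(Nat.nth (fun j : ℕ => IsWaveEigenvalue (-(j : ℤ))) n : ℤ) := by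
  cases n with
  | zero =>
    have h1 : Nat.nth (fun j : ℕ => IsWaveEigenvalue (j : ℤ)) 0 = 0 :=
      Nat.nth_zero_of_zero isWaveEigenvalue_zero
    have h2 : Nat.nth (fun j : ℕ => IsWaveEigenvalue (-(j : ℤ))) 0 = 0 :=
      Nat.nth_zero_of_zero (by simpa using isWaveEigenvalue_zero)
    rw [h2]
    change eigInt ((0 : ℕ) : ℤ) = _
    rw [eigInt_natCast, h1]
    rfl
  | succ n => rfl

/-- An eigenvalue of the sign opposite to that of the gap is separated by `0`; one of the same sign
is a value of the one-sided enumeration, whose consecutive values leave no room between them. -/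
theorem eigInt_gap (k : ℤ) {z : ℤ} (hz : IsWaveEigenvalue z) :
    z ≤ eigInt k ∨ eigInt (k + 1) ≤ z := by
  obtain ⟨n, rfl | rfl⟩ : ∃ n : ℕ, k = n ∨ k = -((n + 1 : ℕ) : ℤ) := by
    rcases le_or_gt 0 k with hk | hk
    · exact ⟨k.toNat, Or.inl (by omega)⟩
    · exact ⟨(-k - 1).toNat, Or.inr (by omega)⟩
  · have h1 : eigInt ((n : ℤ) + 1) = _ := eigInt_natCast (n + 1)
    rw [eigInt_natCast, h1]
    rcases le_total z 0 with h0 | h0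
    · exact Or.inl (h0.trans (by positivity))
    · lift z to ℕ using h0
      exact_mod_cast nth_gap infinite_nonneg_eigenvalues hz n
  · have h1 : -((n + 1 : ℕ) : ℤ) + 1 = -(n : ℤ) := by push_cast; ring
    rw [h1, eigInt_neg_natCast, eigInt_neg_natCast]
    rcases le_total 0 z with h0 | h0
    · exact Or.inr (le_trans (by simp) h0)
    · obtain ⟨j, rfl⟩ : ∃ j : ℕ, z = -(j : ℤ) := ⟨(-z).toNat, by omega⟩
      rcases nth_gap infinite_nonpos_eigenvalues hz n with h | h
      · exact Or.inr (by exact_mod_cast neg_le_neg (Int.ofNat_le.2 h))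
      · exact Or.inl (by exact_mod_cast neg_le_neg (Int.ofNat_le.2 h))

theorem modeEig_gap (k : ℤ) (i : ModeIndex) : modeEig i ≤ eig k ∨ eig (k + 1) ≤ modeEig i := by
  have h : IsWaveEigenvalue ((freqS i : ℤ) ^ 2 - (freqT i : ℤ) ^ 2) :=
    ⟨freqS i, freqT i, by unfold freqS; omega, rfl⟩
  have h1 : modeEig i = (((freqS i : ℤ) ^ 2 - (freqT i : ℤ) ^ 2 : ℤ) : ℝ) := by
    rw [modeEig]; push_cast; rfl
  rw [h1, eig, eig]
  exact_mod_cast eigInt_gap k h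

theorem eig_succ_nonpos {k : ℤ} (hk : eig k < 0) : eig (k + 1) ≤ 0 := by
  rcases eigInt_gap k isWaveEigenvalue_zero with h | h
  · have : (0 : ℝ) ≤ eig k := by rw [eig]; exact_mod_cast h
    linarith
  · rw [eig]; exact_mod_cast h

/-! ### Multipliers of the resolvent at a shift in the gap. -/

/-- `c` lies in the spectral gap above `λ_k`. -/
def InGap (k : ℤ) (c : ℝ) : Prop := eig k < c ∧ c < eig (k + 1)

/-- A bound for the norm of the resolvent at `c`. -/
noncomputable def gapBound (k : ℤ) (c : ℝ) : ℝ := 1 / min (c - eig k) (eig (k + 1) - c)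

section Gap

variable {k : ℤ} {c : ℝ}

theorem InGap.min_pos (hc : InGap k c) : 0 < min (c - eig k) (eig (k + 1) - c) :=
  lt_min (sub_pos.2 hc.1) (sub_pos.2 hc.2)

theorem InGap.gapBound_nonneg (hc : InGap k c) : 0 ≤ gapBound k c :=
  one_div_nonneg.2 hc.min_pos.le

theorem le_abs_sub_modeEig (k : ℤ) (c : ℝ) (i : ModeIndex) :
    min (c - eig k) (eig (k + 1) - c) ≤ |c - modeEig i| := by
  rcases modeEig_gap k i with h | h
  · exact (min_le_left _ _).trans ((sub_le_sub_left h c).trans (le_abs_self _))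
  · rw [abs_sub_comm]
    exact (min_le_right _ _).trans ((sub_le_sub_right h c).trans (le_abs_self _))

theorem InGap.ne_modeEig (hc : InGap k c) (i : ModeIndex) : c ≠ modeEig i := by
  intro h
  have h1 := le_abs_sub_modeEig k c i
  rw [h, sub_self, abs_zero, ← h] at h1
  exact absurd hc.min_pos (not_lt.2 h1)

theorem InGap.abs_resolventMul_le (hc : InGap k c) (i : NonzeroIndex) :
    |resolventMul c i| ≤ gapBound k c := by
  rw [resolventMul, abs_inv, gapBound, one_div]
  exact inv_anti₀ hc.min_pos (le_abs_sub_modeEig k c i)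

theorem InGap.resolventMul_le (hc : InGap k c) (i : NonzeroIndex) :
    resolventMul c i ≤ 1 / (c - eig k) := by
  have h0 : 0 < c - eig k := sub_pos.2 hc.1
  rw [resolventMul, one_div]
  rcases modeEig_gap k i with h | h
  · exact inv_anti₀ h0 (sub_le_sub_left h c)
  · exact (inv_nonpos.2 (by linarith [hc.2])).trans (inv_nonneg.2 h0.le)

theorem finite_freq_le (N : ℝ) :
    {i : NonzeroIndex | (freqS i.1 : ℝ) + freqT i.1 ≤ N}.Finite := by
  have h : {i : ModeIndex | (freqS i : ℝ) + freqT i ≤ N}.Finite := by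
    obtain ⟨n, hn⟩ := exists_nat_ge N
    refine (((Set.finite_Iic n).prod (Set.finite_Iic n)).prod
      (Set.finite_univ (α := Bool))).subset ?_
    rintro ⟨⟨j, l⟩, b⟩ hi
    have h1 : ((j + 1 : ℕ) : ℝ) + (l : ℝ) ≤ n := le_trans hi hn
    have h2 : j + 1 + l ≤ n := by exact_mod_cast h1
    simp only [Set.mem_prod, Set.mem_Iic, Set.mem_univ, and_true]
    omega
  exact h.preimage Subtype.val_injective.injOn

/-- Kernel modes all have multiplier `1/c`. The eigenvalues of the other modes grow with the
frequencies, so outside finitely many modes their multipliers are small. This replaces compactness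
of the resolvent. -/
theorem exists_finset_resolventMul_le {c ρ : ℝ} (hρ : 0 < ρ) (hρc : 1 / c ≤ ρ) :
    ∃ J : Finset NonzeroIndex, ∀ i, i ∉ J → resolventMul c i ≤ ρ := by
  refine ⟨(finite_freq_le (|c| + 1 / ρ)).toFinset, fun i hi => ?_⟩
  rw [Set.Finite.mem_toFinset, Set.mem_ofPred_eq, not_le] at hi
  by_cases h : freqS i.1 = freqT i.1
  · rw [resolventMul, modeEig, h, sub_self, sub_zero, ← one_div]
    exact hρc
  · have h1 := add_freq_le_abs_modeEig h
    have h2 : |modeEig i| - |c| ≤ |c - modeEig i| := by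
      rw [abs_sub_comm]; exact abs_sub_abs_le_abs_sub _ _
    have h3 : 1 / ρ ≤ |c - modeEig i| := by linarith
    refine (le_abs_self _).trans ?_
    rw [resolventMul, abs_inv]
    refine (inv_anti₀ (by positivity) h3).trans (le_of_eq ?_)
    rw [one_div, inv_inv]

/-- The resolvent identity, which makes the quadratic form depend continuously on the shift,
uniformly on the unit ball. -/
theorem InGap.abs_resolventMul_sub_le {c' : ℝ} (hc : InGap k c) (hc' : InGap k c')
    (i : NonzeroIndex) :
    |resolventMul c' i - resolventMul c i| ≤ |c' - c| * (gapBound k c' * gapBound k c) := by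
  have h1 : resolventMul c' i - resolventMul c i =
      -(c' - c) * (resolventMul c' i * resolventMul c i) := by
    have h2 := sub_ne_zero.2 (hc.ne_modeEig i)
    have h3 := sub_ne_zero.2 (hc'.ne_modeEig i)
    rw [resolventMul, resolventMul]
    field_simp
    ring
  rw [h1, abs_mul, abs_neg, abs_mul]
  exact mul_le_mul_of_nonneg_left (mul_le_mul (hc'.abs_resolventMul_le i)
    (hc.abs_resolventMul_le i) (abs_nonneg _) hc'.gapBound_nonneg) (abs_nonneg _)

/-! ## The quadratic form deciding the position with respect to the curve -/

/-- The form `⟨(c - □)⁻¹ v, v⟩ - ‖v⁺‖²/(c - a) - ‖v⁻‖²/(c - b)`. -/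
noncomputable def fucikForm (c a b : ℝ) (v : L2Strip) : ℝ :=
  inner ℝ (diagOp unitMode (resolventMul c) v) v
    - 2 * jumpEnergy (1 / (c - a)) (1 / (c - b)) v

/-- The form `fucikForm` is negative definite. -/
def FucikNeg (c a b : ℝ) : Prop := ∃ δ : ℝ, 0 < δ ∧ ∀ v, fucikForm c a b v ≤ -δ * ‖v‖ ^ 2

/-- The admissible triples `(c, a, b)`. -/
def fucikDomain (k : ℤ) : Set (ℝ × ℝ × ℝ) :=
  {q | InGap k q.1 ∧ q.2.1 < q.1 ∧ q.2.2 < q.1}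

theorem isOpen_fucikDomain (k : ℤ) : IsOpen (fucikDomain k) := by
  have h1 : IsOpen {q : ℝ × ℝ × ℝ | eig k < q.1} := isOpen_lt continuous_const continuous_fst
  have h2 : IsOpen {q : ℝ × ℝ × ℝ | q.1 < eig (k + 1)} :=
    isOpen_lt continuous_fst continuous_const
  have h3 : IsOpen {q : ℝ × ℝ × ℝ | q.2.1 < q.1} := isOpen_lt (by fun_prop) (by fun_prop)
  have h4 : IsOpen {q : ℝ × ℝ × ℝ | q.2.2 < q.1} := isOpen_lt (by fun_prop) (by fun_prop)
  exact (h1.inter h2).inter (h3.inter h4)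

theorem eventually_abs_fucikForm_sub_le {q : ℝ × ℝ × ℝ} (hq : q ∈ fucikDomain k) {ε : ℝ}
    (hε : 0 < ε) : ∀ᶠ q' in 𝓝 q, ∀ v,
      |fucikForm q'.1 q'.2.1 q'.2.2 v - fucikForm q.1 q.2.1 q.2.2 v| ≤ ε * ‖v‖ ^ 2 := by
  obtain ⟨hc, ha, hb⟩ := hq
  have hmin := hc.min_pos
  have t1 : Tendsto (fun q' : ℝ × ℝ × ℝ => |q'.1 - q.1| * (gapBound k q'.1 * gapBound k q.1))
      (𝓝 q) (𝓝 0) := by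
    have h : ContinuousAt
        (fun q' : ℝ × ℝ × ℝ => |q'.1 - q.1| * (gapBound k q'.1 * gapBound k q.1)) q := by
      unfold gapBound
      refine ContinuousAt.mul (by fun_prop) (ContinuousAt.mul ?_ continuousAt_const)
      exact ContinuousAt.div continuousAt_const (by fun_prop) hmin.ne'
    have h' := h.tendsto
    simpa using h'
  have t2 : Tendsto (fun q' : ℝ × ℝ × ℝ => |1 / (q'.1 - q'.2.1) - 1 / (q.1 - q.2.1)|)
      (𝓝 q) (𝓝 0) := by
    have h0 : ContinuousAt (fun q' : ℝ × ℝ × ℝ => 1 / (q'.1 - q'.2.1)) q :=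
      ContinuousAt.div continuousAt_const (by fun_prop) (sub_pos.2 ha).ne'
    have h : ContinuousAt
        (fun q' : ℝ × ℝ × ℝ => |1 / (q'.1 - q'.2.1) - 1 / (q.1 - q.2.1)|) q :=
      (h0.sub continuousAt_const).abs
    have h' := h.tendsto
    simpa using h'
  have t3 : Tendsto (fun q' : ℝ × ℝ × ℝ => |1 / (q'.1 - q'.2.2) - 1 / (q.1 - q.2.2)|)
      (𝓝 q) (𝓝 0) := by
    have h0 : ContinuousAt (fun q' : ℝ × ℝ × ℝ => 1 / (q'.1 - q'.2.2)) q :=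
      ContinuousAt.div continuousAt_const (by fun_prop) (sub_pos.2 hb).ne'
    have h : ContinuousAt
        (fun q' : ℝ × ℝ × ℝ => |1 / (q'.1 - q'.2.2) - 1 / (q.1 - q.2.2)|) q :=
      (h0.sub continuousAt_const).abs
    have h' := h.tendsto
    simpa using h'
  have hε2 : 0 < ε / 2 := by positivity
  filter_upwards [(isOpen_fucikDomain k).mem_nhds ⟨hc, ha, hb⟩, t1.eventually (gt_mem_nhds hε2),
    t2.eventually (gt_mem_nhds hε2), t3.eventually (gt_mem_nhds hε2)] with q' hq' h1 h2 h3 v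
  have e1 := inner_diagOp_sub_le orthonormal_unitMode hq'.1.abs_resolventMul_le
    hc.abs_resolventMul_le (ε := ε / 2) hε2.le
    (fun i => (hc.abs_resolventMul_sub_le hq'.1 i).trans h1.le) v
  have e2 := abs_jumpEnergy_sub_le h2.le h3.le v
  rw [_root_.abs_le] at e1 e2 ⊢
  simp only [fucikForm]
  constructor <;> linarith

theorem isOpen_fucikNeg (k : ℤ) :
    IsOpen {q ∈ fucikDomain k | FucikNeg q.1 q.2.1 q.2.2} := by
  rw [isOpen_iff_mem_nhds]
  rintro q ⟨hq, δ, hδ, h⟩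
  filter_upwards [(isOpen_fucikDomain k).mem_nhds hq,
    eventually_abs_fucikForm_sub_le hq (half_pos hδ)] with q' hq' h'
  refine ⟨hq', δ / 2, by positivity, fun v => ?_⟩
  have h1 := h v
  have h2 := (_root_.abs_le.1 (h' v)).2
  linarith

theorem isOpen_fucikPos (k : ℤ) :
    IsOpen {q ∈ fucikDomain k | ∃ v, 0 < fucikForm q.1 q.2.1 q.2.2 v} := by
  rw [isOpen_iff_mem_nhds]
  rintro q ⟨hq, v, hv⟩
  set ε := fucikForm q.1 q.2.1 q.2.2 v / (2 * (‖v‖ ^ 2 + 1)) with hε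
  have hε0 : 0 < ε := by positivity
  filter_upwards [(isOpen_fucikDomain k).mem_nhds hq,
    eventually_abs_fucikForm_sub_le hq hε0] with q' hq' h'
  refine ⟨hq', v, ?_⟩
  have h2 := (_root_.abs_le.1 (h' v)).1
  have h3 : ε * (‖v‖ ^ 2 + 1) = fucikForm q.1 q.2.1 q.2.2 v / 2 := by
    rw [hε]; field_simp
  linarith

theorem disjoint_fucikNeg_fucikPos (k : ℤ) :
    Disjoint {q ∈ fucikDomain k | FucikNeg q.1 q.2.1 q.2.2}
      {q ∈ fucikDomain k | ∃ v, 0 < fucikForm q.1 q.2.1 q.2.2 v} := by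
  rw [Set.disjoint_left]
  rintro q ⟨-, δ, hδ, h⟩ ⟨-, v, hv⟩
  have h1 := h v
  have h2 : 0 ≤ δ * ‖v‖ ^ 2 := by positivity
  linarith

/-- All multipliers are at most `1/(c - λ_k)`, which is smaller than both `1/(c - a)` and `1/(c -
b)`. -/
theorem fucikNeg_of_eig_lt {a b : ℝ} (hc : InGap k c) (ha : a ∈ Set.Ioo (eig k) c)
    (hb : b ∈ Set.Ioo (eig k) c) : FucikNeg c a b := by
  have h0 : 0 < c - eig k := sub_pos.2 hc.1
  set m := min (1 / (c - a)) (1 / (c - b)) with hm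
  have hm' : 1 / (c - eig k) < m :=
    lt_min (one_div_lt_one_div_of_lt (sub_pos.2 ha.2) (by linarith [ha.1]))
      (one_div_lt_one_div_of_lt (sub_pos.2 hb.2) (by linarith [hb.1]))
  refine ⟨m - 1 / (c - eig k), sub_pos.2 hm', fun v => ?_⟩
  have h1 := inner_diagOp_le orthonormal_unitMode hc.abs_resolventMul_le
    (one_div_nonneg.2 h0.le) ∅ (fun i _ => hc.resolventMul_le i) v
  rw [Finset.sum_empty, mul_zero, add_zero] at h1
  have h2 := jumpEnergy_lower (min_le_left (1 / (c - a)) (1 / (c - b))) (min_le_right _ _) v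
  rw [← hm] at h2
  rw [fucikForm]
  linarith

/-! ### Degenerate forms and the change of shift. -/

theorem fucikForm_smul (hc : InGap k c) (a b : ℝ) {t : ℝ} (ht : 0 ≤ t) (v : L2Strip) :
    fucikForm c a b (t • v) = t ^ 2 * fucikForm c a b v := by
  have h1 : inner ℝ (diagOp unitMode (resolventMul c) (t • v)) (t • v) =
      t ^ 2 * inner ℝ (diagOp unitMode (resolventMul c) v) v := by
    have hs := hasSum_inner_diagOp orthonormal_unitMode hc.abs_resolventMul_le
    refine (hs (t • v) (t • v)).unique (hasSum_of_eq ((hs v v).mul_left (t ^ 2)) fun i => ?_)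
    rw [inner_smul_right]
    ring
  have h2 : ∀ α β : ℝ, jumpEnergy α β (t • v) = t ^ 2 * jumpEnergy α β v := by
    intro α β
    rw [jumpEnergy, jumpEnergy, ← integral_const_mul]
    refine integral_congr_ae ?_
    filter_upwards [Lp.coeFn_smul t v] with z hz
    have hmax : ∀ r : ℝ, max (t * r) 0 = t * max r 0 := fun r => by
      rw [mul_max_of_nonneg _ _ ht, mul_zero]
    rw [hz, Pi.smul_apply, smul_eq_mul, primitive_jump, primitive_jump, ← mul_neg, hmax, hmax]
    ring
  rw [fucikForm, fucikForm, h1, h2]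
  ring

theorem continuous_fucikForm (hc : InGap k c) (a b : ℝ) : Continuous (fucikForm c a b) := by
  have h1 : QuadBounds (fun v => inner ℝ (diagOp unitMode (resolventMul c) v) v)
      (fun v => (2 : ℝ) • diagOp unitMode (resolventMul c) v)
      (-(2 * gapBound k c)) (2 * gapBound k c) := by
    intro x d
    have h := _root_.abs_le.1 (abs_inner_diagOp_le orthonormal_unitMode hc.abs_resolventMul_le
      hc.gapBound_nonneg d)
    simp only
    rw [inner_diagOp_add orthonormal_unitMode hc.abs_resolventMul_le, real_inner_smul_left]
    constructor <;> linarith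
  exact h1.continuous.sub ((quadBounds_jump _ _).continuous.const_mul 2)

/-- In the degenerate case the form has a nontrivial zero, which solves the resonant problem. -/
theorem exists_jumpOp_eq_diagOp {a b : ℝ} (hc : InGap k c)
    (hess : max 0 (1 / c) < min (1 / (c - a)) (1 / (c - b)))
    (hneg : ¬ FucikNeg c a b) (hpos : ∀ v, fucikForm c a b v ≤ 0) :
    ∃ v, v ≠ 0 ∧ jumpOp (1 / (c - a)) (1 / (c - b)) v = diagOp unitMode (resolventMul c) v := by
  set α := 1 / (c - a)
  set β := 1 / (c - b)
  obtain ⟨ρ, hρ1, hρ2⟩ := exists_between hess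
  have hρ0 : 0 < ρ := (le_max_left _ _).trans_lt hρ1
  obtain ⟨J, hJ⟩ := exists_finset_resolventMul_le hρ0 ((le_max_right 0 (1 / c)).trans hρ1.le)
  have hlow := (quadBounds_jump α β).sub_diagOp_lower orthonormal_unitMode
    hc.abs_resolventMul_le hc.gapBound_nonneg hρ0.le hJ
  have hup := (quadBounds_jump α β).sub_diagOp_upper orthonormal_unitMode
    hc.abs_resolventMul_le hc.gapBound_nonneg
  have hD : ∀ v, jumpEnergy α β v - inner ℝ (diagOp unitMode (resolventMul c) v) v / 2 =
      -fucikForm c a b v / 2 := fun v => by rw [fucikForm]; ring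
  simp only [hD] at hlow hup
  -- Definiteness with constant `1/(n+1)` fails for every `n`; after rescaling, this gives unit
  -- vectors along which the nonpositive form tends to its supremum `0`.
  have hseq : ∀ n : ℕ, ∃ w : L2Strip, ‖w‖ = 1 ∧ -(1 / ((n : ℝ) + 1)) ≤ fucikForm c a b w := by
    intro n
    have hn : (0 : ℝ) < 1 / ((n : ℝ) + 1) := by positivity
    have h1 : ∃ v, -(1 / ((n : ℝ) + 1)) * ‖v‖ ^ 2 < fucikForm c a b v := by
      by_contra! h
      exact hneg ⟨_, hn, h⟩
    obtain ⟨v, hv⟩ := h1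
    have hv0 : ‖v‖ ≠ 0 := by
      intro h
      rw [h] at hv
      have := hpos v
      norm_num at hv
      linarith
    refine ⟨‖v‖⁻¹ • v, ?_, ?_⟩
    · rw [norm_smul, norm_inv, norm_norm, inv_mul_cancel₀ hv0]
    · rw [fucikForm_smul hc _ _ (by positivity), inv_pow, ← div_eq_inv_mul,
        le_div_iff₀ (by positivity)]
      exact hv.le
  choose w hw1 hw2 using hseq
  have hlim : Tendsto (fun n => -fucikForm c a b (w n) / 2) atTop (𝓝 0) := by
    have h1 : Tendsto (fun n : ℕ => 1 / ((n : ℝ) + 1)) atTop (𝓝 0) :=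
      tendsto_one_div_add_atTop_nhds_zero_nat
    refine squeeze_zero (fun n => ?_) (fun n => ?_) h1
    · have := hpos (w n); linarith
    · have h2 := hw2 n
      have h3 : (0 : ℝ) < 1 / ((n : ℝ) + 1) := by positivity
      linarith
  obtain ⟨v, θ, hθ, hv⟩ := exists_tendsto_of_minimizing (coordMap unitMode J)
    (D := fun v => -fucikForm c a b v / 2) (m := 0) (half_pos (sub_pos.2 hρ2)) hlow
    (fun v => by have := hpos v; linarith) (R := 1) (fun n => (hw1 n).le) hlim
  -- Convergence is strong, so the limit stays on the unit sphere: it is a nonzero minimizer of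
  -- `-fucikForm/2`.
  have hv1 : ‖v‖ = 1 := tendsto_nhds_unique hv.norm (by simp only [hw1]; exact tendsto_const_nhds)
  have hcont : Continuous fun v => -fucikForm c a b v / 2 :=
    (continuous_fucikForm hc a b).neg.div_const 2
  have hDv : -fucikForm c a b v / 2 = 0 :=
    tendsto_nhds_unique ((hcont.tendsto v).comp hv) (hlim.comp hθ.tendsto_atTop)
  refine ⟨v, fun h => by simp [h] at hv1, ?_⟩
  refine sub_eq_zero.1 (eq_zero_of_forall_le_add (D := fun v => -fucikForm c a b v / 2)
    (fun y => ?_) (hup v))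
  have := hpos y
  linarith

theorem jumpOp_zero (α β : ℝ) : jumpOp α β 0 = 0 := by
  refine Lp.ext ?_
  filter_upwards [coeFn_jumpOp α β 0, Lp.coeFn_zero ℝ 2 stripMeasure] with z h1 h2
  rw [h1, h2]
  simp [jump]

/-- Negative definiteness is inherited by larger shifts in the gap. -/
theorem FucikNeg.mono {a b c' : ℝ} (hc : InGap k c) (ha : a < c) (hb : b < c) (hcc : c ≤ c')
    (hc' : InGap k c')
    (hess : ∀ x ∈ Set.Icc c c', max 0 (1 / x) < min (1 / (x - a)) (1 / (x - b)))
    (h : FucikNeg c a b) : FucikNeg c' a b := by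
  have hcont : Continuous fun x : ℝ => (x, a, b) := by fun_prop
  have hU := (isOpen_fucikNeg k).preimage hcont
  have hV := (isOpen_fucikPos k).preimage hcont
  have hdom : ∀ x ∈ Set.Icc c c', (x, a, b) ∈ fucikDomain k := fun x hx =>
    ⟨⟨hc.1.trans_le hx.1, hx.2.trans_lt hc'.2⟩, ha.trans_le hx.1, hb.trans_le hx.1⟩
  have hcU : c ∈ (fun x : ℝ => (x, a, b)) ⁻¹' {q ∈ fucikDomain k | FucikNeg q.1 q.2.1 q.2.2} :=
    ⟨hdom c ⟨le_rfl, hcc⟩, h⟩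
  -- The segment of shifts is connected and starts in the open set of definiteness, so it suffices
  -- that no shift on it is degenerate.
  suffices hcover : Set.Icc c c' ⊆
      (fun x : ℝ => (x, a, b)) ⁻¹' {q ∈ fucikDomain k | FucikNeg q.1 q.2.1 q.2.2} ∪
      (fun x : ℝ => (x, a, b)) ⁻¹'
        {q ∈ fucikDomain k | ∃ v, 0 < fucikForm q.1 q.2.1 q.2.2 v} by
    have hsub := isPreconnected_Icc.subset_left_of_subset_union hU hV
      ((disjoint_fucikNeg_fucikPos k).preimage _) hcover ⟨c, ⟨le_rfl, hcc⟩, hcU⟩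
    exact (hsub ⟨hcc, le_rfl⟩).2
  intro x hx
  by_contra hx'
  rw [Set.mem_union, not_or] at hx'
  have hxd := hdom x hx
  obtain ⟨hxg, hxa, hxb⟩ := hxd
  simp only at hxg hxa hxb
  have hxn : ¬ FucikNeg x a b := fun h => hx'.1 ⟨hdom x hx, h⟩
  have hxp : ∀ v, fucikForm x a b v ≤ 0 := fun v => by
    by_contra! hv
    exact hx'.2 ⟨hdom x hx, v, hv⟩
  obtain ⟨v, hv0, hv⟩ := exists_jumpOp_eq_diagOp hxg (hess x hx) hxn hxp
  -- At a degenerate shift `x`, `u = (x - □)⁻¹v` and `v = (x-a)u⁺ - (x-b)u⁻`, i.e. `□u = au⁺ - bu⁻`,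
  -- an equation free of `x`.
  set u := diagOp unitMode (resolventMul x) v with hu
  have pxa : 0 < x - a := sub_pos.2 hxa
  have pxb : 0 < x - b := sub_pos.2 hxb
  have pca : 0 < c - a := sub_pos.2 ha
  have pcb : 0 < c - b := sub_pos.2 hb
  have hvu : jumpOp (x - a) (x - b) u = v := by
    rw [← hv, jumpOp_jumpOp (by positivity) (by positivity), mul_one_div_cancel pxa.ne',
      mul_one_div_cancel pxb.ne', jumpOp_one]
  -- The same `u` read at the shift `c`: `y` represents `(c - □)u` and equals `(c-a)u⁺ - (c-b)u⁻`,
  -- so it is a null vector of the form at `c`.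
  set y := v + (c - x) • u with hy
  have hyu : y = jumpOp (c - a) (c - b) u := by
    rw [hy]
    conv_lhs => rw [← hvu]
    rw [jumpOp_add_smul]
    congr 1 <;> ring
  have huy : jumpOp (1 / (c - a)) (1 / (c - b)) y = u := by
    rw [hyu, jumpOp_jumpOp pca pcb, one_div_mul_cancel pca.ne', one_div_mul_cancel pcb.ne',
      jumpOp_one]
  have hMy : diagOp unitMode (resolventMul c) y = u := by
    refine (hasSum_diagOp orthonormal_unitMode hc.abs_resolventMul_le y).unique
      (hasSum_of_eq (hasSum_diagOp orthonormal_unitMode hxg.abs_resolventMul_le v) fun i => ?_)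
    congr 1
    rw [hy, inner_add_right, inner_smul_right, hu,
      inner_diagOp orthonormal_unitMode hxg.abs_resolventMul_le, resolventMul, resolventMul]
    have h2 := sub_ne_zero.2 (hc.ne_modeEig i)
    have h3 := sub_ne_zero.2 (hxg.ne_modeEig i)
    field_simp
    ring
  have hQ : fucikForm c a b y = 0 := by
    have := inner_jumpOp_self (1 / (c - a)) (1 / (c - b)) y
    rw [fucikForm, hMy, ← this, huy, sub_self]
  obtain ⟨δ, hδ, hneg⟩ := h
  have h1 := hneg y
  rw [hQ] at h1
  have h2 : ‖y‖ ^ 2 = 0 := by nlinarith [sq_nonneg ‖y‖]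
  have hy0 : y = 0 := norm_eq_zero.1 (pow_eq_zero_iff two_ne_zero |>.1 h2)
  rw [hy0, jumpOp_zero] at huy
  rw [← huy, jumpOp_zero] at hvu
  exact hv0 hvu.symm

end Gap

/-! ## Points above the curve -/

theorem Admissible.inGap {k : ℤ} {ε₃ ε₄ : ℝ} (h : Admissible k ε₃ ε₄) :
    InGap k (eig (k + 1) - ε₃) :=
  ⟨by linarith [h.1.2], by linarith [h.1.1]⟩

theorem Admissible.rho_pos {k : ℤ} {ε₃ ε₄ : ℝ} (h : Admissible k ε₃ ε₄) : 0 < rho k ε₃ ε₄ :=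
  add_pos_of_nonneg_of_pos (le_max_left _ _) h.2.1

/-- Points of the square where the form is semidefinite but not definite are on the curve. -/
theorem mem_curveD {k : ℤ} {ε₃ ε₄ a b : ℝ} (hadm : Admissible k ε₃ ε₄)
    (hab : (a, b) ∈ squareR k ε₃ ε₄) (hneg : ¬ FucikNeg (eig (k + 1) - ε₃) a b)
    (hpos : ∀ v, fucikForm (eig (k + 1) - ε₃) a b v ≤ 0) : (a, b) ∈ curveD k ε₃ ε₄ := by
  have hc := hadm.inGap
  have hρ := hadm.rho_pos
  set c := eig (k + 1) - ε₃ with hcdef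
  set ρ := rho k ε₃ ε₄ with hρdef
  obtain ⟨⟨ha1, ha2⟩, hb1, hb2⟩ := hab
  simp only at ha1 ha2 hb1 hb2
  rw [← hcdef] at ha1 ha2 hb1 hb2
  rw [← hρdef] at ha1 hb1
  have hpa : 0 < c - a := by linarith
  have hpb : 0 < c - b := by linarith
  have hlt : ∀ {x : ℝ}, 0 < x → x < 1 / ρ → ρ < 1 / x := fun {x} h1 h2 => by
    rw [lt_div_iff₀ h1]
    rw [lt_div_iff₀ hρ] at h2
    linarith
  set α := 1 / (c - a) - ρ with hα
  set β := 1 / (c - b) - ρ with hβ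
  have hα0 : 0 < α := sub_pos.2 (hlt hpa (by linarith))
  have hβ0 : 0 < β := sub_pos.2 (hlt hpb (by linarith))
  -- This `r` makes `(a, b)` the point of the curve with parameter `r` as soon as `ã(r) = α`. Both
  -- `α` and `β` are positive because `(a, b)` lies in the square.
  set r := β / α with hr
  have hr0 : 0 < r := by positivity
  have hrα : r * α = β := by rw [hr]; field_simp
  set num : L2Strip → ℝ := fun v => inner ℝ (resolventOp c v - ρ • v) v with hnum
  set den : L2Strip → ℝ := fun v => ‖Lp.posPart v‖ ^ 2 + r * ‖Lp.negPart v‖ ^ 2 with hden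
  have hform : ∀ v, fucikForm c a b v = num v - α * den v := by
    intro v
    simp only [hnum, hden, fucikForm, resolventOp_eq_diagOp hc.abs_resolventMul_le, jumpEnergy_eq]
    rw [inner_sub_left, real_inner_smul_left, real_inner_self_eq_norm_sq,
      ← norm_sq_posPart_add_negPart v]
    have e1 : 1 / (c - a) = α + ρ := by rw [hα]; ring
    have e2 : 1 / (c - b) = β + ρ := by rw [hβ]; ring
    rw [e1, e2]
    linear_combination (-‖Lp.negPart v‖ ^ 2) * hrα.symm
  have hdenl : ∀ v, min 1 r * ‖v‖ ^ 2 ≤ den v := by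
    intro v
    simp only [hden]
    rw [← norm_sq_posPart_add_negPart v, mul_add]
    have h1 := mul_le_mul_of_nonneg_right (min_le_left 1 r) (sq_nonneg ‖Lp.posPart v‖)
    have h2 := mul_le_mul_of_nonneg_right (min_le_right 1 r) (sq_nonneg ‖Lp.negPart v‖)
    linarith
  have hmin : 0 < min 1 r := lt_min one_pos hr0
  have hdenp : ∀ v, v ≠ 0 → 0 < den v := fun v hv =>
    lt_of_lt_of_le (mul_pos hmin (pow_pos (norm_pos_iff.2 hv) 2)) (hdenl v)
  have hratio : ∀ v : {v : L2Strip // v ≠ 0}, num v.1 / den v.1 ≤ α := fun v => by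
    rw [div_le_iff₀ (hdenp v.1 v.2)]
    have := hpos v.1
    rw [hform] at this
    linarith
  have haT : aTilde k ε₃ ε₄ r = ⨆ v : {v : L2Strip // v ≠ 0}, num v.1 / den v.1 := rfl
  -- Bounding the supremum by `α` requires a nonempty index set; on a trivial space the form would
  -- be vacuously definite.
  have hne : Nonempty {v : L2Strip // v ≠ 0} := by
    by_contra h
    refine hneg ⟨1, one_pos, fun v => ?_⟩
    have hv : v = 0 := by
      by_contra hv
      exact h ⟨⟨v, hv⟩⟩
    have := hpos v
    rw [hv] at this ⊢
    simpa using this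
  have hle : aTilde k ε₃ ε₄ r ≤ α := by rw [haT]; exact ciSup_le hratio
  have heq : aTilde k ε₃ ε₄ r = α := by
    -- A supremum strictly below `α` would give definiteness, since the denominator dominates `min
    -- {1, r}‖v‖²`.
    refine le_antisymm hle (le_of_not_gt fun hlt' => hneg ?_)
    refine ⟨(α - aTilde k ε₃ ε₄ r) * min 1 r, mul_pos (sub_pos.2 hlt') hmin, fun v => ?_⟩
    by_cases hv : v = 0
    · have := hpos v
      rw [hv] at this ⊢
      simpa using this
    · have h1 : num v / den v ≤ aTilde k ε₃ ε₄ r := by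
        rw [haT]
        exact le_ciSup (f := fun v : {v : L2Strip // v ≠ 0} => num v.1 / den v.1)
          ⟨α, by rintro _ ⟨v, rfl⟩; exact hratio v⟩ ⟨v, hv⟩
      rw [div_le_iff₀ (hdenp v hv)] at h1
      have h2 := mul_le_mul_of_nonneg_left (hdenl v) (sub_pos.2 hlt').le
      rw [hform]
      linarith
  refine ⟨r, hr0, ?_⟩
  rw [heq, hrα, ← hcdef, ← hρdef]
  have e1 : α + ρ = 1 / (c - a) := by rw [hα]; ring
  have e2 : β + ρ = 1 / (c - b) := by rw [hβ]; ring
  rw [e1, e2, one_div_one_div, one_div_one_div, sub_sub_cancel, sub_sub_cancel]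

/-- Off the curve, the square is covered by the disjoint open sets where the form is definite and
where it is somewhere positive. The component in question meets the first one in `]λ_k, c[²`, hence
lies in it. -/
theorem fucikNeg_of_mem_aboveInSquare {k : ℤ} {ε₃ ε₄ : ℝ} {z : ℝ × ℝ}
    (hadm : Admissible k ε₃ ε₄) (hz : z ∈ aboveInSquare k ε₃ ε₄) :
    z ∈ squareR k ε₃ ε₄ ∧ FucikNeg (eig (k + 1) - ε₃) z.1 z.2 := by
  have hc := hadm.inGap
  obtain ⟨z₀, hz₀, hz⟩ := hz
  have hsub := connectedComponentIn_subset (squareR k ε₃ ε₄ \ curveD k ε₃ ε₄) z₀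
  have hz₀F : z₀ ∈ squareR k ε₃ ε₄ \ curveD k ε₃ ε₄ :=
    connectedComponentIn_nonempty_iff.1 ⟨z, hz⟩
  have hcont : Continuous fun z : ℝ × ℝ => (eig (k + 1) - ε₃, z) := by fun_prop
  have hdom : ∀ y ∈ squareR k ε₃ ε₄, (eig (k + 1) - ε₃, y) ∈ fucikDomain k := fun y hy =>
    ⟨hc, hy.1.2, hy.2.2⟩
  set U := {q ∈ fucikDomain k | FucikNeg q.1 q.2.1 q.2.2} with hU
  set V := {q ∈ fucikDomain k | ∃ v, 0 < fucikForm q.1 q.2.1 q.2.2 v} with hV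
  have hcover : connectedComponentIn (squareR k ε₃ ε₄ \ curveD k ε₃ ε₄) z₀ ⊆
      (fun z : ℝ × ℝ => (eig (k + 1) - ε₃, z)) ⁻¹' U ∪
      (fun z : ℝ × ℝ => (eig (k + 1) - ε₃, z)) ⁻¹' V := by
    intro y hy
    obtain ⟨hyR, hyD⟩ := hsub hy
    by_contra h
    rw [Set.mem_union, not_or] at h
    refine hyD (mem_curveD hadm hyR (fun hn => h.1 ⟨hdom y hyR, hn⟩) fun v => ?_)
    by_contra! hv
    exact h.2 ⟨hdom y hyR, v, hv⟩
  have hz₀U : z₀ ∈ (fun z : ℝ × ℝ => (eig (k + 1) - ε₃, z)) ⁻¹' U :=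
    ⟨hdom z₀ hz₀F.1, fucikNeg_of_eig_lt hc hz₀.1 hz₀.2⟩
  have key := isPreconnected_connectedComponentIn.subset_left_of_subset_union
    ((isOpen_fucikNeg k).preimage hcont) ((isOpen_fucikPos k).preimage hcont)
    ((disjoint_fucikNeg_fucikPos k).preimage _) hcover
    ⟨z₀, mem_connectedComponentIn hz₀F, hz₀U⟩
  exact ⟨(hsub hz).1, (key hz).2⟩

/-- For points of `R̃_k`, the multipliers of the nonlinearity exceed the essential spectrum. -/
theorem max_lt_min_of_mem_squareRTilde {k : ℤ} {a b c : ℝ} (hab : (a, b) ∈ squareRTilde k)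
    (hc : InGap k c) (ha : a < c) (hb : b < c) :
    max 0 (1 / c) < min (1 / (c - a)) (1 / (c - b)) := by
  have hpa : 0 < c - a := sub_pos.2 ha
  have hpb : 0 < c - b := sub_pos.2 hb
  refine max_lt (lt_min (by positivity) (by positivity)) ?_
  rcases hab with ⟨hk, -, -⟩ | ⟨hk, ha', hb'⟩
  · have h1 : c < 0 := hc.2.trans_le (eig_succ_nonpos hk)
    have h2 : 1 / c < 0 := one_div_neg.2 h1
    exact lt_min (h2.trans (by positivity)) (h2.trans (by positivity))
  · exact lt_min (one_div_lt_one_div_of_lt hpa (by linarith [ha'.1]))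
      (one_div_lt_one_div_of_lt hpb (by linarith [hb'.1]))

/-! ## The energy functional -/

theorem primitive_add {f g : Strip → ℝ → ℝ} (hf : Continuous (Function.uncurry f))
    (hg : Continuous (Function.uncurry g)) (z : Strip) (x : ℝ) :
    primitive (fun z x => f z x + g z x) z x = primitive f z x + primitive g z x :=
  intervalIntegral.integral_add ((continuous_slice hf z).intervalIntegrable _ _)
    ((continuous_slice hg z).intervalIntegrable _ _)

theorem continuous_nonlinearity (a b : ℝ) {p : Strip → ℝ → ℝ}
    (hp : Continuous (Function.uncurry p)) :
    Continuous (Function.uncurry (nonlinearity a b p)) :=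
  (continuous_jump a b).add hp

theorem primitive_nonlinearity (a b : ℝ) {p : Strip → ℝ → ℝ}
    (hp : Continuous (Function.uncurry p)) (z : Strip) (x : ℝ) :
    primitive (nonlinearity a b p) z x = primitive (jump a b) z x + primitive p z x :=
  primitive_add (continuous_jump a b) hp z x

/-- The jump terms are merged with the integral of `P`, because the available slope bounds concern
the full right-hand side rather than `p`. -/
theorem energy_eq {a b σ L : ℝ} {p : Strip → ℝ → ℝ} (hp : Continuous (Function.uncurry p))
    (hs : SlopeBounds (nonlinearity a b p) σ L) (w : sobolevSpace × kernelSpace) :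
    energy a b p w = 1 / 2 * (‖(w.1 : L2Strip × L2Strip × L2Strip).2.1‖ ^ 2
      - ‖(w.1 : L2Strip × L2Strip × L2Strip).2.2‖ ^ 2)
      - ∫ z, primitive (nonlinearity a b p) z (toFunction w z) ∂stripMeasure := by
  have i1 := integrable_primitive (continuous_nonlinearity a b hp) hs (toFunction w)
  have i2 := integrable_primitive (continuous_jump a b) (slopeBounds_jump a b) (toFunction w)
  have h1 : ∫ z, primitive p z (toFunction w z) ∂stripMeasure =
      ∫ z, primitive (nonlinearity a b p) z (toFunction w z) ∂stripMeasure
        - jumpEnergy a b (toFunction w) := by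
    rw [jumpEnergy, ← integral_sub i1 i2]
    refine integral_congr_ae (ae_of_all _ fun z => ?_)
    simp only [primitive_nonlinearity a b hp]
    ring
  rw [jumpEnergy_eq] at h1
  have h2 : energy a b p w = 1 / 2 * (‖(w.1 : L2Strip × L2Strip × L2Strip).2.1‖ ^ 2
      - ‖(w.1 : L2Strip × L2Strip × L2Strip).2.2‖ ^ 2
      - a * ‖Lp.posPart (toFunction w)‖ ^ 2 - b * ‖Lp.negPart (toFunction w)‖ ^ 2)
      - ∫ z, primitive p z (toFunction w z) ∂stripMeasure := rfl
  rw [h2, h1]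
  ring

/-- The maps to `x_s`, `x_t` and `x + y` are continuous and linear, so the chain rule applies; the
hypothesis says that the resulting derivative vanishes in every direction. -/
theorem isWeakSolution_of_inner_eq {a b σ L : ℝ} {p : Strip → ℝ → ℝ}
    (hp : Continuous (Function.uncurry p)) (hs : SlopeBounds (nonlinearity a b p) σ L)
    {w : sobolevSpace × kernelSpace}
    (hw : ∀ d : sobolevSpace × kernelSpace,
        inner ℝ (w.1 : L2Strip × L2Strip × L2Strip).2.1 (d.1 : L2Strip × L2Strip × L2Strip).2.1
          - inner ℝ (w.1 : L2Strip × L2Strip × L2Strip).2.2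
              (d.1 : L2Strip × L2Strip × L2Strip).2.2 =
        inner ℝ (superpose _ (continuous_nonlinearity a b hp) hs (toFunction w))
          (toFunction d)) : IsWeakSolution a b p w := by
  let X : (sobolevSpace × kernelSpace) →L[ℝ] (L2Strip × L2Strip × L2Strip) :=
    sobolevSpace.subtypeL.comp (ContinuousLinearMap.fst ℝ sobolevSpace kernelSpace)
  let A : (sobolevSpace × kernelSpace) →L[ℝ] L2Strip :=
    ((ContinuousLinearMap.fst ℝ L2Strip L2Strip).comp
      (ContinuousLinearMap.snd ℝ L2Strip (L2Strip × L2Strip))).comp X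
  let B : (sobolevSpace × kernelSpace) →L[ℝ] L2Strip :=
    ((ContinuousLinearMap.snd ℝ L2Strip L2Strip).comp
      (ContinuousLinearMap.snd ℝ L2Strip (L2Strip × L2Strip))).comp X
  let T : (sobolevSpace × kernelSpace) →L[ℝ] L2Strip :=
    (ContinuousLinearMap.fst ℝ L2Strip (L2Strip × L2Strip)).comp X +
      kernelSpace.subtypeL.comp (ContinuousLinearMap.snd ℝ sobolevSpace kernelSpace)
  have hΦ := (quadBounds_superpose (continuous_nonlinearity a b hp) hs).hasFDerivAt (T w)
  have hA := (A.hasFDerivAt (x := w)).norm_sq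
  have hB := (B.hasFDerivAt (x := w)).norm_sq
  have hT := hΦ.comp w (T.hasFDerivAt (x := w))
  have h := ((hA.sub hB).const_mul (1 / 2)).sub hT
  unfold IsWeakSolution
  have he : energy a b p = fun w => 1 / 2 * (‖A w‖ ^ 2 - ‖B w‖ ^ 2)
      - ∫ z, primitive (nonlinearity a b p) z (T w z) ∂stripMeasure :=
    funext fun w => energy_eq hp hs w
  rw [he]
  refine HasFDerivAt.congr_fderiv h ?_
  refine ContinuousLinearMap.ext fun d => ?_
  have hd : inner ℝ (A w) (A d) - inner ℝ (B w) (B d) =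
      inner ℝ (superpose _ (continuous_nonlinearity a b hp) hs (T w)) (T d) := hw d
  have e : (1 / 2 : ℝ) * (2 * inner ℝ (A w) (A d) - 2 * inner ℝ (B w) (B d)) -
      inner ℝ (superpose _ (continuous_nonlinearity a b hp) hs (T w)) (T d) = 0 := by
    rw [← hd]; ring
  simpa using e

/-! ## Consequences of the hypotheses on `p` -/

theorem SlopeBounds.le {g : Strip → ℝ → ℝ} {σ L : ℝ} (h : SlopeBounds g σ L) : σ ≤ L := by
  have z : Strip := (⟨0, le_rfl, pi_pos.le⟩, 0)
  have h1 := (h z).1 zero_le_one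
  have h2 := (h z).2 zero_le_one
  simp only at h1 h2
  linarith

/-- Sublinearity and compactness give `|p| ≤ (η/2)|u| + C`; after integration, Young's inequality
absorbs `C|x|`. -/
theorem SublinearAtInfinity.abs_primitive_le {p : Strip → ℝ → ℝ} (h : SublinearAtInfinity p)
    (hp : Continuous (Function.uncurry p)) {η : ℝ} (hη : 0 < η) :
    ∃ C, ∀ z x, |primitive p z x| ≤ η * x ^ 2 + C := by
  have h1 := Metric.tendstoUniformly_iff.1 h (η / 2) (half_pos hη)
  rw [← Metric.cobounded_eq_cocompact, (hasBasis_cobounded_norm (E := ℝ)).eventually_iff] at h1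
  obtain ⟨R, -, hR⟩ := h1
  obtain ⟨C, hC0, hC⟩ := exists_bound_slice hp R
  have hb : ∀ z u, |p z u| ≤ η / 2 * |u| + C := by
    intro z u
    rcases le_total |u| R with hu | hu
    · have := hC z u hu
      have : 0 ≤ η / 2 * |u| := by positivity
      linarith
    · rcases eq_or_ne u 0 with rfl | hu0
      · rw [abs_zero, mul_zero, zero_add]
        by_cases hR0 : 0 ≤ R
        · exact hC z 0 (by simpa using hR0)
        -- The threshold `R` may be negative, in which case the ratio bound holds for all `u` but
        -- says nothing at `u = 0`, where `p/0 = 0`; the value there is recovered as a limit.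
        · obtain ⟨C', hC'0, hC'⟩ := exists_bound_slice hp 0
          have hlim : Tendsto (fun u : ℝ => η / 2 * |u|) (𝓝[≠] 0) (𝓝 0) := by
            have : Tendsto (fun u : ℝ => η / 2 * |u|) (𝓝 0) (𝓝 (η / 2 * |0|)) :=
              Continuous.tendsto (by fun_prop) 0
            rw [abs_zero, mul_zero] at this
            exact this.mono_left nhdsWithin_le_nhds
          have hpl : Tendsto (fun u : ℝ => |p z u|) (𝓝[≠] 0) (𝓝 |p z 0|) :=
            ((continuous_slice hp z).abs.tendsto 0).mono_left nhdsWithin_le_nhds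
          refine (le_of_tendsto_of_tendsto hpl hlim ?_).trans hC0
          filter_upwards [self_mem_nhdsWithin] with v hv
          have h2 := hR (show R ≤ ‖v‖ by linarith [norm_nonneg v]) z
          rw [dist_zero_left, norm_div, Real.norm_eq_abs, Real.norm_eq_abs,
            div_lt_iff₀ (abs_pos.2 hv)] at h2
          exact h2.le
      · have h2 := hR (show R ≤ ‖u‖ from hu) z
        rw [dist_zero_left, norm_div, Real.norm_eq_abs, Real.norm_eq_abs,
          div_lt_iff₀ (abs_pos.2 hu0)] at h2
        linarith
  refine ⟨C ^ 2 / (2 * η), fun z x => ?_⟩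
  have h3 := intervalIntegral.norm_integral_le_of_norm_le_const (a := 0) (b := x)
    (f := p z) (C := η / 2 * |x| + C) (fun τ hτ => by
      refine (hb z τ).trans ?_
      have : |τ| ≤ |x| := by
        rcases le_total 0 x with h0 | h0
        · rw [Set.uIoc_of_le h0] at hτ
          rw [abs_of_pos hτ.1, abs_of_nonneg h0]; exact hτ.2
        · rw [Set.uIoc_of_ge h0] at hτ
          rw [abs_of_nonpos hτ.2, abs_of_nonpos h0]; linarith [hτ.1]
      gcongr)
  refine h3.trans ?_
  rw [sub_zero, ← sq_abs x]
  have h4 : η * |x| ^ 2 + C ^ 2 / (2 * η) - (η / 2 * |x| + C) * |x| =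
      (η * |x| - C) ^ 2 / (2 * η) := by field_simp; ring
  have h5 : 0 ≤ (η * |x| - C) ^ 2 / (2 * η) := by positivity
  linarith

/-- The dual nonlinearity `c u - (a u⁺ - b u⁻ + p)`. -/
noncomputable def dualNonlinearity (c a b : ℝ) (p : Strip → ℝ → ℝ) (z : Strip) (x : ℝ) : ℝ :=
  c * x - nonlinearity a b p z x

theorem continuous_dualNonlinearity (c a b : ℝ) {p : Strip → ℝ → ℝ}
    (hp : Continuous (Function.uncurry p)) :
    Continuous (Function.uncurry (dualNonlinearity c a b p)) :=
  (continuous_snd.const_mul c).sub (continuous_nonlinearity a b hp)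

theorem primitive_dualNonlinearity (c a b : ℝ) {p : Strip → ℝ → ℝ}
    (hp : Continuous (Function.uncurry p)) (z : Strip) (x : ℝ) :
    primitive (dualNonlinearity c a b p) z x =
      primitive (jump (c - a) (c - b)) z x - primitive p z x := by
  have h : primitive (jump (c - a) (c - b)) z x =
      primitive (dualNonlinearity c a b p) z x + primitive p z x := by
    rw [← primitive_add (continuous_dualNonlinearity c a b hp) hp]
    congr 1
    funext z x
    rw [dualNonlinearity, nonlinearity]
    rcases le_total 0 x with hx | hx
    · rw [jump_of_nonneg _ _ _ hx, max_eq_left hx, max_eq_right (by linarith)]; ring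
    · rw [jump_of_nonpos _ _ _ hx, max_eq_right hx, max_eq_left (by linarith)]; ring
  rw [h]; ring

theorem SlopeBounds.nonlinearity {c a b σ L : ℝ} {p : Strip → ℝ → ℝ}
    (h : SlopeBounds (dualNonlinearity c a b p) σ L) :
    SlopeBounds (nonlinearity a b p) (c - L) (c - σ) := by
  intro z
  constructor
  · intro x y hxy
    have := (h z).2 hxy
    simp only [dualNonlinearity] at this ⊢
    linarith
  · intro x y hxy
    have := (h z).1 hxy
    simp only [dualNonlinearity] at this ⊢
    linarith

/-- If `λ_k < 0` then `c < 0`, and any positive `L` will do: (H3′) gives `c - min {a, b} + 1/ε'`. If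
`λ_k > 0`, (H2′) gives `L = c - ε'`, so that `1/L > 1/c`. -/
theorem exists_slopeBounds_dualNonlinearity {k : ℤ} {a b c ε : ℝ} {p : Strip → ℝ → ℝ}
    (hk : eig k ≠ 0) (hc : InGap k c) (hε : 0 < ε) (hcε : eig (k + 1) - ε / 2 ≤ c)
    (h1 : ∀ z, Antitone fun u => nonlinearity a b p z u - (eig (k + 1) - ε) * u)
    (h2 : HypH2' k a b p) (h3 : HypH3' k p) :
    ∃ L, max 0 (1 / c) < 1 / L ∧ 0 < L ∧
      SlopeBounds (dualNonlinearity c a b p) (ε / 2) L := by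
  have hmono : ∀ z, Monotone fun x => dualNonlinearity c a b p z x - ε / 2 * x := by
    intro z x y hxy
    have h4 := h1 z hxy
    simp only [dualNonlinearity] at h4 ⊢
    have h5 : (eig (k + 1) - ε / 2) * (y - x) ≤ c * (y - x) :=
      mul_le_mul_of_nonneg_right hcε (sub_nonneg.2 hxy)
    linarith
  have key : ∀ L, (∀ z, Antitone fun x => dualNonlinearity c a b p z x - L * x) →
      SlopeBounds (dualNonlinearity c a b p) (ε / 2) L ∧ 0 < L := fun L hL => by
    have hs : SlopeBounds (dualNonlinearity c a b p) (ε / 2) L := fun z => ⟨hmono z, hL z⟩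
    exact ⟨hs, lt_of_lt_of_le (by positivity) hs.le⟩
  rcases lt_or_gt_of_ne hk with hk | hk
  · obtain ⟨ε', hε', h⟩ := h3 hk
    obtain ⟨hs, hL⟩ := key (c - min a b + 1 / ε') (fun z x y hxy => by
      have h4 := h z hxy
      have h5 := (slopeBounds_jump a b z).1 hxy
      simp only [dualNonlinearity, nonlinearity, jump] at h4 h5 ⊢
      linarith)
    refine ⟨_, max_lt (by positivity) ?_, hL, hs⟩
    have h6 : 1 / c < 0 := one_div_neg.2 (hc.2.trans_le (eig_succ_nonpos hk))
    exact h6.trans (by positivity)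
  · obtain ⟨ε', hε', h⟩ := h2 hk
    obtain ⟨hs, hL⟩ := key (c - ε') (fun z x y hxy => by
      have h4 := h z hxy
      simp only [dualNonlinearity] at h4 ⊢
      linarith)
    exact ⟨_, max_lt (by positivity) (one_div_lt_one_div_of_lt hL (by linarith)), hL, hs⟩

/-- Coercivity of the dual functional: the convex conjugate is bounded below by the energy of
the piecewise linear problem. -/
theorem exists_jumpEnergy_le_conjugate {c a b η : ℝ} {p : Strip → ℝ → ℝ} {K' : L2Strip → ℝ}
    (ha : a < c) (hb : b < c) (hη : 0 < η) (hp : Continuous (Function.uncurry p))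
    (hsub : SublinearAtInfinity p)
    {σ L : ℝ} (hs : SlopeBounds (dualNonlinearity c a b p) σ L)
    (hK : ∀ u v : L2Strip, inner ℝ u v
      - ∫ z, primitive (dualNonlinearity c a b p) z (u z) ∂stripMeasure ≤ K' v) :
    ∃ C, ∀ v, jumpEnergy (1 / (c - a)) (1 / (c - b)) v - η * ‖v‖ ^ 2 - C ≤ K' v := by
  have hpa : 0 < c - a := sub_pos.2 ha
  have hpb : 0 < c - b := sub_pos.2 hb
  set m := min (c - a) (c - b) with hm
  have hm0 : 0 < m := lt_min hpa hpb
  -- The factor `m²` compensates for `‖u‖ ≤ ‖v‖/m`, with `u` the test vector below.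
  obtain ⟨C, hC⟩ := hsub.abs_primitive_le hp (η := η * m ^ 2) (by positivity)
  refine ⟨∫ _, C ∂stripMeasure, fun v => ?_⟩
  -- The conjugate is tested at the vector that would be optimal for `p = 0`.
  set u := jumpOp (1 / (c - a)) (1 / (c - b)) v with hu
  have hvu : jumpOp (c - a) (c - b) u = v := by
    rw [hu, jumpOp_jumpOp (by positivity) (by positivity), mul_one_div_cancel hpa.ne',
      mul_one_div_cancel hpb.ne', jumpOp_one]
  have e1 : inner ℝ u v = 2 * jumpEnergy (1 / (c - a)) (1 / (c - b)) v := inner_jumpOp_self _ _ v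
  have e2 : inner ℝ v u = 2 * jumpEnergy (c - a) (c - b) u := by
    have := inner_jumpOp_self (c - a) (c - b) u
    rwa [hvu] at this
  have hnorm : m * ‖u‖ ≤ ‖v‖ := by
    have h1 := jumpEnergy_lower (min_le_left (c - a) (c - b)) (min_le_right _ _) u
    rw [← hm] at h1
    have h2 : inner ℝ v u ≤ ‖v‖ * ‖u‖ := real_inner_le_norm _ _
    rcases (norm_nonneg u).eq_or_lt with h0 | h0
    · rw [← h0, mul_zero]; exact norm_nonneg v
    · refine le_of_mul_le_mul_right ?_ h0
      linarith
  have hnorm2 : m ^ 2 * ‖u‖ ^ 2 ≤ ‖v‖ ^ 2 := by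
    rw [← mul_pow]
    exact pow_le_pow_left₀ (by positivity) hnorm 2
  have hΨ : ∫ z, primitive (dualNonlinearity c a b p) z (u z) ∂stripMeasure ≤
      jumpEnergy (c - a) (c - b) u + (η * m ^ 2 * ‖u‖ ^ 2 + ∫ _, C ∂stripMeasure) := by
    have i1 := integrable_primitive (continuous_jump (c - a) (c - b)) (slopeBounds_jump _ _) u
    have i2 : Integrable (fun z => (u z) ^ 2) stripMeasure := (Lp.memLp u).integrable_sq
    have i3 : Integrable (fun _ : Strip => C) stripMeasure := integrable_const C
    rw [jumpEnergy, norm_sq_eq_integral, ← integral_const_mul,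
      ← integral_add (i2.const_mul _) i3, ← integral_add i1 (by exact (i2.const_mul _).add i3)]
    refine integral_mono (integrable_primitive (continuous_dualNonlinearity c a b hp) hs u)
      (by exact i1.add ((i2.const_mul _).add i3)) fun z => ?_
    simp only
    rw [primitive_dualNonlinearity c a b hp]
    have := (_root_.abs_le.1 (hC z (u z))).1
    linarith
  have h1 := hK u v
  rw [real_inner_comm] at e2
  have h2 := mul_le_mul_of_nonneg_left hnorm2 hη.le
  linarith

/-- Existence of a weak solution when the form at a shift `c` close to `λ_{k+1}` is negative
definite. -/
theorem exists_isWeakSolution {k : ℤ} {a b c ε : ℝ} {p : Strip → ℝ → ℝ}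
    (hk : eig k ≠ 0) (hc : InGap k c) (ha : a < c) (hb : b < c) (hneg : FucikNeg c a b)
    (hp : Continuous (Function.uncurry p)) (hsub : SublinearAtInfinity p)
    (hε : 0 < ε) (hcε : eig (k + 1) - ε / 2 ≤ c)
    (h1 : ∀ z, Antitone fun u => nonlinearity a b p z u - (eig (k + 1) - ε) * u)
    (h2 : HypH2' k a b p) (h3 : HypH3' k p) :
    ∃ w : sobolevSpace × kernelSpace, IsWeakSolution a b p w := by
  obtain ⟨L, hLc, hL, hs⟩ := exists_slopeBounds_dualNonlinearity hk hc hε hcε h1 h2 h3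
  have hh := continuous_dualNonlinearity c a b hp
  obtain ⟨K', R, hNR, hK', hfen⟩ :=
    (quadBounds_superpose hh hs).exists_conjugate (half_pos hε) hL
  obtain ⟨δ, hδ, hform⟩ := hneg
  -- Definiteness gives coercivity with constant `δ/2`; half of it is spent on the perturbation `p`.
  obtain ⟨C, hC⟩ := exists_jumpEnergy_le_conjugate ha hb (η := δ / 4) (by positivity) hp hsub hs
    hfen
  obtain ⟨ρ, hρ1, hρ2⟩ := exists_between hLc
  have hρ0 : 0 < ρ := (le_max_left _ _).trans_lt hρ1
  obtain ⟨J, hJ⟩ := exists_finset_resolventMul_le hρ0 ((le_max_right 0 (1 / c)).trans hρ1.le)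
  obtain ⟨v, hv⟩ := exists_critical_of_coercive (coordMap unitMode J)
    (D := fun v => K' v - inner ℝ (diagOp unitMode (resolventMul c) v) v / 2)
    (n := fun v => R v - diagOp unitMode (resolventMul c) v)
    (half_pos (sub_pos.2 hρ2)) (δ := δ / 4) (B := C) (by positivity)
    (hK'.sub_diagOp_lower orthonormal_unitMode hc.abs_resolventMul_le hc.gapBound_nonneg
      hρ0.le hJ)
    (hK'.sub_diagOp_upper orthonormal_unitMode hc.abs_resolventMul_le hc.gapBound_nonneg)
    (fun v => by
      have e1 := hC v
      have e2 := hform v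
      rw [fucikForm] at e2
      linarith)
  obtain ⟨w, hw1, hw2⟩ := exists_weak_of_diagOp (fun i => hc.ne_modeEig i)
    hc.abs_resolventMul_le v
  refine ⟨w, isWeakSolution_of_inner_eq hp hs.nonlinearity fun d => ?_⟩
  -- Criticality says that `u = (c - □)⁻¹v` is also `∇Ψ*(v)`; hence `v = cu - f(u)`, and `cu - v` is
  -- the right-hand side of (1).
  have hu : toFunction w = R v := hw1.trans (sub_eq_zero.1 hv).symm
  have hNv : superpose _ hh hs (toFunction w) = v := by rw [hu, hNR]
  rw [hw2]
  congr 1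
  refine Lp.ext ?_
  have a1 := coeFn_superpose hh hs (toFunction w)
  rw [hNv] at a1
  filter_upwards [a1, coeFn_superpose (continuous_nonlinearity a b hp) hs.nonlinearity
    (toFunction w), Lp.coeFn_sub (c • toFunction w) v,
    Lp.coeFn_smul c (toFunction w)] with z h4 h5 h6 h7
  rw [h6, h5, Pi.sub_apply, h7, h4, Pi.smul_apply, smul_eq_mul, dualNonlinearity,
    sub_sub_cancel]

end WaveFucik

/-! ### The existence theorem. -/

open WaveFucik
theorem mainTheorem4 (k : ℤ) (hk : eig k ≠ 0) (a b : ℝ) (hab : (a, b) ∈ aboveD k)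
    (p : Strip → ℝ → ℝ) (hp : Continuous (Function.uncurry p))
    (hsub : SublinearAtInfinity p)
    (h1 : HypH1' k a b p) (h2 : HypH2' k a b p) (h3 : HypH3' k p) :
    ∃ w : sobolevSpace × kernelSpace, IsWeakSolution a b p w := by
  obtain ⟨habT, ε₃, ε₄, hadm, habove⟩ := hab
  obtain ⟨hR, hneg⟩ := fucikNeg_of_mem_aboveInSquare hadm habove
  obtain ⟨ε, hε, h1⟩ := h1
  have hc := hadm.inGap
  have ha : a < eig (k + 1) - ε₃ := hR.1.2
  have hb : b < eig (k + 1) - ε₃ := hR.2.2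
  have hle := le_max_left (eig (k + 1) - ε₃) (eig (k + 1) - ε / 2)
  have hc' : InGap k (max (eig (k + 1) - ε₃) (eig (k + 1) - ε / 2)) :=
    ⟨hc.1.trans_le hle, max_lt hc.2 (by linarith)⟩
  -- The maximum of the two shifts is at least `λ_{k+1} - ε₃`, where definiteness is known, and at
  -- least `λ_{k+1} - ε/2`, where (H1′) leaves slope `ε/2` for the dual nonlinearity.
  refine exists_isWeakSolution hk hc' (ha.trans_le hle) (hb.trans_le hle)
    (hneg.mono hc ha hb hle hc' fun x hx => ?_) hp hsub hε (le_max_right _ _) h1 h2 h3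
  exact max_lt_min_of_mem_squareRTilde habT ⟨hc.1.trans_le hx.1, hx.2.trans_lt hc'.2⟩
    (ha.trans_le hx.1) (hb.trans_le hx.1)
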